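/- **Setting.** Let $M^m$ and $M^{n-m}$ be smooth (Hausdorff) manifolds of dimensions $m$ and $n-m$ with local coordinates $(x^a)$ and $(x^\alpha)$, and let $u^a=\dot x^a$ be the fibre coordinates on $TM^m$. Consider a smooth constrained second order system $$\ddot x^a=F^a(t,x^b,x^\beta,\dot x^b),\qquad \dot x^\alpha=\Psi^\alpha(t,x^b,x^\beta,\dot x^b)$$ on $M=M^m\times M^{n-m}$. Its constraint submanifold $\tilde E=\{u^\alpha=\Psi^\alpha\}\subset\mathbb R\times TM$ is identified with $\mathbb R\times TM^m\times M^{n-m}$ by means of the coordinates $(t,x^a,u^a,x^\alpha)$. Put $$\tilde\Gamma=\frac{\partial}{\partial t}+u^a\frac{\partial}{\partial x^a}+\Psi^\beta\frac{\partial}{\partial x^\beta}+F^b\frac{\partial}{\partial u^b},\qquad \tilde\Gamma^b_a=-\tfrac12\frac{\partial F^b}{\partial u^a},\qquad \Psi^\beta_a=-\frac{\partial\Psi^\beta}{\partial u^a},$$ $$\tilde V_a=\frac{\partial}{\partial u^a},\qquad \tilde H_a=\frac{\partial}{\partial x^a}-\tilde\Gamma^b_a\frac{\partial}{\partial u^b}-\Psi^\beta_a\frac{\partial}{\partial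 x^\beta}.$$ The frame $\{\tilde\Gamma,\partial/\partial x^\alpha,\tilde V_a,\tilde H_a\}$ has the dual coframe $\{dt,\eta^\alpha,\tilde\psi^a,\theta^a\}$ with $$\theta^a=dx^a-u^a\,dt,\qquad \tilde\psi^a=du^a-F^a\,dt+\tilde\Gamma^a_b\theta^b,\qquad \eta^\alpha=dx^\alpha-\Psi^\alpha\,dt+\Psi^\alpha_b\theta^b.$$ These define on $\tilde E$ the projectors $$P_{\tilde\Gamma}=dt\otimes\tilde\Gamma,\quad N=\eta^\alpha\otimes\frac{\partial}{\partial x^\alpha},\quad P_V=\tilde\psi^a\otimes\tilde V_a,\quad P_H=\theta^a\otimes\tilde H_a$$ and the tensors $S=\theta^a\otimes\tilde V_a$ and $Q=\tilde\psi^a\otimes\tilde H_a$. Let a smooth linear connection on $M^{n-m}$, not necessarily symmetric, with coefficients $\Upsilon^\gamma_{\alpha\beta}$ be given. On the images of $P_{\tilde\Gamma}$, $N$, $P_H$, $P_V$ take the submodule derivatives $$\nabla^{\tilde\Gamma}_XY=X(dt(Y))\,\tilde\Gamma,\qquad \nabla^N_XY=\bigl(X(Y^\gamma)+\Upsilon^\gamma_{\alpha\beta}X^\alpha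 Y^\beta\bigr)\frac{\partial}{\partial x^\gamma},$$ $$\nabla^{\tilde H}_XY=Q([X,S(Y)]),\qquad \nabla^{\tilde V}_XY=S([X,Q(Y)]),$$ and for a submodule derivative $\nabla^P$ on the image of a projector $P$ put $\bar\nabla^P_XY=\nabla^P_{P(X)}Y+P([X-P(X),Y])$, for every vector field $X$ and every $Y$ in the image of $P$. **Theorem.** The formula $$\tilde\nabla_XY=\bar\nabla^{\tilde\Gamma}_X(P_{\tilde\Gamma}(Y))+\bar\nabla^N_X(N(Y))+\bar\nabla^{\tilde H}_X(P_H(Y))+\bar\nabla^{\tilde V}_X(P_V(Y))$$ defines a smooth linear connection on $\tilde E$. Explicitly, $$\begin{aligned}\tilde\nabla_XY={}&X(dt(Y))\,\tilde\Gamma+\nabla^N_{N(X)}(N(Y))+Q([P_H(X),S(Y)])+S([P_V(X),Q(Y)])\\&+N([X-N(X),N(Y)])+P_H([X-P_H(X),P_H(Y)])+P_V([X-P_V(X),P_V(Y)]).\end{aligned}$$ Let $T(X,Y)=\nabla_XY-\nabla_YX-[X,Y]$ and $R(X,Y)Z=\nabla_X\nabla_YZ-\nabla_Y\nabla_XZ-\nabla_{[X,Y]}Z$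 denote the torsion and the curvature of a linear connection $\nabla$. Then $\tilde\nabla$ is the unique smooth linear connection $\nabla$ on $\tilde E$ with the following properties: - $\nabla\tilde\Gamma=0$, $\nabla dt=0$, $\nabla S=0$, $\nabla Q=0$; - $\nabla_{\tilde V_a}\tilde V_b=0$ in all adapted coordinates; - $P_H(X)=T(\tilde\Gamma,S(X))$ and $P_V(X)=S(T(\tilde\Gamma,X))$ for all $X$; - $R(\tilde\Gamma,\tilde V_a)=0$; - $\nabla N=0$; - $\nabla_{\partial/\partial x^\alpha}\,\partial/\partial x^\beta=\Upsilon^\gamma_{\alpha\beta}\,\partial/\partial x^\gamma$; - $(I-P_V)\bigl(T((I-N)(X),N(Y))\bigr)=0$ for all $X,Y$. -/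

import Mathlib

open Bundle Manifold VectorField
open scoped Manifold ContDiff Topology

noncomputable section

namespace ConstrainedSODE

/-! ### The constraint submanifold and its tangent vectors

The configuration space is `ℝ × M × B`, where `M` is the factor with the coordinates `x^a` and `B`
is the constraint factor with the coordinates `x^α`.  The constraint submanifold
`{u^α = Ψ^α(t, x^a, x^α, u^a)}` of `ℝ × T(M × B)` is the graph of `Ψ`, and it is parametrised by the
points `(t, v, y)` of `ℝ × TM × B`, that is, by the coordinates `(t, (x^a, u^a), x^α)`. -/

section Space

variable (E : Type*) [NormedAddCommGroup E] [NormedSpace ℝ E]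
  (M : Type*) [TopologicalSpace M] [ChartedSpace E M] [IsManifold 𝓘(ℝ, E) ∞ M]
  (E' : Type*) [NormedAddCommGroup E'] [NormedSpace ℝ E']
  (B : Type*) [TopologicalSpace B] [ChartedSpace E' B] [IsManifold 𝓘(ℝ, E') ∞ B]

/-- The constraint submanifold, parametrised by `(t, (x^a, u^a), x^α)`. -/
abbrev Space : Type _ := ℝ × TangentBundle 𝓘(ℝ, E) M × B

/-- The vector space on which the constraint submanifold is modelled. -/
abbrev Model : Type _ := ℝ × (E × E) × E'

/-- The (boundaryless) model with corners of the constraint submanifold. -/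
abbrev model : ModelWithCorners ℝ (Model E E') (ModelProd ℝ (ModelProd (ModelProd E E) E')) :=
  𝓘(ℝ, ℝ).prod (𝓘(ℝ, E).tangent.prod 𝓘(ℝ, E'))

/-- The tangent space of the constraint submanifold at `p`. -/
abbrev Tan (p : Space E M B) : Type _ := TangentSpace (model E E') p

/-- Vector fields (without a smoothness condition) on the constraint submanifold. -/
abbrev VField : Type _ := ∀ p : Space E M B, Tan E M E' B p

end Space

variable {E : Type*} [NormedAddCommGroup E] [NormedSpace ℝ E]
  {M : Type*} [TopologicalSpace M] [ChartedSpace E M] [IsManifold 𝓘(ℝ, E) ∞ M]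
  {E' : Type*} [NormedAddCommGroup E'] [NormedSpace ℝ E']
  {B : Type*} [TopologicalSpace B] [ChartedSpace E' B] [IsManifold 𝓘(ℝ, E') ∞ B]

/-- The vector field `X` is smooth. -/
def Smooth (X : VField E M E' B) : Prop :=
  ContMDiff (model E E') (model E E').tangent ∞
    (fun p => (⟨p, X p⟩ : TangentBundle (model E E') (Space E M B)))

/-- The components `(τ, (a, w), b)` of the tangent vector
`τ ∂/∂t + a^a ∂/∂x^a + w^a ∂/∂u^a + b^α ∂/∂x^α` at `p = (t, (x, u), y)`.  The coordinates are those
of the preferred charts at `x` and `y`; the preferred chart of `TM` at `(x, u)` is the one induced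
by the preferred chart of `M` at `x`, and a tangent space is by definition the space of the
components in the preferred chart. -/
def comp {p : Space E M B} (ξ : Tan E M E' B p) : Model E E' := ξ

/-- The tangent vector at `p` with the given components, the inverse of `comp`. -/
def vec (p : Space E M B) (τ : ℝ) (a w : E) (b : E') : Tan E M E' B p :=
  (show Model E E' from (τ, (a, w), b))

/-- The velocity components `u^a` at the point `p = (t, (x, u), y)`. -/
def vel (p : Space E M B) : E := p.2.1.2

end ConstrainedSODE

variable (E : Type*) [NormedAddCommGroup E] [NormedSpace ℝ E]
  (M : Type*) [TopologicalSpace M] [ChartedSpace E M] [IsManifold 𝓘(ℝ, E) ∞ M]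
  (E' : Type*) [NormedAddCommGroup E'] [NormedSpace ℝ E']
  (B : Type*) [TopologicalSpace B] [ChartedSpace E' B] [IsManifold 𝓘(ℝ, E') ∞ B] in
/-- A constrained second order system `ẍ^a = F^a(t, x^b, x^β, ẋ^b)`, `ẋ^α = Ψ^α(t, x^b, x^β, ẋ^b)`.
The first part is a smooth map assigning to `(t, v, y)` a second order vector at `v ∈ TM`, i.e. a
vector `u^a ∂/∂x^a + F^a ∂/∂u^a` whose projection to `M` is `v` itself; the second part is a smooth
map assigning to `(t, v, y)` a vector `Ψ^α ∂/∂x^α` at `y ∈ B`. -/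
structure ConstrainedSODE where
  /-- the vector `u^a ∂/∂x^a + F^a ∂/∂u^a` -/
  F : ∀ p : ConstrainedSODE.Space E M B, TangentSpace 𝓘(ℝ, E).tangent p.2.1
  /-- the vector `Ψ^α ∂/∂x^α` -/
  Ψ : ∀ p : ConstrainedSODE.Space E M B, TangentSpace 𝓘(ℝ, E') p.2.2
  smooth_F : ContMDiff (ConstrainedSODE.model E E') 𝓘(ℝ, E).tangent.tangent ∞
    (fun p => (⟨p.2.1, F p⟩ : TangentBundle 𝓘(ℝ, E).tangent (TangentBundle 𝓘(ℝ, E) M)))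
  smooth_Ψ : ContMDiff (ConstrainedSODE.model E E') 𝓘(ℝ, E').tangent ∞
    (fun p => (⟨p.2.2, Ψ p⟩ : TangentBundle 𝓘(ℝ, E') B))
  second_order : ∀ p, mfderiv 𝓘(ℝ, E).tangent 𝓘(ℝ, E)
    (fun v : TangentBundle 𝓘(ℝ, E) M => v.1) p.2.1 (F p) = p.2.1.2

namespace ConstrainedSODE

variable {E : Type*} [NormedAddCommGroup E] [NormedSpace ℝ E]
  {M : Type*} [TopologicalSpace M] [ChartedSpace E M] [IsManifold 𝓘(ℝ, E) ∞ M]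
  {E' : Type*} [NormedAddCommGroup E'] [NormedSpace ℝ E']
  {B : Type*} [TopologicalSpace B] [ChartedSpace E' B] [IsManifold 𝓘(ℝ, E') ∞ B]

section Tensors

variable (s : ConstrainedSODE E M E' B) (p : Space E M B)

/-- The components `F^a` at the point `p`. -/
def force : E := (show E × E from s.F p).2

/-- The components `Ψ^α` at the point `p`. -/
def psi : E' := s.Ψ p

/-- The map with the matrix `Γ^b_a = -(1/2) ∂F^b/∂u^a`.  All points of the fibre `T_x M` have the
same preferred chart, so that `u ↦ F^b` is a map of vector spaces. -/
def connCoeff : E →L[ℝ] E :=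
  (-(1 / 2 : ℝ)) • fderiv ℝ (fun u : E => s.force (p.1, ⟨p.2.1.1, u⟩, p.2.2)) (vel p)

/-- The map with the matrix `Ψ^β_a = -∂Ψ^β/∂u^a`. -/
def psiCoeff : E →L[ℝ] E' :=
  -fderiv ℝ (fun u : E => s.psi (p.1, ⟨p.2.1.1, u⟩, p.2.2)) (vel p)

/-- The field `Γ = ∂/∂t + u^a ∂/∂x^a + Ψ^β ∂/∂x^β + F^b ∂/∂u^b`. -/
def Γ : Tan E M E' B p := vec p 1 (vel p) (s.force p) (s.psi p)

variable {p}

/-- The form `dt`. -/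
def dt (ξ : Tan E M E' B p) : ℝ := (comp ξ).1

/-- The forms `θ^a = dx^a - u^a dt`. -/
def θ (ξ : Tan E M E' B p) : E := (comp ξ).2.1.1 - dt ξ • vel p

/-- The forms `ψ^a = φ^a + Γ^a_b θ^b`, where `φ^a = du^a - F^a dt`. -/
def ψ (ξ : Tan E M E' B p) : E :=
  ((comp ξ).2.1.2 - dt ξ • s.force p) + s.connCoeff p (θ ξ)

/-- The forms `η^α = θ^α + Ψ^α_b θ^b`, where `θ^α = dx^α - Ψ^α dt`. -/
def η (ξ : Tan E M E' B p) : E' :=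
  ((comp ξ).2.2 - dt ξ • s.psi p) + s.psiCoeff p (θ ξ)

variable (p)

/-- The vertical vector `w^a V_a`, where `V_a = ∂/∂u^a`. -/
def vert (w : E) : Tan E M E' B p := vec p 0 0 w 0

/-- The horizontal vector `a^a H_a`, where
`H_a = ∂/∂x^a - Γ^b_a ∂/∂u^b - Ψ^β_a ∂/∂x^β`. -/
def horiz (a : E) : Tan E M E' B p := vec p 0 a (-s.connCoeff p a) (-s.psiCoeff p a)

/-- The vector `b^α ∂/∂x^α`. -/
def cons (b : E') : Tan E M E' B p := vec p 0 0 0 b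

/-- The vertical endomorphism `S = θ^a ⊗ V_a`. -/
def S (ξ : Tan E M E' B p) : Tan E M E' B p := vert p (θ ξ)

/-- The tensor `Q = ψ^a ⊗ H_a`. -/
def Q (ξ : Tan E M E' B p) : Tan E M E' B p := s.horiz p (s.ψ ξ)

/-- The projector `P_Γ = dt ⊗ Γ`. -/
def PΓ (ξ : Tan E M E' B p) : Tan E M E' B p := dt ξ • s.Γ p

/-- The projector `N = η^α ⊗ ∂/∂x^α`. -/
def N (ξ : Tan E M E' B p) : Tan E M E' B p := cons p (s.η ξ)

/-- The projector `P_H = θ^a ⊗ H_a`. -/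
def PH (ξ : Tan E M E' B p) : Tan E M E' B p := s.horiz p (θ ξ)

/-- The projector `P_V = ψ^a ⊗ V_a`. -/
def PV (ξ : Tan E M E' B p) : Tan E M E' B p := vert p (s.ψ ξ)

end Tensors

section Derivatives

/-- A field of endomorphisms of the tangent spaces, applied to a vector field. -/
def app (A : ∀ p : Space E M B, Tan E M E' B p → Tan E M E' B p) (X : VField E M E' B) :
    VField E M E' B := fun p => A p (X p)

/-- The Lie bracket `[X, Y]`. -/
def bracket (X Y : VField E M E' B) : VField E M E' B := mlieBracket (model E E') X Y

/-- The derivative `X(f)` of the function `f`. -/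
def dirDeriv (X : VField E M E' B) (f : Space E M B → ℝ) (p : Space E M B) : ℝ :=
  mvfderiv (model E E') f p (X p)

/-- The function `dt(Y)`. -/
def dtFun (Y : VField E M E' B) : Space E M B → ℝ := fun p => dt (Y p)

variable (s : ConstrainedSODE E M E' B)

/-- The submodule derivative `∇^Γ_X Y = X(dt(Y)) Γ`. -/
def derivΓ (X Y : VField E M E' B) : VField E M E' B :=
  fun p => dirDeriv X (dtFun Y) p • s.Γ p

/-- The submodule derivative `∇^N_X Y = (X(Y^γ) + Υ^γ_{αβ} X^α Y^β) ∂/∂x^γ` on the fields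
`X = X^α ∂/∂x^α`, `Y = Y^α ∂/∂x^α`, where `Υ^γ_{αβ}` are the coefficients of the linear connection
`D` on `B`: the derivative at `(t, v, y)`, with respect to `D`, of the restriction of `Y` to the
slice `{(t, v)} × B`.  (In Mathlib, `D Z y b` is the value of `D_b Z` at `y`.) -/
def derivN (D : CovariantDerivative 𝓘(ℝ, E') E' (TangentSpace 𝓘(ℝ, E') : B → Type _))
    (X Y : VField E M E' B) : VField E M E' B :=
  fun p => cons p (D (fun y => (comp (Y (p.1, p.2.1, y))).2.2) p.2.2 (comp (X p)).2.2)

/-- The submodule derivative `∇^H_X Y = Q([X, S(Y)])`. -/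
def derivH (X Y : VField E M E' B) : VField E M E' B := app s.Q (bracket X (app S Y))

/-- The submodule derivative `∇^V_X Y = S([X, Q(Y)])`. -/
def derivV (X Y : VField E M E' B) : VField E M E' B := app S (bracket X (app s.Q Y))

/-- The extension `∇̄_X Y = ∇_{P(X)} Y + P([X - P(X), Y])` of a submodule derivative on the image of
the projector `P`, to all vector fields `X`. -/
def extend (P : ∀ p : Space E M B, Tan E M E' B p → Tan E M E' B p)
    (d : VField E M E' B → VField E M E' B → VField E M E' B) (X Y : VField E M E' B) :
    VField E M E' B :=
  d (app P X) Y + app P (bracket (X - app P X) Y)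

/-- The derivative glued from the four submodule derivatives. -/
def glued (D : CovariantDerivative 𝓘(ℝ, E') E' (TangentSpace 𝓘(ℝ, E') : B → Type _))
    (X Y : VField E M E' B) : VField E M E' B :=
  extend s.PΓ s.derivΓ X (app s.PΓ Y) + extend s.N (derivN D) X (app s.N Y)
    + extend s.PH s.derivH X (app s.PH Y) + extend s.PV s.derivV X (app s.PV Y)

/-- The explicit formula for the glued derivative. -/
def explicit (D : CovariantDerivative 𝓘(ℝ, E') E' (TangentSpace 𝓘(ℝ, E') : B → Type _))
    (X Y : VField E M E' B) : VField E M E' B :=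
  (fun p => dirDeriv X (dtFun Y) p • s.Γ p) + derivN D (app s.N X) (app s.N Y)
    + app s.Q (bracket (app s.PH X) (app S Y)) + app S (bracket (app s.PV X) (app s.Q Y))
    + app s.N (bracket (X - app s.N X) (app s.N Y))
    + app s.PH (bracket (X - app s.PH X) (app s.PH Y))
    + app s.PV (bracket (X - app s.PV X) (app s.PV Y))

end Derivatives

section Conditions

/-- Covariant derivatives on the tangent bundle of the constraint submanifold. -/
abbrev Conn (E : Type*) [NormedAddCommGroup E] [NormedSpace ℝ E]
    (M : Type*) [TopologicalSpace M] [ChartedSpace E M] [IsManifold 𝓘(ℝ, E) ∞ M]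
    (E' : Type*) [NormedAddCommGroup E'] [NormedSpace ℝ E']
    (B : Type*) [TopologicalSpace B] [ChartedSpace E' B] [IsManifold 𝓘(ℝ, E') ∞ B] : Type _ :=
  CovariantDerivative (model E E') (Model E E')
    (TangentSpace (model E E') : Space E M B → Type _)

/-- `∇_X Y`. -/
def nabla (C : Conn E M E' B) (X Y : VField E M E' B) : VField E M E' B := fun p => C Y p (X p)

/-- `(∇_X A)(Y) = ∇_X (A(Y)) - A(∇_X Y)` for a tensor `A` of type `(1,1)`. -/
def nablaEndo (C : Conn E M E' B) (A : ∀ p : Space E M B, Tan E M E' B p → Tan E M E' B p)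
    (X Y : VField E M E' B) : VField E M E' B :=
  nabla C X (app A Y) - app A (nabla C X Y)

/-- The curvature `R(X, Y)Z = ∇_X ∇_Y Z - ∇_Y ∇_X Z - ∇_{[X, Y]} Z`. -/
def curv (C : Conn E M E' B) (X Y Z : VField E M E' B) : VField E M E' B :=
  nabla C X (nabla C Y Z) - nabla C Y (nabla C X Z) - nabla C (bracket X Y) Z

/-- The vertical lift of a vector field on `M`: the lift of `W^a ∂/∂x^a` is `W^a V_a`. -/
def vertLift (W : ∀ x : M, TangentSpace 𝓘(ℝ, E) x) : VField E M E' B :=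
  fun p => vert p (W p.2.1.1)

/-- The lift of a vector field on `B` along the product structure: the lift of `Z^α ∂/∂x^α` is
`Z^α ∂/∂x^α`. -/
def consLift (Z : ∀ y : B, TangentSpace 𝓘(ℝ, E') y) : VField E M E' B :=
  fun p => cons p (Z p.2.2)

variable [FiniteDimensional ℝ E] [FiniteDimensional ℝ E']

/-- The torsion `T`, a tensor. -/
def tors (C : Conn E M E' B) {p : Space E M B} (ξ ζ : Tan E M E' B p) : Tan E M E' B p :=
  C.torsion p ξ ζ

/-- The conditions that single out the connection. -/
structure Characterizes (s : ConstrainedSODE E M E' B)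
    (D : CovariantDerivative 𝓘(ℝ, E') E' (TangentSpace 𝓘(ℝ, E') : B → Type _))
    (C : Conn E M E' B) : Prop where
  /-- `∇Γ = 0` -/
  nabla_Γ : ∀ X, Smooth X → nabla C X s.Γ = 0
  /-- `∇dt = 0` -/
  nabla_dt : ∀ X Y, Smooth X → Smooth Y → dirDeriv X (dtFun Y) - dtFun (nabla C X Y) = 0
  /-- `∇S = 0` -/
  nabla_S : ∀ X Y, Smooth X → Smooth Y → nablaEndo C S X Y = 0
  /-- `∇Q = 0` -/
  nabla_Q : ∀ X Y, Smooth X → Smooth Y → nablaEndo C s.Q X Y = 0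
  /-- `∇_{V_a} V_b = 0`: the derivative of a vertical lift from `M`, such as the field `V_b` of any
  chart of `M`, in a vertical direction is zero -/
  nabla_vert : ∀ (U : Set M) (W : ∀ x : M, TangentSpace 𝓘(ℝ, E) x), IsOpen U →
    ContMDiffOn 𝓘(ℝ, E) 𝓘(ℝ, E).tangent ∞ (fun x => (⟨x, W x⟩ : TangentBundle 𝓘(ℝ, E) M)) U →
    ∀ p : Space E M B, p.2.1.1 ∈ U → ∀ w : E, C (vertLift W) p (vert p w) = 0
  /-- `P_H(X) = T(Γ, S(X))` -/
  PH_eq : ∀ (p : Space E M B) (ξ : Tan E M E' B p), s.PH p ξ = tors C (s.Γ p) (S p ξ)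
  /-- `P_V(X) = S(T(Γ, X))` -/
  PV_eq : ∀ (p : Space E M B) (ξ : Tan E M E' B p), s.PV p ξ = S p (tors C (s.Γ p) ξ)
  /-- `R(Γ, V) = 0` for vertical `V` -/
  curv_eq : ∀ V Z, Smooth V → Smooth Z → (∀ p, ∃ w, V p = vert p w) → curv C s.Γ V Z = 0
  /-- `∇N = 0` -/
  nabla_N : ∀ X Y, Smooth X → Smooth Y → nablaEndo C s.N X Y = 0
  /-- `∇_{∂/∂x^α} ∂/∂x^β = Υ^γ_{αβ} ∂/∂x^γ`: on lifts of vector fields from `B`, such as the fields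
  `∂/∂x^β` of any chart of `B`, the connection is `D` -/
  nabla_cons : ∀ (U : Set B) (Z : ∀ y : B, TangentSpace 𝓘(ℝ, E') y), IsOpen U →
    ContMDiffOn 𝓘(ℝ, E') 𝓘(ℝ, E').tangent ∞
      (fun y => (⟨y, Z y⟩ : TangentBundle 𝓘(ℝ, E') B)) U →
    ∀ p : Space E M B, p.2.2 ∈ U → ∀ b : E',
      C (consLift Z) p (cons p b) = cons (E' := E') p (D Z p.2.2 b)
  /-- `(I - P_V)(T((I - N)(X), N(Y))) = 0` -/
  tors_eq : ∀ (p : Space E M B) (ξ ζ : Tan E M E' B p),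
    tors C (ξ - s.N p ξ) (s.N p ζ) - s.PV p (tors C (ξ - s.N p ξ) (s.N p ζ)) = 0

end Conditions

end ConstrainedSODE

end

/-! All computations take place in components with respect to the adapted frame Γ, H_a, V_a, ∂/∂x^α.
A change of adapted coordinates acts on these components block by block through the Jacobians of the
two factors, with the same Jacobian on the H and V blocks (`coframe_chartDeriv`). The factor 1/2 in
Γ^b_a is what makes the second derivatives of the coordinate change cancel. Hence the projectors, S
and Q are constant block matrices in every chart, and the bracket is a flat bracket of components
corrected by the exterior derivative of the coframe (`frameComp_bracket`).

Existence: in the frame the seven-term formula collapses to DY(X) + ω(Y)(X) with ω bilinear at each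
point (`frameComp_explicit`), and such an expression is a covariant derivative. The nonzero
coefficients are ∇_Γ H_a = Γ^b_a H_b and ∇_{H_c} H_a = (∂Γ^b_c/∂u^a) H_b, the same ones for V in
place of the differentiated H, and ∇_Γ ∂_α = -(∂Ψ^β/∂x^α) ∂_β, ∇_{H_a} ∂_α = (∂Ψ^β_a/∂x^α) ∂_β,
∇_{∂_α} ∂_β = Υ^γ_{αβ} ∂_γ. Equality of the H and V coefficients makes S and Q parallel, the torsion
follows from the first structure equation (`frameVec_tors`), and R(Γ, V) = 0 reduces to the symmetry
of second derivatives (`curvature_expression`).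

Uniqueness: let A(Y)X be the difference tensor `diff` of two connections with the listed properties.
It commutes with S, Q and N and kills Γ as its argument Y. The conditions on ∇_V V, on ∇_{∂_α} ∂_β
and on the torsion then kill A in the directions Γ, V_a and ∂/∂x^α (`Characterizes.diff_eq`). The
directions H_a are reached through curvature: both connections agree along Γ and V, so R(Γ, V) = 0
for both forces agreement along [Γ, V], whose horizontal part is minus the horizontal vector
belonging to V (`Characterizes.diff_horiz_right`). -/

noncomputable section

/-! ### Vector fields, their derivatives and their brackets read in a fixed preferred chart. -/

section ChartReading

variable {F : Type*} [NormedAddCommGroup F] [NormedSpace ℝ F]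
  {H : Type*} [TopologicalSpace H] {I : ModelWithCorners ℝ F H}
  {N : Type*} [TopologicalSpace N] [ChartedSpace H N]

variable (I) in
/-- The derivative at `q` of the preferred chart at `p`, i.e. the change of components of tangent
vectors at `q` from the preferred chart at `q` to the one at `p`. -/
def chartDeriv (p q : N) : F →L[ℝ] F := mfderiv I 𝓘(ℝ, F) (extChartAt I p) q

variable (I) in
/-- The vector field `X` read in the preferred chart at `p`. -/
def reading (p : N) (X : ∀ q : N, TangentSpace I q) (z : F) : F :=
  chartDeriv I p ((extChartAt I p).symm z) (X ((extChartAt I p).symm z))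

lemma reading_extChartAt {p q : N} (X : ∀ q : N, TangentSpace I q)
    (hq : q ∈ (extChartAt I p).source) :
    reading I p X (extChartAt I p q) = chartDeriv I p q (X q) := by
  simp only [reading]
  rw [(extChartAt I p).left_inv hq]

lemma chartDeriv_self [IsManifold I 1 N] (p : N) :
    chartDeriv I p p = ContinuousLinearMap.id ℝ F := mfderiv_extChartAt_self

lemma chartDeriv_isInvertible [IsManifold I 1 N] {p q : N} (hq : q ∈ (extChartAt I p).source) :
    (chartDeriv I p q).IsInvertible := isInvertible_mfderiv_extChartAt hq

lemma chartDeriv_injective [IsManifold I 1 N] {p q : N} (hq : q ∈ (extChartAt I p).source) :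
    Function.Injective (chartDeriv I p q) := by
  obtain ⟨e, he⟩ := chartDeriv_isInvertible hq
  rw [← he]; exact e.injective

lemma chartDeriv_eq_fderiv [I.Boundaryless] (p q : N) (h : MDifferentiableAt I 𝓘(ℝ, F) (extChartAt I p) q) :
    chartDeriv I p q = fderiv ℝ (extChartAt I p ∘ (extChartAt I q).symm) (extChartAt I q q) := by
  unfold chartDeriv
  rw [h.mfderiv, I.range_eq_univ, fderivWithin_univ]
  rfl

lemma trivializationAt_snd_eq_chartDeriv [IsManifold I 1 N] {p q : N}
    (hq : q ∈ (extChartAt I p).source)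
    (v : TangentSpace I q) :
    (trivializationAt F (TangentSpace I) p ⟨q, v⟩).2 = chartDeriv I p q v := by
  have hq' : q ∈ (chartAt H p).source := by simpa using hq
  have h := TangentBundle.continuousLinearMapAt_trivializationAt (I := I) hq'
  have h' : (trivializationAt F (TangentSpace I) p).continuousLinearMapAt ℝ q v =
      chartDeriv I p q v := by rw [h]; rfl
  rw [← h', Trivialization.continuousLinearMapAt_apply, Trivialization.linearMapAt_apply,
    if_pos (by exact hq')]

/-- Transfer of smoothness of functions through a chart. -/
lemma contMDiffAt_iff_contDiffAt_comp_symm [I.Boundaryless] {n : ℕ∞ω} [IsManifold I n N]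
    {G : Type*} [NormedAddCommGroup G] [NormedSpace ℝ G] {p q : N}
    (hq : q ∈ (extChartAt I p).source) (f : N → G) :
    ContMDiffAt I 𝓘(ℝ, G) n f q ↔
      ContDiffAt ℝ n (f ∘ (extChartAt I p).symm) (extChartAt I p q) := by
  rw [contMDiffAt_iff_source_of_mem_source (x := p) (by simpa using hq),
    I.range_eq_univ, contMDiffWithinAt_univ, contMDiffAt_iff_contDiffAt]

lemma mdifferentiableAt_iff_differentiableAt_comp_symm [I.Boundaryless] [IsManifold I 1 N]
    {G : Type*} [NormedAddCommGroup G] [NormedSpace ℝ G] {p q : N}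
    (hq : q ∈ (extChartAt I p).source) (f : N → G) :
    MDifferentiableAt I 𝓘(ℝ, G) f q ↔
      DifferentiableAt ℝ (f ∘ (extChartAt I p).symm) (extChartAt I p q) := by
  rw [mdifferentiableAt_iff_source_of_mem_source (x := p) (by simpa using hq),
    I.range_eq_univ, mdifferentiableWithinAt_univ, mdifferentiableAt_iff_differentiableAt]

lemma mfderiv_apply_eq_fderiv_comp_symm [I.Boundaryless] [IsManifold I 1 N]
    {G : Type*} [NormedAddCommGroup G] [NormedSpace ℝ G] {p q : N}
    (hq : q ∈ (extChartAt I p).source) {f : N → G}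
    (hf : DifferentiableAt ℝ (f ∘ (extChartAt I p).symm) (extChartAt I p q)) (v : TangentSpace I q) :
    mfderiv I 𝓘(ℝ, G) f q v =
      fderiv ℝ (f ∘ (extChartAt I p).symm) (extChartAt I p q) (chartDeriv I p q v) := by
  have h1 : MDifferentiableAt I 𝓘(ℝ, F) (extChartAt I p) q :=
    mdifferentiableAt_extChartAt (by simpa using hq)
  have h2 : f =ᶠ[𝓝 q] (f ∘ (extChartAt I p).symm) ∘ extChartAt I p := by
    filter_upwards [(isOpen_extChartAt_source p).mem_nhds hq] with q' hq'
    simp only [Function.comp_apply, (extChartAt I p).left_inv hq']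
  rw [h2.mfderiv_eq, mfderiv_comp q hf.mdifferentiableAt h1, mfderiv_eq_fderiv]
  rfl

lemma contMDiffAt_section_iff_reading [I.Boundaryless] [IsManifold I ∞ N]
    {p q : N} (hq : q ∈ (extChartAt I p).source) (X : ∀ q : N, TangentSpace I q) :
    ContMDiffAt I I.tangent ∞ (fun q => (⟨q, X q⟩ : TangentBundle I N)) q ↔
      ContDiffAt ℝ ∞ (reading I p X) (extChartAt I p q) := by
  have hq' : q ∈ (chartAt H p).source := by simpa using hq
  have e : I.tangent = I.prod 𝓘(ℝ, F) := rfl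
  rw [e, Trivialization.contMDiffAt_section_iff (e := trivializationAt F (TangentSpace I) p) (by simpa using hq'),
    contMDiffAt_iff_contDiffAt_comp_symm hq]
  have h : (fun q' => (trivializationAt F (TangentSpace I) p ⟨q', X q'⟩).2) ∘
      (extChartAt I p).symm =ᶠ[𝓝 (extChartAt I p q)] reading I p X := by
    filter_upwards [(isOpen_extChartAt_target p).mem_nhds ((extChartAt I p).map_source hq)] with z hz
    exact trivializationAt_snd_eq_chartDeriv ((extChartAt I p).map_target hz) _
  exact ⟨fun k => k.congr_of_eventuallyEq h.symm, fun k => k.congr_of_eventuallyEq h⟩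

lemma mdifferentiableAt_section_iff_reading [I.Boundaryless] [IsManifold I 2 N]
    {p q : N} (hq : q ∈ (extChartAt I p).source) (X : ∀ q : N, TangentSpace I q) :
    MDifferentiableAt I I.tangent (fun q => (⟨q, X q⟩ : TangentBundle I N)) q ↔
      DifferentiableAt ℝ (reading I p X) (extChartAt I p q) := by
  have hq' : q ∈ (chartAt H p).source := by simpa using hq
  have e : I.tangent = I.prod 𝓘(ℝ, F) := rfl
  rw [e, Trivialization.mdifferentiableAt_section_iff I (trivializationAt F (TangentSpace I) p) X (by simpa using hq'),
    mdifferentiableAt_iff_differentiableAt_comp_symm hq]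
  apply Filter.EventuallyEq.differentiableAt_iff
  filter_upwards [(isOpen_extChartAt_target p).mem_nhds ((extChartAt I p).map_source hq)] with z hz
  exact trivializationAt_snd_eq_chartDeriv ((extChartAt I p).map_target hz) _

/-- The derivatives of a chart and of its inverse are mutually inverse, so pulling back along the
inverse chart amounts to applying `chartDeriv`. This makes the naturality of the Lie bracket
available for readings. -/
lemma eventually_mpullback_eq_reading [I.Boundaryless] [IsManifold I 1 N] {p : N} {z : F}
    (hz : z ∈ (extChartAt I p).target) (X : ∀ q : N, TangentSpace I q) :
    (mpullback 𝓘(ℝ, F) I (extChartAt I p).symm X : F → F) =ᶠ[𝓝 z] reading I p X := by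
  filter_upwards [(isOpen_extChartAt_target p).mem_nhds hz] with z hz
  have h1 := mfderiv_extChartAt_comp_mfderivWithin_extChartAt_symm (I := I) hz
  have h2 := mfderivWithin_extChartAt_symm_comp_mfderiv_extChartAt (I := I) hz
  rw [I.range_eq_univ, mfderivWithin_univ] at h1 h2
  rw [mpullback_apply, ContinuousLinearMap.inverse_eq h2 h1]
  rfl

/-- The bracket commutes with the pullback along the inverse chart, and on a vector space it is the
difference of directional derivatives. -/
lemma reading_mlieBracket [I.Boundaryless] [IsManifold I ∞ N] [CompleteSpace F]
    {p q : N} (hq : q ∈ (extChartAt I p).source) {X Y : ∀ q : N, TangentSpace I q}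
    (hX : DifferentiableAt ℝ (reading I p X) (extChartAt I p q))
    (hY : DifferentiableAt ℝ (reading I p Y) (extChartAt I p q)) :
    reading I p (mlieBracket I X Y) (extChartAt I p q) =
      fderiv ℝ (reading I p Y) (extChartAt I p q) (reading I p X (extChartAt I p q)) -
      fderiv ℝ (reading I p X) (extChartAt I p q) (reading I p Y (extChartAt I p q)) := by
  have hz := (extChartAt I p).map_source hq
  have : IsManifold I (minSmoothness ℝ 2) N := by
    rw [minSmoothness_of_isRCLikeNormedField]; infer_instance
  have hX' := (mdifferentiableAt_section_iff_reading hq X).2 hX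
  have hY' := (mdifferentiableAt_section_iff_reading hq Y).2 hY
  have hf : ContMDiffAt 𝓘(ℝ, F) I 2 (extChartAt I p).symm (extChartAt I p q) :=
    (contMDiffOn_extChartAt_symm (n := 2) p).contMDiffAt ((isOpen_extChartAt_target p).mem_nhds hz)
  have := mpullback_mlieBracket (I := 𝓘(ℝ, F)) (I' := I) (n := 2) (x₀ := extChartAt I p q)
    (f := (extChartAt I p).symm) (V := X) (W := Y)
    (by rw [(extChartAt I p).left_inv hq]; exact hX')
    (by rw [(extChartAt I p).left_inv hq]; exact hY') hf (by simp)
  rw [← (eventually_mpullback_eq_reading hz _).eq_of_nhds]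
  refine this.trans ?_
  rw [← mlieBracketWithin_univ, mlieBracketWithin_eq_lieBracketWithin]
  refine (congrFun (lieBracketWithin_univ (E := F)) _).trans ?_
  exact Filter.EventuallyEq.lieBracket_vectorField_eq (E := F) (eventually_mpullback_eq_reading hz X)
    (eventually_mpullback_eq_reading hz Y)

end ChartReading
end

/-! ### Coordinate changes on TM and on the constraint submanifold. -/

noncomputable section
variable {E : Type*} [NormedAddCommGroup E] [NormedSpace ℝ E]
  {M : Type*} [TopologicalSpace M] [ChartedSpace E M] [IsManifold 𝓘(ℝ, E) ∞ M]
  {E' : Type*} [NormedAddCommGroup E'] [NormedSpace ℝ E']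
  {B : Type*} [TopologicalSpace B] [ChartedSpace E' B] [IsManifold 𝓘(ℝ, E') ∞ B]

def chartTransition (x₀ x : M) : E → E :=
  extChartAt 𝓘(ℝ, E) x₀ ∘ (extChartAt 𝓘(ℝ, E) x).symm

lemma chartDeriv_eq_fderiv_chartTransition (x₀ x x' : M) (hx : x' ∈ (extChartAt 𝓘(ℝ, E) x).source)
    (hx0 : x' ∈ (extChartAt 𝓘(ℝ, E) x₀).source) (v : E) :
    chartDeriv 𝓘(ℝ, E) x₀ x' v = fderiv ℝ (chartTransition x₀ x) (extChartAt 𝓘(ℝ, E) x x')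
      (chartDeriv 𝓘(ℝ, E) x x' v) := by
  have : IsManifold 𝓘(ℝ, E) 1 M := inferInstance
  refine mfderiv_apply_eq_fderiv_comp_symm (p := x) (f := extChartAt 𝓘(ℝ, E) x₀) hx ?_ v
  rw [← mdifferentiableAt_iff_differentiableAt_comp_symm hx]
  exact mdifferentiableAt_extChartAt (by simpa using hx0)

lemma contDiffAt_chartTransition (x₀ x x' : M) (hx : x' ∈ (extChartAt 𝓘(ℝ, E) x).source)
    (hx0 : x' ∈ (extChartAt 𝓘(ℝ, E) x₀).source) :
    ContDiffAt ℝ ∞ (chartTransition x₀ x) (extChartAt 𝓘(ℝ, E) x x') := by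
  have := (contMDiffAt_iff_contDiffAt_comp_symm (I := 𝓘(ℝ, E)) (n := ∞) hx
    (extChartAt 𝓘(ℝ, E) x₀)).1 (contMDiffAt_extChartAt' (by simpa using hx0))
  exact this

/-- The components of a tangent vector in the preferred chart at its base point. -/
def fibreCoord (v : TangentBundle 𝓘(ℝ, E) M) : E := v.2

lemma extChartAt_tangent_apply (v₀ v : TangentBundle 𝓘(ℝ, E) M)
    (hx : v.1 ∈ (extChartAt 𝓘(ℝ, E) v₀.1).source) :
    extChartAt 𝓘(ℝ, E).tangent v₀ v =
      (extChartAt 𝓘(ℝ, E) v₀.1 v.1, chartDeriv 𝓘(ℝ, E) v₀.1 v.1 (fibreCoord v)) := by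
  unfold fibreCoord
  rw [← trivializationAt_snd_eq_chartDeriv hx]
  rfl

lemma mem_extChartAt_tangent_source (v₀ v : TangentBundle 𝓘(ℝ, E) M) :
    v ∈ (extChartAt 𝓘(ℝ, E).tangent v₀).source ↔ v.1 ∈ (extChartAt 𝓘(ℝ, E) v₀.1).source := by
  rw [extChartAt_source, extChartAt_source]
  exact TangentBundle.mem_chart_source_iff _ _

/-- The coordinate change of TM is (x, u) ↦ (χ(x), Dχ(x)u). Differentiating its second component
produces the second derivative of χ, the source of the inhomogeneous terms in the transformation
laws of F and Γ^b_a. -/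
lemma chartDeriv_tangent_apply (v₀ v : TangentBundle 𝓘(ℝ, E) M)
    (hx : v.1 ∈ (extChartAt 𝓘(ℝ, E) v₀.1).source) (a w : E) :
    chartDeriv 𝓘(ℝ, E).tangent v₀ v (a, w) =
      (chartDeriv 𝓘(ℝ, E) v₀.1 v.1 a,
        fderiv ℝ (fderiv ℝ (chartTransition v₀.1 v.1)) (extChartAt 𝓘(ℝ, E) v.1 v.1) a (fibreCoord v) +
        chartDeriv 𝓘(ℝ, E) v₀.1 v.1 w) := by
  have : IsManifold 𝓘(ℝ, E).tangent 1 (TangentBundle 𝓘(ℝ, E) M) := inferInstance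
  rw [chartDeriv_eq_fderiv _ _ (mdifferentiableAt_extChartAt
    (by simpa using (mem_extChartAt_tangent_source v₀ v).2 hx))]
  set χ := chartTransition (E := E) v₀.1 v.1
  have hs := mem_extChartAt_source (I := 𝓘(ℝ, E)) v.1
  have e0 : extChartAt 𝓘(ℝ, E).tangent v v = (extChartAt 𝓘(ℝ, E) v.1 v.1, fibreCoord v) := by
    rw [extChartAt_tangent_apply v v hs, chartDeriv_self]; rfl
  -- Only the germ at v matters for the derivative, and near v the coordinate change of TM is the
  -- tangent map of χ.
  have ev : (extChartAt 𝓘(ℝ, E).tangent v₀ ∘ (extChartAt 𝓘(ℝ, E).tangent v).symm) =ᶠ[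
      𝓝 (extChartAt 𝓘(ℝ, E).tangent v v)] fun z : E × E => (χ z.1, fderiv ℝ χ z.1 z.2) := by
    have h1 := extChartAt_target_mem_nhds (I := 𝓘(ℝ, E).tangent) v
    have h2 : ∀ᶠ z in 𝓝 (extChartAt 𝓘(ℝ, E).tangent v v),
        (extChartAt 𝓘(ℝ, E).tangent v).symm z ∈ (extChartAt 𝓘(ℝ, E).tangent v₀).source := by
      apply (continuousAt_extChartAt_symm v).eventually_mem
      rw [extChartAt_to_inv]
      exact (isOpen_extChartAt_source _).mem_nhds ((mem_extChartAt_tangent_source _ _).2 hx)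
    filter_upwards [h1, h2] with z hz hz2
    set v' := (extChartAt 𝓘(ℝ, E).tangent v).symm z with hv'
    have hz1 : v' ∈ (extChartAt 𝓘(ℝ, E).tangent v).source :=
      (extChartAt 𝓘(ℝ, E).tangent v).map_target hz
    have hz3 := (extChartAt 𝓘(ℝ, E).tangent v).right_inv hz
    rw [mem_extChartAt_tangent_source] at hz1 hz2
    rw [← hv', extChartAt_tangent_apply _ _ hz1] at hz3
    rw [Function.comp_apply, extChartAt_tangent_apply _ _ hz2,
      chartDeriv_eq_fderiv_chartTransition _ v.1 _ hz1 hz2]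
    obtain ⟨z1, z2⟩ := z
    simp only [Prod.mk.injEq] at hz3 ⊢
    rw [hz3.1, hz3.2]
    refine ⟨?_, rfl⟩
    rw [← hz3.1]
    simp only [χ, chartTransition, Function.comp_apply]
    rw [(extChartAt 𝓘(ℝ, E) v.1).left_inv hz1]
  rw [ev.fderiv_eq, e0]
  have hχ := contDiffAt_chartTransition v₀.1 v.1 v.1 hs hx
  have d1 : HasFDerivAt χ (fderiv ℝ χ (extChartAt 𝓘(ℝ, E) v.1 v.1)) (extChartAt 𝓘(ℝ, E) v.1 v.1) :=
    (hχ.differentiableAt (by simp)).hasFDerivAt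
  have d2 : HasFDerivAt (fderiv ℝ χ) (fderiv ℝ (fderiv ℝ χ) (extChartAt 𝓘(ℝ, E) v.1 v.1))
      (extChartAt 𝓘(ℝ, E) v.1 v.1) :=
    ((hχ.fderiv_right (m := ∞) le_rfl).differentiableAt (by simp)).hasFDerivAt
  have d3 : HasFDerivAt (fun z : E × E => χ z.1) _ (extChartAt 𝓘(ℝ, E) v.1 v.1, fibreCoord v) :=
    HasFDerivAt.comp (g := χ) (f := Prod.fst) _ d1 hasFDerivAt_fst
  have d4 : HasFDerivAt (fun z : E × E => fderiv ℝ χ z.1) _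
      (extChartAt 𝓘(ℝ, E) v.1 v.1, fibreCoord v) :=
    HasFDerivAt.comp (g := fderiv ℝ χ) (f := Prod.fst) _ d2 hasFDerivAt_fst
  have d5 : HasFDerivAt (𝕜 := ℝ) (fun z : E × E => z.2) (ContinuousLinearMap.snd ℝ E E)
      (extChartAt 𝓘(ℝ, E) v.1 v.1, fibreCoord v) :=
    hasFDerivAt_snd
  rw [(d3.prodMk (d4.clm_apply d5)).fderiv]
  have e1 (b : E) : chartDeriv 𝓘(ℝ, E) v₀.1 v.1 b = fderiv ℝ χ (extChartAt 𝓘(ℝ, E) v.1 v.1) b := by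
    rw [chartDeriv_eq_fderiv_chartTransition v₀.1 v.1 _ hs hx, chartDeriv_self]; rfl
  rw [e1, e1]
  simp [add_comm]

lemma fderiv_fderiv_chartTransition_symm (x₀ x : M)
    (hx : x ∈ (extChartAt 𝓘(ℝ, E) x₀).source) (a b : E) :
    fderiv ℝ (fderiv ℝ (chartTransition x₀ x)) (extChartAt 𝓘(ℝ, E) x x) a b =
    fderiv ℝ (fderiv ℝ (chartTransition x₀ x)) (extChartAt 𝓘(ℝ, E) x x) b a :=
  ((contDiffAt_chartTransition x₀ x x (mem_extChartAt_source x) hx).isSymmSndFDerivAt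
    (by simpa using ENat.LEInfty.out)) a b


lemma chartDeriv_prod_apply
    {F : Type*} [NormedAddCommGroup F] [NormedSpace ℝ F]
    {H : Type*} [TopologicalSpace H] {I : ModelWithCorners ℝ F H}
    {N : Type*} [TopologicalSpace N] [ChartedSpace H N] [IsManifold I 1 N]
    {F' : Type*} [NormedAddCommGroup F'] [NormedSpace ℝ F']
    {H' : Type*} [TopologicalSpace H'] {I' : ModelWithCorners ℝ F' H'}
    {N' : Type*} [TopologicalSpace N'] [ChartedSpace H' N'] [IsManifold I' 1 N']
    (p q : N × N') (h : q.1 ∈ (extChartAt I p.1).source) (h' : q.2 ∈ (extChartAt I' p.2).source)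
    (ξ : F × F') :
    chartDeriv (I.prod I') p q ξ = (chartDeriv I p.1 q.1 ξ.1, chartDeriv I' p.2 q.2 ξ.2) := by
  have h1 : MDifferentiableAt I 𝓘(ℝ, F) (extChartAt I p.1) q.1 :=
    mdifferentiableAt_extChartAt (by simpa using h)
  have h2 : MDifferentiableAt I' 𝓘(ℝ, F') (extChartAt I' p.2) q.2 :=
    mdifferentiableAt_extChartAt (by simpa using h')
  have key : chartDeriv (I.prod I') p q =
      (chartDeriv I p.1 q.1).prodMap (chartDeriv I' p.2 q.2) := by
    unfold chartDeriv
    rw [modelWithCornersSelf_prod, ← chartedSpaceSelf_prod, extChartAt_prod]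
    exact mfderiv_prodMap h1 h2
  rw [key]
  rfl

namespace ConstrainedSODE

lemma mem_source_iff (p q : Space E M B) : q ∈ (extChartAt (model E E') p).source ↔
    q.2.1.1 ∈ (extChartAt 𝓘(ℝ, E) p.2.1.1).source ∧ q.2.2 ∈ (extChartAt 𝓘(ℝ, E') p.2.2).source := by
  rw [extChartAt_prod, extChartAt_prod, PartialEquiv.prod_source, PartialEquiv.prod_source,
    Set.mem_prod, Set.mem_prod, mem_extChartAt_tangent_source, extChartAt_model_space_eq_id]
  simp

lemma extChartAt_apply {p q : Space E M B} (h : q ∈ (extChartAt (model E E') p).source) :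
    extChartAt (model E E') p q = (q.1, (extChartAt 𝓘(ℝ, E) p.2.1.1 q.2.1.1,
      chartDeriv 𝓘(ℝ, E) p.2.1.1 q.2.1.1 (vel q)), extChartAt 𝓘(ℝ, E') p.2.2 q.2.2) := by
  rw [mem_source_iff] at h
  rw [extChartAt_prod, extChartAt_prod, PartialEquiv.prod_coe, PartialEquiv.prod_coe]
  refine Prod.ext (by simp only [extChartAt_model_space_eq_id]; rfl) (Prod.ext ?_ rfl)
  exact extChartAt_tangent_apply _ _ h.1

lemma chartDeriv_apply {p q : Space E M B} (h : q ∈ (extChartAt (model E E') p).source)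
    (ξ : Model E E') :
    chartDeriv (model E E') p q ξ = (ξ.1, (chartDeriv 𝓘(ℝ, E) p.2.1.1 q.2.1.1 ξ.2.1.1,
      fderiv ℝ (fderiv ℝ (chartTransition p.2.1.1 q.2.1.1))
        (extChartAt 𝓘(ℝ, E) q.2.1.1 q.2.1.1) ξ.2.1.1 (vel q) +
        chartDeriv 𝓘(ℝ, E) p.2.1.1 q.2.1.1 ξ.2.1.2), chartDeriv 𝓘(ℝ, E') p.2.2 q.2.2 ξ.2.2) := by
  rw [mem_source_iff] at h
  have h1 : q.2.1 ∈ (extChartAt 𝓘(ℝ, E).tangent p.2.1).source :=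
    (mem_extChartAt_tangent_source _ _).2 h.1
  rw [chartDeriv_prod_apply _ _ (by rw [extChartAt_model_space_eq_id]; trivial)
    (by rw [extChartAt_prod]; exact ⟨h1, h.2⟩), chartDeriv_prod_apply _ _ h1 h.2]
  have e : chartDeriv 𝓘(ℝ, ℝ) p.1 q.1 = ContinuousLinearMap.id ℝ ℝ := by
    unfold chartDeriv
    rw [extChartAt_self_eq, mfderiv_eq_fderiv]
    exact fderiv_id
  rw [e]
  obtain ⟨τ, ⟨a, w⟩, b⟩ := ξ
  rw [chartDeriv_tangent_apply _ _ h.1]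
  rfl

end ConstrainedSODE
end

/-! ### The adapted coframe and its dual frame over a coordinate domain. -/

noncomputable section

namespace ConstrainedSODE

section Coordinates

variable {E : Type*} [NormedAddCommGroup E] [NormedSpace ℝ E] [FiniteDimensional ℝ E]
  {E' : Type*} [NormedAddCommGroup E'] [NormedSpace ℝ E'] [FiniteDimensional ℝ E']

variable (E E') in
/-- The vectors in the directions `u^a`. -/
def inclU : E →L[ℝ] Model E E' :=
  LinearMap.toContinuousLinearMap
    { toFun := fun w => (0, (0, w), 0)
      map_add' := fun _ _ => by simp
      map_smul' := fun _ _ => by simp }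

variable (E E') in
/-- The vectors in the directions `x^α`. -/
def inclB : E' →L[ℝ] Model E E' :=
  LinearMap.toContinuousLinearMap
    { toFun := fun b => (0, (0, 0), b)
      map_add' := fun _ _ => by simp
      map_smul' := fun _ _ => by simp }

@[simp] lemma inclU_apply (w : E) : inclU E E' w = (0, (0, w), 0) := rfl
@[simp] lemma inclB_apply (b : E') : inclB E E' b = (0, (0, 0), b) := rfl

variable (f : Model E E' → E) (g : Model E E' → E') (z : Model E E')

/-- The map with the matrix `-(1/2) ∂f^b/∂u^a`. -/
def connHat : E →L[ℝ] E := (-(1 / 2 : ℝ)) • (fderiv ℝ f z).comp (inclU E E')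

/-- The map with the matrix `-∂g^β/∂u^a`. -/
def psiHat : E →L[ℝ] E' := -(fderiv ℝ g z).comp (inclU E E')

/-- The coframe `(dt, (θ, ψ), η)` at the point `z` of a coordinate domain. -/
def coframe : Model E E' →L[ℝ] Model E E' :=
  LinearMap.toContinuousLinearMap
    { toFun := fun ξ => (ξ.1, (ξ.2.1.1 - ξ.1 • z.2.1.2,
        ξ.2.1.2 - ξ.1 • f z + connHat f z (ξ.2.1.1 - ξ.1 • z.2.1.2)),
        ξ.2.2 - ξ.1 • g z + psiHat g z (ξ.2.1.1 - ξ.1 • z.2.1.2))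
      map_add' := fun ξ ζ => by
        ext <;> simp only [Prod.fst_add, Prod.snd_add, map_add, map_sub, map_smul] <;> module
      map_smul' := fun c ξ => by
        ext <;> simp only [Prod.smul_fst, Prod.smul_snd, map_sub, map_smul, smul_eq_mul,
          RingHom.id_apply] <;> module }

/-- The frame dual to `coframe`. -/
def frame : Model E E' →L[ℝ] Model E E' :=
  LinearMap.toContinuousLinearMap
    { toFun := fun c => (c.1, (c.2.1.1 + c.1 • z.2.1.2,
        c.2.1.2 + c.1 • f z - connHat f z c.2.1.1),
        c.2.2 + c.1 • g z - psiHat g z c.2.1.1)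
      map_add' := fun ξ ζ => by
        ext <;> simp only [Prod.fst_add, Prod.snd_add, map_add, map_sub, map_smul] <;> module
      map_smul' := fun c ξ => by
        ext <;> simp only [Prod.smul_fst, Prod.smul_snd, map_sub, map_smul, smul_eq_mul,
          RingHom.id_apply] <;> module }

lemma coframe_apply (ξ : Model E E') : coframe f g z ξ = (ξ.1, (ξ.2.1.1 - ξ.1 • z.2.1.2,
        ξ.2.1.2 - ξ.1 • f z + connHat f z (ξ.2.1.1 - ξ.1 • z.2.1.2)),
        ξ.2.2 - ξ.1 • g z + psiHat g z (ξ.2.1.1 - ξ.1 • z.2.1.2)) := rfl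

lemma frame_apply (c : Model E E') : frame f g z c = (c.1, (c.2.1.1 + c.1 • z.2.1.2,
        c.2.1.2 + c.1 • f z - connHat f z c.2.1.1),
        c.2.2 + c.1 • g z - psiHat g z c.2.1.1) := rfl

@[simp] lemma coframe_frame (c : Model E E') : coframe f g z (frame f g z c) = c := by
  rw [coframe_apply, frame_apply]
  ext <;> simp <;> abel

@[simp] lemma frame_coframe (ξ : Model E E') : frame f g z (coframe f g z ξ) = ξ := by
  rw [coframe_apply, frame_apply]
  ext <;> simp <;> abel

/-- The derivative in the direction `ξ` of the coframe, evaluated on `ζ`. -/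
def dcoframe (ξ ζ : Model E E') : Model E E' :=
  (0, (-(ζ.1 • ξ.2.1.2),
    -(ζ.1 • fderiv ℝ f z ξ) + fderiv ℝ (connHat f) z ξ (ζ.2.1.1 - ζ.1 • z.2.1.2)
      - ζ.1 • connHat f z ξ.2.1.2),
    -(ζ.1 • fderiv ℝ g z ξ) + fderiv ℝ (psiHat g) z ξ (ζ.2.1.1 - ζ.1 • z.2.1.2)
      - ζ.1 • psiHat g z ξ.2.1.2)

variable {f g z}

lemma contDiffAt_connHat (hf : ContDiffAt ℝ ∞ f z) : ContDiffAt ℝ ∞ (connHat f) z := by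
  have h1 : ContDiffAt ℝ ∞ (fderiv ℝ f) z := hf.fderiv_right le_rfl
  exact (h1.clm_comp (contDiffAt_const (c := inclU E E'))).const_smul (-(1 / 2 : ℝ))

lemma contDiffAt_psiHat (hg : ContDiffAt ℝ ∞ g z) : ContDiffAt ℝ ∞ (psiHat g) z := by
  have h1 : ContDiffAt ℝ ∞ (fderiv ℝ g) z := hg.fderiv_right le_rfl
  exact (h1.clm_comp contDiffAt_const).neg

lemma contDiffAt_coframe_apply (hf : ContDiffAt ℝ ∞ f z) (hg : ContDiffAt ℝ ∞ g z)
    {Y : Model E E' → Model E E'} {n : ℕ∞ω} (hn : n ≤ ∞) (hY : ContDiffAt ℝ n Y z) :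
    ContDiffAt ℝ n (fun z => coframe f g z (Y z)) z := by
  have hG := (contDiffAt_connHat hf).of_le hn
  have hP := (contDiffAt_psiHat hg).of_le hn
  have hf := hf.of_le hn
  have hg := hg.of_le hn
  simp only [coframe_apply]
  fun_prop

lemma contDiffAt_frame_apply (hf : ContDiffAt ℝ ∞ f z) (hg : ContDiffAt ℝ ∞ g z)
    {Y : Model E E' → Model E E'} {n : ℕ∞ω} (hn : n ≤ ∞) (hY : ContDiffAt ℝ n Y z) :
    ContDiffAt ℝ n (fun z => frame f g z (Y z)) z := by
  have hG := (contDiffAt_connHat hf).of_le hn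
  have hP := (contDiffAt_psiHat hg).of_le hn
  have hf := hf.of_le hn
  have hg := hg.of_le hn
  simp only [frame_apply]
  fun_prop

lemma differentiableAt_coframe_apply (hf : ContDiffAt ℝ ∞ f z) (hg : ContDiffAt ℝ ∞ g z)
    {Y : Model E E' → Model E E'} (hY : DifferentiableAt ℝ Y z) :
    DifferentiableAt ℝ (fun z => coframe f g z (Y z)) z := by
  have hG := (contDiffAt_connHat hf).differentiableAt (by simp)
  have hP := (contDiffAt_psiHat hg).differentiableAt (by simp)
  have hf := hf.differentiableAt (by simp)
  have hg := hg.differentiableAt (by simp)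
  simp only [coframe_apply]
  fun_prop

lemma differentiableAt_frame_apply (hf : ContDiffAt ℝ ∞ f z) (hg : ContDiffAt ℝ ∞ g z)
    {Y : Model E E' → Model E E'} (hY : DifferentiableAt ℝ Y z) :
    DifferentiableAt ℝ (fun z => frame f g z (Y z)) z := by
  have hG := (contDiffAt_connHat hf).differentiableAt (by simp)
  have hP := (contDiffAt_psiHat hg).differentiableAt (by simp)
  have hf := hf.differentiableAt (by simp)
  have hg := hg.differentiableAt (by simp)
  simp only [frame_apply]
  fun_prop

/-- This is the product rule: one term differentiates the field, and `dcoframe` collects the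
derivatives of the coefficients u, f, g, `connHat f` and `psiHat g`. -/
lemma fderiv_coframe_apply (hf : ContDiffAt ℝ ∞ f z) (hg : ContDiffAt ℝ ∞ g z)
    {Y : Model E E' → Model E E'} (hY : DifferentiableAt ℝ Y z) (ξ : Model E E') :
    fderiv ℝ (fun z => coframe f g z (Y z)) z ξ =
      coframe f g z (fderiv ℝ Y z ξ) + dcoframe f g z ξ (Y z) := by
  have hG := ((contDiffAt_connHat hf).differentiableAt (by simp)).hasFDerivAt
  have hP := ((contDiffAt_psiHat hg).differentiableAt (by simp)).hasFDerivAt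
  have hf := (hf.differentiableAt (by simp)).hasFDerivAt
  have hg := (hg.differentiableAt (by simp)).hasFDerivAt
  have hY := hY.hasFDerivAt
  have hu : HasFDerivAt (fun z : Model E E' => z.2.1.2) _ z :=
    (hasFDerivAt_id (𝕜 := ℝ) z).snd.fst.snd
  have hτ : HasFDerivAt (fun z => (Y z).1) _ z := hY.fst
  have hθ : HasFDerivAt (fun z => (Y z).2.1.1 - (Y z).1 • z.2.1.2) _ z :=
    (hY.snd.fst.fst).sub (hτ.smul hu)
  have hψ : HasFDerivAt (fun z => (Y z).2.1.2 - (Y z).1 • f z +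
      connHat f z ((Y z).2.1.1 - (Y z).1 • z.2.1.2)) _ z :=
    ((hY.snd.fst.snd).sub (hτ.smul hf)).add (hG.clm_apply hθ)
  have hη : HasFDerivAt (fun z => (Y z).2.2 - (Y z).1 • g z +
      psiHat g z ((Y z).2.1.1 - (Y z).1 • z.2.1.2)) _ z :=
    ((hY.snd.snd).sub (hτ.smul hg)).add (hP.clm_apply hθ)
  have key : HasFDerivAt (fun z => coframe f g z (Y z)) _ z :=
    hτ.prodMk ((hθ.prodMk hψ).prodMk hη)
  rw [key.fderiv, coframe_apply, dcoframe]
  ext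
  · simp
  · simp [sub_eq_add_neg]; abel
  · simp [sub_eq_add_neg]; abel
  · simp [sub_eq_add_neg]; abel

end Coordinates

end ConstrainedSODE
end

/-! ### Christoffel symbols of a covariant derivative in a preferred chart, and their smoothness. -/

noncomputable section

section Christoffel

variable {F : Type*} [NormedAddCommGroup F] [NormedSpace ℝ F]
  {H : Type*} [TopologicalSpace H] {I : ModelWithCorners ℝ F H}
  {N : Type*} [TopologicalSpace N] [ChartedSpace H N]

variable (I) in
/-- The vector field with constant components in the preferred chart at `p`. -/
def chartConst (p : N) (c : F) : ∀ q : N, TangentSpace I q := fun q => (chartDeriv I p q).inverse c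

lemma chartDeriv_inverse_apply [IsManifold I 1 N] {p q : N} (hq : q ∈ (extChartAt I p).source)
    (c : F) : chartDeriv I p q ((chartDeriv I p q).inverse c) = c :=
  (chartDeriv_isInvertible hq).self_apply_inverse c

lemma chartDeriv_inverse_apply_self [IsManifold I 1 N] {p q : N}
    (hq : q ∈ (extChartAt I p).source) (c : F) :
    (chartDeriv I p q).inverse (chartDeriv I p q c) = c :=
  (chartDeriv_isInvertible hq).inverse_apply_self c

lemma reading_chartConst [IsManifold I 1 N] {p : N} {z : F} (hz : z ∈ (extChartAt I p).target)
    (c : F) : reading I p (chartConst I p c) z = c :=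
  chartDeriv_inverse_apply ((extChartAt I p).map_target hz) c

lemma eventuallyEq_reading_chartConst [I.Boundaryless] [IsManifold I 1 N] {p q : N}
    (hq : q ∈ (extChartAt I p).source) (c : F) :
    reading I p (chartConst I p c) =ᶠ[𝓝 (extChartAt I p q)] fun _ => c := by
  filter_upwards [(isOpen_extChartAt_target p).mem_nhds ((extChartAt I p).map_source hq)] with z hz
  exact reading_chartConst hz c

lemma contMDiffAt_chartConst [I.Boundaryless] [IsManifold I ∞ N] {p q : N}
    (hq : q ∈ (extChartAt I p).source) (c : F) :
    ContMDiffAt I I.tangent ∞ (fun q => (⟨q, chartConst I p c q⟩ : TangentBundle I N)) q := by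
  rw [contMDiffAt_section_iff_reading hq]
  exact contDiffAt_const.congr_of_eventuallyEq (eventuallyEq_reading_chartConst hq c)

lemma mdifferentiableAt_chartConst [I.Boundaryless] [IsManifold I ∞ N] {p q : N}
    (hq : q ∈ (extChartAt I p).source) (c : F) :
    MDifferentiableAt I I.tangent (fun q => (⟨q, chartConst I p c q⟩ : TangentBundle I N)) q :=
  (contMDiffAt_chartConst hq c).mdifferentiableAt (by simp)

/-- A vector field that is smooth near a point agrees near this point with a smooth one. -/
lemma exists_contMDiff_eventuallyEq [FiniteDimensional ℝ F] [T2Space N] [IsManifold I ∞ N]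
    {q : N} {X : ∀ q : N, TangentSpace I q}
    (hX : ∀ᶠ q' in 𝓝 q, ContMDiffAt I I.tangent ∞
      (fun q => (⟨q, X q⟩ : TangentBundle I N)) q') :
    ∃ Y : ∀ q : N, TangentSpace I q,
      ContMDiff I I.tangent ∞ (fun q => (⟨q, Y q⟩ : TangentBundle I N)) ∧ Y =ᶠ[𝓝 q] X := by
  -- The points of smoothness of X contain a neighbourhood of q, hence the closed support of some
  -- bump function; off that support the product with X is zero.
  obtain ⟨f, -, hf⟩ := (SmoothBumpFunction.nhds_basis_tsupport (I := I) q).mem_iff.1 hX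
  refine ⟨fun q => f q • X q, fun q' => ?_, ?_⟩
  · by_cases h : q' ∈ tsupport f
    · exact f.contMDiffAt.smul_section (hf h)
    · have h0 : ContMDiffAt I I.tangent ∞
        (fun q => (⟨q, (0 : TangentSpace I q)⟩ : TangentBundle I N)) q' :=
        Bundle.contMDiff_zeroSection ℝ (TangentSpace I : N → Type _) q'
      refine h0.congr_of_eventuallyEq ?_
      filter_upwards [(isClosed_tsupport f).isOpen_compl.mem_nhds h] with q hq
      rw [image_eq_zero_of_notMem_tsupport hq, zero_smul]
  · filter_upwards [f.eventuallyEq_one] with q hq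
    rw [hq, Pi.one_apply, one_smul]

variable [IsManifold I ∞ N]

/-- The Christoffel symbols at `q` of a covariant derivative in the preferred chart at `p`. -/
def christoffel (D : CovariantDerivative I F (TangentSpace I : N → Type _)) (p q : N) (c : F) :
    F →L[ℝ] F :=
  (chartDeriv I p q) ∘L (show F →L[ℝ] F from D (chartConst I p c) q) ∘L (chartDeriv I p q).inverse

lemma christoffel_apply (D : CovariantDerivative I F (TangentSpace I : N → Type _)) (p q : N)
    (c b : F) : christoffel D p q c b =
      chartDeriv I p q (D (chartConst I p c) q ((chartDeriv I p q).inverse b)) := rfl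

variable (D : CovariantDerivative I F (TangentSpace I : N → Type _))

lemma christoffel_add [I.Boundaryless] {p q : N}
    (hq : q ∈ (extChartAt I p).source) (c c' : F) :
    christoffel D p q (c + c') = christoffel D p q c + christoffel D p q c' := by
  have h : chartConst I p (c + c') = chartConst I p c + chartConst I p c' := by
    funext q; exact map_add _ _ _
  ext b
  have := D.isCovariantDerivativeOnUniv.add (mdifferentiableAt_chartConst hq c)
    (mdifferentiableAt_chartConst hq c')
  rw [add_apply, christoffel_apply, christoffel_apply, christoffel_apply, h, this]
  exact map_add (chartDeriv I p q) _ _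

lemma christoffel_smul [I.Boundaryless] {p q : N}
    (hq : q ∈ (extChartAt I p).source) (r : ℝ) (c : F) :
    christoffel D p q (r • c) = r • christoffel D p q c := by
  have h : chartConst I p (r • c) = r • chartConst I p c := by
    funext q; exact map_smul _ _ _
  ext b
  have := D.isCovariantDerivativeOnUniv.smul_const r (mdifferentiableAt_chartConst hq c)
  rw [smul_apply, christoffel_apply, christoffel_apply, h, this]
  exact map_smul (chartDeriv I p q) _ _

/-- D minus the flat derivative in the chart is tensorial, since the two Leibniz terms cancel. It
may therefore be evaluated on the field with constant components and the same value at q, whose flat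
derivative vanishes. -/
lemma chartDeriv_covariantDerivative [I.Boundaryless] [FiniteDimensional ℝ F]
    {p q : N} (hq : q ∈ (extChartAt I p).source) {Z : ∀ q : N, TangentSpace I q}
    (hZ : MDifferentiableAt I I.tangent (fun q => (⟨q, Z q⟩ : TangentBundle I N)) q)
    (v : TangentSpace I q) :
    chartDeriv I p q (D Z q v) =
      fderiv ℝ (reading I p Z) (extChartAt I p q) (chartDeriv I p q v) +
        christoffel D p q (chartDeriv I p q (Z q)) (chartDeriv I p q v) := by
  let Φ : (∀ q : N, TangentSpace I q) → F := fun Z =>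
    chartDeriv I p q (D Z q v) -
      fderiv ℝ (reading I p Z) (extChartAt I p q) (chartDeriv I p q v)
  have hΦ : TensorialAt I F Φ q := by
    constructor
    · intro f σ hf hσ
      have h1 := D.isCovariantDerivativeOnUniv.leibniz hσ hf
      have hσ' := (mdifferentiableAt_section_iff_reading hq σ).1 hσ
      have hf' := (mdifferentiableAt_iff_differentiableAt_comp_symm hq f).1 hf
      have h2 : reading I p (f • σ) = fun z => (f ∘ (extChartAt I p).symm) z • reading I p σ z := by
        funext z
        exact map_smul (chartDeriv I p _) _ _
      have h3 := mfderiv_apply_eq_fderiv_comp_symm hq hf' v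
      simp only [Φ]
      rw [h1, h2, fderiv_fun_smul hf' hσ', reading_extChartAt _ hq]
      have h4 : ((f q • D σ q + (mvfderiv I f q).smulRight (σ q)) v : TangentSpace I q) =
        f q • D σ q v + (fderiv ℝ (f ∘ (extChartAt I p).symm) (extChartAt I p q)
          (chartDeriv I p q v)) • σ q := by
        rw [← h3]; rfl
      rw [h4]
      have h5 : chartDeriv I p q (f q • D σ q v + (fderiv ℝ (f ∘ (extChartAt I p).symm)
          (extChartAt I p q) (chartDeriv I p q v)) • σ q) =
          f q • chartDeriv I p q (D σ q v) + (fderiv ℝ (f ∘ (extChartAt I p).symm)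
          (extChartAt I p q) (chartDeriv I p q v)) • chartDeriv I p q (σ q) := by
        refine (map_add (chartDeriv I p q) _ _).trans ?_
        exact congrArg₂ _ (map_smul (chartDeriv I p q) _ _) (map_smul (chartDeriv I p q) _ _)
      rw [h5]
      simp only [Function.comp_apply, add_apply, smul_apply,
        ContinuousLinearMap.smulRight_apply, (extChartAt I p).left_inv hq]
      module
    · intro σ σ' hσ hσ'
      have h1 := D.isCovariantDerivativeOnUniv.add hσ hσ'
      have hr := (mdifferentiableAt_section_iff_reading hq σ).1 hσ
      have hr' := (mdifferentiableAt_section_iff_reading hq σ').1 hσ'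
      have h2 : reading I p (σ + σ') = fun z => reading I p σ z + reading I p σ' z := by
        funext z
        exact map_add (chartDeriv I p _) _ _
      have h5 : chartDeriv I p q ((D σ q + D σ' q) v) =
          chartDeriv I p q (D σ q v) + chartDeriv I p q (D σ' q v) :=
        map_add (chartDeriv I p q) _ _
      simp only [Φ]
      rw [h1, h2, fderiv_fun_add hr hr', h5]
      simp only [add_apply]
      module
  set c := chartDeriv I p q (Z q) with hc
  have h1 : Φ Z = Φ (chartConst I p c) :=
    hΦ.pointwise hZ (mdifferentiableAt_chartConst hq c)
      (chartDeriv_inverse_apply_self hq (Z q)).symm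
  have h2 : Φ (chartConst I p c) = christoffel D p q c (chartDeriv I p q v) := by
    have h3 : christoffel D p q c (chartDeriv I p q v) =
        chartDeriv I p q (D (chartConst I p c) q v) :=
      congrArg (fun b : F => chartDeriv I p q (D (chartConst I p c) q b))
        (chartDeriv_inverse_apply_self hq v)
    rw [h3]
    simp only [Φ, (eventuallyEq_reading_chartConst hq c).fderiv_eq]
    simp
  rw [← h2, ← h1]
  simp [Φ]


/-- Smoothness of a covariant derivative is smoothness of a section of an endomorphism bundle. In
the trivialization at p such a section is read by conjugation with `chartDeriv`, the form in which
`christoffel` is defined. -/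
lemma inCoordinates_tangentSpace {p q : N} (hq : q ∈ (extChartAt I p).source)
    (A : TangentSpace I q →L[ℝ] TangentSpace I q) :
    ContinuousLinearMap.inCoordinates F (TangentSpace I : N → Type _) F
      (TangentSpace I : N → Type _) p q p q A =
      (chartDeriv I p q) ∘L (show F →L[ℝ] F from A) ∘L (chartDeriv I p q).inverse := by
  have hq' : q ∈ (chartAt H p).source := by simpa using hq
  have h := TangentBundle.continuousLinearMapAt_trivializationAt (I := I) hq'
  have hb : q ∈ (trivializationAt F (TangentSpace I : N → Type _) p).baseSet := hq'
  ext v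
  have e1 : (trivializationAt F (TangentSpace I : N → Type _) p).symmL ℝ q v =
      (chartDeriv I p q).inverse v := by
    have h1 := Trivialization.continuousLinearMapAt_symmL (R := ℝ)
      (trivializationAt F (TangentSpace I : N → Type _) p) hb v
    rw [h] at h1
    apply chartDeriv_injective hq
    exact h1.trans (chartDeriv_inverse_apply hq v).symm
  have e2 : ContinuousLinearMap.inCoordinates F (TangentSpace I : N → Type _) F
      (TangentSpace I : N → Type _) p q p q A v =
      (trivializationAt F (TangentSpace I : N → Type _) p).continuousLinearMapAt ℝ q
        (A ((trivializationAt F (TangentSpace I : N → Type _) p).symmL ℝ q v)) := rfl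
  rw [e2, h, e1]
  rfl

/-- The smoothness of D is applied to globally smooth fields, whereas a field with constant
components is smooth only on the chart domain. A cut-off of it agrees with it near p, and covariant
derivatives are local. -/
lemma contDiffAt_christoffel_const [I.Boundaryless] [FiniteDimensional ℝ F] [T2Space N]
    (hD : CovariantDerivative.ContMDiffCovariantDerivative D ∞) (p : N) (c : F) :
    ContDiffAt ℝ ∞ (fun z => christoffel D p ((extChartAt I p).symm z) c) (extChartAt I p p) := by
  have hp := mem_extChartAt_source (I := I) p
  obtain ⟨Y, hY, hYc⟩ := exists_contMDiff_eventuallyEq (X := chartConst I p c) (q := p) (by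
    filter_upwards [(isOpen_extChartAt_source p).mem_nhds hp] with q hq
    exact contMDiffAt_chartConst hq c)
  have h1 := hD.contMDiff.contMDiff (σ := Y) hY.contMDiffOn
  have h2 := (h1 p (Set.mem_univ _)).contMDiffAt Filter.univ_mem
  rw [contMDiffAt_hom_bundle] at h2
  have h3 := (contMDiffAt_iff_contDiffAt_comp_symm hp _).1 h2.2
  refine h3.congr_of_eventuallyEq ?_
  have h4 : ∀ᶠ q in 𝓝 p, ∀ᶠ q' in 𝓝 q, Y q' = chartConst I p c q' :=
    eventually_eventually_nhds.2 hYc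
  have h5 : Filter.Tendsto (extChartAt I p).symm (𝓝 (extChartAt I p p)) (𝓝 p) := by
    have := continuousAt_extChartAt_symm (I := I) p
    rwa [ContinuousAt, extChartAt_to_inv] at this
  filter_upwards [h5.eventually h4, h5.eventually ((isOpen_extChartAt_source p).mem_nhds hp)]
    with z hz hzs
  have h6 : D Y ((extChartAt I p).symm z) = D (chartConst I p c) ((extChartAt I p).symm z) :=
    D.isCovariantDerivativeOnUniv.congr_of_eventuallyEq ((hY _).mdifferentiableAt (by simp))
      (mdifferentiableAt_chartConst hzs c) Filter.univ_mem hz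
  simp only [Function.comp_apply]
  rw [inCoordinates_tangentSpace hzs, h6]
  rfl

/-- The symbols are linear in their first argument, so a varying argument is expanded in a finite
basis and the constant case applies to each basis vector. -/
lemma contDiffAt_christoffel [I.Boundaryless] [FiniteDimensional ℝ F] [T2Space N]
    (hD : CovariantDerivative.ContMDiffCovariantDerivative D ∞) {p : N}
    {V : Type*} [NormedAddCommGroup V] [NormedSpace ℝ V] {v : V}
    {r c : V → F} (hr : ContDiffAt ℝ ∞ r v) (hrv : r v = extChartAt I p p)
    (hc : ContDiffAt ℝ ∞ c v) :
    ContDiffAt ℝ ∞ (fun v => christoffel D p ((extChartAt I p).symm (r v)) (c v)) v := by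
  let e := Module.finBasis ℝ F
  have h1 : ContDiffAt ℝ ∞ (fun v => ∑ i, e.coord i (c v) •
      christoffel D p ((extChartAt I p).symm (r v)) (e i)) v := by
    refine ContDiffAt.sum fun i _ => ContDiffAt.fun_smul ?_ ?_
    · exact (LinearMap.toContinuousLinearMap (e.coord i)).contDiff.contDiffAt.comp v hc
    · have := contDiffAt_christoffel_const D hD p (e i)
      rw [← hrv] at this
      exact this.comp v hr
  refine h1.congr_of_eventuallyEq ?_
  have h2 : ∀ᶠ z in 𝓝 (r v), z ∈ (extChartAt I p).target := by
    rw [hrv]; exact extChartAt_target_mem_nhds p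
  filter_upwards [hr.continuousAt.eventually h2] with v' hv'
  have hs := (extChartAt I p).map_target hv'
  let L : F →ₗ[ℝ] F →L[ℝ] F :=
    { toFun := fun c => christoffel D p ((extChartAt I p).symm (r v')) c
      map_add' := christoffel_add D hs
      map_smul' := christoffel_smul D hs }
  have h3 : L (c v') = L (∑ i, e.coord i (c v') • e i) := by
    congr 1
    exact (e.sum_repr (c v')).symm
  simp only [map_sum, map_smul] at h3
  exact h3

end Christoffel
end

/-! ### Transformation of F, Ψ and their velocity derivatives under coordinate changes. -/

noncomputable section

namespace ConstrainedSODE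

variable {E : Type*} [NormedAddCommGroup E] [NormedSpace ℝ E]
  {M : Type*} [TopologicalSpace M] [ChartedSpace E M] [IsManifold 𝓘(ℝ, E) ∞ M]
  {E' : Type*} [NormedAddCommGroup E'] [NormedSpace ℝ E']
  {B : Type*} [TopologicalSpace B] [ChartedSpace E' B] [IsManifold 𝓘(ℝ, E') ∞ B]

variable (s : ConstrainedSODE E M E' B)

/-- The components `F^a` in the chart at `p`. -/
def forceHat (p : Space E M B) (z : Model E E') : E := (reading (model E E') p s.Γ z).2.1.2

/-- The components `Ψ^α` in the chart at `p`. -/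
def slopeHat (p : Space E M B) (z : Model E E') : E' := (reading (model E E') p s.Γ z).2.2

variable {p q : Space E M B}

/-- In the preferred chart at the base point the projection TM → M is the first coordinate, so the
second order condition identifies the first component. -/
lemma F_eq (q : Space E M B) : s.F q = ((vel q, s.force q) : E × E) := by
  refine Prod.ext ?_ rfl
  have h := s.second_order q
  have h1 : MDifferentiableAt 𝓘(ℝ, E).tangent 𝓘(ℝ, E)
      (fun v : TangentBundle 𝓘(ℝ, E) M => v.1) q.2.1 :=
    (contMDiff_proj (TangentSpace 𝓘(ℝ, E) : M → Type _) (n := 1)).contMDiffAt.mdifferentiableAt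
      (by simp)
  have hs := mem_extChartAt_source (I := 𝓘(ℝ, E)) q.2.1.1
  have h2 : MDifferentiableAt 𝓘(ℝ, E) 𝓘(ℝ, E) (extChartAt 𝓘(ℝ, E) q.2.1.1) q.2.1.1 :=
    mdifferentiableAt_extChartAt (by simp)
  have h3 := mfderiv_comp (I := 𝓘(ℝ, E).tangent) (I' := 𝓘(ℝ, E)) (I'' := 𝓘(ℝ, E)) q.2.1 h2 h1
  have hv := mem_extChartAt_source (I := 𝓘(ℝ, E).tangent) q.2.1
  have hev : (extChartAt 𝓘(ℝ, E) q.2.1.1 ∘ fun v : TangentBundle 𝓘(ℝ, E) M => v.1) ∘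
      (extChartAt 𝓘(ℝ, E).tangent q.2.1).symm =ᶠ[𝓝 (extChartAt 𝓘(ℝ, E).tangent q.2.1 q.2.1)]
      Prod.fst := by
    filter_upwards [extChartAt_target_mem_nhds (I := 𝓘(ℝ, E).tangent) q.2.1] with z hz
    have hz1 := (extChartAt 𝓘(ℝ, E).tangent q.2.1).map_target hz
    have hz2 := (extChartAt 𝓘(ℝ, E).tangent q.2.1).right_inv hz
    rw [mem_extChartAt_tangent_source] at hz1
    rw [extChartAt_tangent_apply _ _ hz1] at hz2
    simp only [Function.comp_apply]
    exact congrArg Prod.fst hz2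
  have h4 := mfderiv_apply_eq_fderiv_comp_symm hv
    (hev.differentiableAt_iff.2 differentiableAt_fst) (s.F q)
  rw [hev.fderiv_eq, chartDeriv_self, fderiv_fst] at h4
  have h5 := DFunLike.congr_fun h3 (s.F q)
  have h6 : chartDeriv 𝓘(ℝ, E) q.2.1.1 q.2.1.1 (mfderiv 𝓘(ℝ, E).tangent 𝓘(ℝ, E)
    (fun v : TangentBundle 𝓘(ℝ, E) M => v.1) q.2.1 (s.F q)) = (show E × E from s.F q).1 :=
    h5.symm.trans h4
  rw [h, chartDeriv_self] at h6
  exact h6.symm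

/-- The inhomogeneous term is quadratic in the velocity because the x-component of the second order
vector is the velocity itself. -/
lemma forceHat_extChartAt (hq : q ∈ (extChartAt (model E E') p).source) :
    s.forceHat p (extChartAt (model E E') p q) =
      fderiv ℝ (fderiv ℝ (chartTransition p.2.1.1 q.2.1.1))
        (extChartAt 𝓘(ℝ, E) q.2.1.1 q.2.1.1) (vel q) (vel q) +
        chartDeriv 𝓘(ℝ, E) p.2.1.1 q.2.1.1 (s.force q) := by
  have h := chartDeriv_apply hq (s.Γ q)
  rw [forceHat, reading_extChartAt _ hq, h]
  rfl

lemma slopeHat_extChartAt (hq : q ∈ (extChartAt (model E E') p).source) :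
    s.slopeHat p (extChartAt (model E E') p q) =
      chartDeriv 𝓘(ℝ, E') p.2.2 q.2.2 (s.psi q) := by
  have h := chartDeriv_apply hq (s.Γ q)
  rw [slopeHat, reading_extChartAt _ hq, h]
  rfl

lemma contDiffAt_forceHat (hq : q ∈ (extChartAt (model E E') p).source) :
    ContDiffAt ℝ ∞ (s.forceHat p) (extChartAt (model E E') p q) := by
  have hq1 := (mem_source_iff p q).1 hq
  have h := s.smooth_F q
  have e : 𝓘(ℝ, E).tangent.tangent = 𝓘(ℝ, E).tangent.prod 𝓘(ℝ, E × E) := rfl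
  have hv : q.2.1 ∈ (extChartAt 𝓘(ℝ, E).tangent p.2.1).source :=
    (mem_extChartAt_tangent_source _ _).2 hq1.1
  rw [e, Trivialization.contMDiffAt_iff (e := trivializationAt (E × E)
    (TangentSpace 𝓘(ℝ, E).tangent : TangentBundle 𝓘(ℝ, E) M → Type _) p.2.1)
    (by rw [Trivialization.mem_source]; simpa using hv)] at h
  have h2 := (contMDiffAt_iff_contDiffAt_comp_symm (I := model E E') hq _).1 h.2
  refine (contDiff_snd.contDiffAt.comp _ h2).congr_of_eventuallyEq ?_
  filter_upwards [(isOpen_extChartAt_target p).mem_nhds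
    ((extChartAt (model E E') p).map_source hq)] with z hz
  have hz1 := (extChartAt (model E E') p).map_target hz
  have hz2 := (mem_source_iff _ _).1 hz1
  have h3 := s.forceHat_extChartAt hz1
  rw [(extChartAt (model E E') p).right_inv hz] at h3
  have hv' := (mem_extChartAt_tangent_source p.2.1 ((extChartAt (model E E') p).symm z).2.1).2 hz2.1
  simp only [Function.comp_apply]
  rw [trivializationAt_snd_eq_chartDeriv hv', h3, F_eq, chartDeriv_tangent_apply _ _ hz2.1]
  rfl

lemma contDiffAt_slopeHat (hq : q ∈ (extChartAt (model E E') p).source) :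
    ContDiffAt ℝ ∞ (s.slopeHat p) (extChartAt (model E E') p q) := by
  have hq1 := (mem_source_iff p q).1 hq
  have h := s.smooth_Ψ q
  have e : 𝓘(ℝ, E').tangent = 𝓘(ℝ, E').prod 𝓘(ℝ, E') := rfl
  rw [e, Trivialization.contMDiffAt_iff (e := trivializationAt E'
    (TangentSpace 𝓘(ℝ, E') : B → Type _) p.2.2)
    (by rw [Trivialization.mem_source]; simpa using hq1.2)] at h
  have h2 := (contMDiffAt_iff_contDiffAt_comp_symm (I := model E E') hq _).1 h.2
  refine h2.congr_of_eventuallyEq ?_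
  filter_upwards [(isOpen_extChartAt_target p).mem_nhds
    ((extChartAt (model E E') p).map_source hq)] with z hz
  have hz1 := (extChartAt (model E E') p).map_target hz
  have hz2 := (mem_source_iff _ _).1 hz1
  have h3 := s.slopeHat_extChartAt hz1
  rw [(extChartAt (model E E') p).right_inv hz] at h3
  simp only [Function.comp_apply]
  rw [trivializationAt_snd_eq_chartDeriv hz2.2, h3]
  rfl

/-- The point of the same fibre of `TM` with velocity components `u`. -/
def withVel (q : Space E M B) (u : E) : Space E M B := (q.1, ⟨q.2.1.1, u⟩, q.2.2)

lemma withVel_mem_source (hq : q ∈ (extChartAt (model E E') p).source) (u : E) :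
    withVel q u ∈ (extChartAt (model E E') p).source := by
  rw [mem_source_iff] at hq ⊢
  exact hq

lemma extChartAt_withVel (hq : q ∈ (extChartAt (model E E') p).source) (u : E) :
    extChartAt (model E E') p (withVel q u) = (q.1, (extChartAt 𝓘(ℝ, E) p.2.1.1 q.2.1.1,
      chartDeriv 𝓘(ℝ, E) p.2.1.1 q.2.1.1 u), extChartAt 𝓘(ℝ, E') p.2.2 q.2.2) :=
  extChartAt_apply (withVel_mem_source hq u)

section

variable [FiniteDimensional ℝ E] [FiniteDimensional ℝ E']

lemma hasFDerivAt_extChartAt_withVel (hq : q ∈ (extChartAt (model E E') p).source) (u : E) :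
    HasFDerivAt (fun u => extChartAt (model E E') p (withVel q u))
      ((inclU E E').comp (chartDeriv 𝓘(ℝ, E) p.2.1.1 q.2.1.1)) u := by
  simp only [extChartAt_withVel hq]
  have h1 : HasFDerivAt (fun u : E => inclU E E' (chartDeriv 𝓘(ℝ, E) p.2.1.1 q.2.1.1 u))
    ((inclU E E').comp (chartDeriv 𝓘(ℝ, E) p.2.1.1 q.2.1.1)) u :=
    ((inclU E E').comp (chartDeriv 𝓘(ℝ, E) p.2.1.1 q.2.1.1)).hasFDerivAt
  have h2 := h1.add_const ((q.1, (extChartAt 𝓘(ℝ, E) p.2.1.1 q.2.1.1, 0),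
    extChartAt 𝓘(ℝ, E') p.2.2 q.2.2) : Model E E')
  simpa using h2

/-- Differentiating the law F̂ = B(u, u) + L F along the fibre gives 2B(w, u), as the second
derivative B of the coordinate change is symmetric. The factor -1/2 turns this into the single term
-B(w, u) that cancels the one in the change of du. -/
lemma chartDeriv_connCoeff (hq : q ∈ (extChartAt (model E E') p).source) (w : E) :
    connHat (s.forceHat p) (extChartAt (model E E') p q)
      (chartDeriv 𝓘(ℝ, E) p.2.1.1 q.2.1.1 w) =
      chartDeriv 𝓘(ℝ, E) p.2.1.1 q.2.1.1 (s.connCoeff q w) -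
      fderiv ℝ (fderiv ℝ (chartTransition p.2.1.1 q.2.1.1))
        (extChartAt 𝓘(ℝ, E) q.2.1.1 q.2.1.1) w (vel q) := by
  have hq1 := ((mem_source_iff p q).1 hq).1
  obtain ⟨L, hL⟩ := chartDeriv_isInvertible (I := 𝓘(ℝ, E)) hq1
  set Bq := fderiv ℝ (fderiv ℝ (chartTransition p.2.1.1 q.2.1.1))
        (extChartAt 𝓘(ℝ, E) q.2.1.1 q.2.1.1) with hB
  have hsym : ∀ a b, Bq a b = Bq b a := fderiv_fderiv_chartTransition_symm _ _ hq1
  have e0 : withVel q (vel q) = q := rfl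
  have h1 : HasFDerivAt (fun u => s.forceHat p (extChartAt (model E E') p (withVel q u)))
      ((fderiv ℝ (s.forceHat p) (extChartAt (model E E') p q)).comp
        ((inclU E E').comp (chartDeriv 𝓘(ℝ, E) p.2.1.1 q.2.1.1))) (vel q) := by
    have := ((s.contDiffAt_forceHat hq).differentiableAt (by simp)).hasFDerivAt
    exact HasFDerivAt.comp (g := s.forceHat p) (vel q) this
      (hasFDerivAt_extChartAt_withVel hq (vel q))
  have h2 : HasFDerivAt (fun u => Bq u u) (Bq (vel q) + Bq.flip (vel q)) (vel q) := by
    have := Bq.hasFDerivAt (x := vel q)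
    have h := this.clm_apply (hasFDerivAt_id (𝕜 := ℝ) (vel q))
    exact h
  -- The transformation law is solved for the force; L and B depend on the base point only, hence
  -- are constant along the fibre.
  have h3 : (fun u => s.force (withVel q u)) =
      fun u => L.symm (s.forceHat p (extChartAt (model E E') p (withVel q u)) - Bq u u) := by
    funext u
    rw [s.forceHat_extChartAt (withVel_mem_source hq u)]
    have : chartDeriv 𝓘(ℝ, E) p.2.1.1 (withVel q u).2.1.1 = L := hL.symm
    rw [this]
    exact (L.symm_apply_eq.2 (add_sub_cancel_left _ _)).symm
  have h4 : HasFDerivAt (fun u => s.force (withVel q u)) ((L.symm : E →L[ℝ] E).comp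
      (((fderiv ℝ (s.forceHat p) (extChartAt (model E E') p q)).comp
        ((inclU E E').comp (chartDeriv 𝓘(ℝ, E) p.2.1.1 q.2.1.1))) -
        (Bq (vel q) + Bq.flip (vel q)))) (vel q) := by
    rw [h3]
    exact (L.symm : E →L[ℝ] E).hasFDerivAt.comp (vel q) (h1.sub h2)
  have h5 : s.connCoeff q w = (-(1 / 2 : ℝ)) • L.symm (fderiv ℝ (s.forceHat p)
      (extChartAt (model E E') p q) (inclU E E' (L w)) - (Bq (vel q) w + Bq w (vel q))) := by
    have : s.connCoeff q = (-(1 / 2 : ℝ)) • fderiv ℝ (fun u => s.force (withVel q u)) (vel q) := rfl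
    rw [this, h4.fderiv, ← hL]
    simp
  rw [h5, ← hL, connHat]
  simp only [map_smul, ContinuousLinearEquiv.coe_coe, ContinuousLinearEquiv.apply_symm_apply]
  rw [hsym (vel q) w]
  simp only [smul_apply, ContinuousLinearMap.comp_apply]
  module

/-- Ψ transforms linearly, by a Jacobian that does not involve u, so its fibre derivative is
tensorial. -/
lemma chartDeriv_psiCoeff (hq : q ∈ (extChartAt (model E E') p).source) (w : E) :
    psiHat (s.slopeHat p) (extChartAt (model E E') p q)
      (chartDeriv 𝓘(ℝ, E) p.2.1.1 q.2.1.1 w) =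
      chartDeriv 𝓘(ℝ, E') p.2.2 q.2.2 (s.psiCoeff q w) := by
  have hq1 := (mem_source_iff p q).1 hq
  obtain ⟨L, hL⟩ := chartDeriv_isInvertible (I := 𝓘(ℝ, E')) hq1.2
  have h1 : HasFDerivAt (fun u => s.slopeHat p (extChartAt (model E E') p (withVel q u)))
      ((fderiv ℝ (s.slopeHat p) (extChartAt (model E E') p q)).comp
        ((inclU E E').comp (chartDeriv 𝓘(ℝ, E) p.2.1.1 q.2.1.1))) (vel q) := by
    have := ((s.contDiffAt_slopeHat hq).differentiableAt (by simp)).hasFDerivAt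
    exact HasFDerivAt.comp (g := s.slopeHat p) (vel q) this
      (hasFDerivAt_extChartAt_withVel hq (vel q))
  have h3 : (fun u => s.psi (withVel q u)) =
      fun u => L.symm (s.slopeHat p (extChartAt (model E E') p (withVel q u))) := by
    funext u
    rw [s.slopeHat_extChartAt (withVel_mem_source hq u)]
    have : chartDeriv 𝓘(ℝ, E') p.2.2 (withVel q u).2.2 = L := hL.symm
    rw [this]
    exact (L.symm_apply_apply _).symm
  have h4 : HasFDerivAt (fun u => s.psi (withVel q u)) ((L.symm : E' →L[ℝ] E').comp
      ((fderiv ℝ (s.slopeHat p) (extChartAt (model E E') p q)).comp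
        ((inclU E E').comp (chartDeriv 𝓘(ℝ, E) p.2.1.1 q.2.1.1)))) (vel q) := by
    rw [h3]
    exact (L.symm : E' →L[ℝ] E').hasFDerivAt.comp (vel q) h1
  have h5 : s.psiCoeff q w = - L.symm (fderiv ℝ (s.slopeHat p)
      (extChartAt (model E E') p q) (inclU E E' (chartDeriv 𝓘(ℝ, E) p.2.1.1 q.2.1.1 w))) := by
    have : s.psiCoeff q = - fderiv ℝ (fun u => s.psi (withVel q u)) (vel q) := rfl
    rw [this, h4.fderiv]
    simp
  rw [h5, ← hL, psiHat]
  simp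

/-- In the ψ-block the second-derivative terms are B(a, u) from du, -dt B(u, u) from F and -B(θ, u)
from Γ^b_a; they cancel because θ = a - dt u. This makes the frame decomposition and its tensors
independent of coordinates. -/
lemma coframe_chartDeriv (hq : q ∈ (extChartAt (model E E') p).source) (ξ : Tan E M E' B q) :
    coframe (s.forceHat p) (s.slopeHat p) (extChartAt (model E E') p q)
      (chartDeriv (model E E') p q ξ) =
      (dt ξ, (chartDeriv 𝓘(ℝ, E) p.2.1.1 q.2.1.1 (θ ξ),
        chartDeriv 𝓘(ℝ, E) p.2.1.1 q.2.1.1 (s.ψ ξ)),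
        chartDeriv 𝓘(ℝ, E') p.2.2 q.2.2 (s.η ξ)) := by
  have hθ : chartDeriv 𝓘(ℝ, E) p.2.1.1 q.2.1.1 (comp ξ).2.1.1 -
      (comp ξ).1 • chartDeriv 𝓘(ℝ, E) p.2.1.1 q.2.1.1 (vel q) =
      chartDeriv 𝓘(ℝ, E) p.2.1.1 q.2.1.1 (θ ξ) := by
    simp [θ, dt]
  have h0 : chartDeriv (model E E') p q ξ = _ := chartDeriv_apply hq (comp ξ)
  have hu : (extChartAt (model E E') p q).2.1.2 =
      chartDeriv 𝓘(ℝ, E) p.2.1.1 q.2.1.1 (vel q) := by rw [extChartAt_apply hq]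
  rw [coframe_apply, h0]
  simp only [hu, hθ, s.chartDeriv_connCoeff hq, s.chartDeriv_psiCoeff hq, s.forceHat_extChartAt hq,
    s.slopeHat_extChartAt hq]
  have hq1 := ((mem_source_iff p q).1 hq).1
  have hsym := fderiv_fderiv_chartTransition_symm _ _ hq1
  refine Prod.ext rfl (Prod.ext (Prod.ext rfl ?_) ?_)
  · simp only [ψ, θ, dt, map_add, map_sub, map_smul, sub_apply, smul_apply]
    module
  · simp only [η, dt, map_add, map_sub, map_smul]

end

end ConstrainedSODE
end

/-! ### Vector fields, tensors and brackets in frame components. -/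

noncomputable section

namespace ConstrainedSODE

variable {E : Type*} [NormedAddCommGroup E] [NormedSpace ℝ E]
  {M : Type*} [TopologicalSpace M] [ChartedSpace E M] [IsManifold 𝓘(ℝ, E) ∞ M]
  {E' : Type*} [NormedAddCommGroup E'] [NormedSpace ℝ E']
  {B : Type*} [TopologicalSpace B] [ChartedSpace E' B] [IsManifold 𝓘(ℝ, E') ∞ B]

variable (s : ConstrainedSODE E M E' B)

section Pointwise

variable {p : Space E M B}

/-- The components `(dt, (θ, ψ), η)` of a tangent vector in the frame `Γ, H_a, V_a, ∂/∂x^α`. -/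
def frameVec (ξ : Tan E M E' B p) : Model E E' := (dt ξ, (θ ξ, s.ψ ξ), s.η ξ)

/-- The coframe is triangular in the coordinate components: dt, then θ, then ψ and η can be solved
in turn. Identities between tangent vectors are checked blockwise through this lemma. -/
lemma frameVec_injective : Function.Injective (s.frameVec (p := p)) := by
  intro ξ ζ h
  simp only [frameVec, ψ, η, θ, Prod.mk.injEq] at h
  obtain ⟨h1, ⟨h2, h3⟩, h4⟩ := h
  have h5 : (comp ξ).2.1.1 = (comp ζ).2.1.1 := by rw [h1] at h2; exact sub_left_inj.1 h2
  have h6 : (comp ξ).2.1.2 = (comp ζ).2.1.2 := by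
    rw [h2, h1] at h3
    exact sub_left_inj.1 (add_right_cancel h3)
  have h7 : (comp ξ).2.2 = (comp ζ).2.2 := by
    rw [h2, h1] at h4
    exact sub_left_inj.1 (add_right_cancel h4)
  exact Prod.ext h1 (Prod.ext (Prod.ext h5 h6) h7)

lemma frameVec_add (ξ ζ : Tan E M E' B p) :
    s.frameVec (ξ + ζ) = s.frameVec ξ + s.frameVec ζ := by
  have h : comp (ξ + ζ) = comp ξ + comp ζ := rfl
  simp only [frameVec, ψ, η, θ, dt, h]
  ext <;> simp only [Prod.fst_add, Prod.snd_add, map_add, map_sub, map_smul] <;> module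

lemma frameVec_smul (r : ℝ) (ξ : Tan E M E' B p) :
    s.frameVec (r • ξ) = r • s.frameVec ξ := by
  have h : comp (r • ξ) = r • comp ξ := rfl
  simp only [frameVec, ψ, η, θ, dt, h]
  ext <;> simp only [Prod.smul_fst, Prod.smul_snd, map_sub, map_smul, smul_eq_mul] <;> module

lemma frameVec_zero : s.frameVec (0 : Tan E M E' B p) = 0 := by
  have := s.frameVec_smul 0 (0 : Tan E M E' B p)
  rwa [zero_smul, zero_smul] at this

lemma frameVec_sub (ξ ζ : Tan E M E' B p) :
    s.frameVec (ξ - ζ) = s.frameVec ξ - s.frameVec ζ := by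
  have h := s.frameVec_add (ξ - ζ) ζ
  rw [sub_add_cancel] at h
  exact eq_sub_of_add_eq h.symm

lemma frameVec_vert (w : E) : s.frameVec (vert p w : Tan E M E' B p) = (0, (0, w), 0) := by
  simp [frameVec, ψ, η, θ, dt, vert, vec, comp]

lemma frameVec_cons (b : E') : s.frameVec (cons p b : Tan E M E' B p) = (0, (0, 0), b) := by
  simp [frameVec, ψ, η, θ, dt, cons, vec, comp]

lemma frameVec_horiz (a : E) : s.frameVec (s.horiz p a) = (0, (a, 0), 0) := by
  simp [frameVec, ψ, η, θ, dt, horiz, vec, comp]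

lemma frameVec_Γ : s.frameVec (s.Γ p) = (1, (0, 0), 0) := by
  simp [frameVec, ψ, η, θ, dt, Γ, vec, comp]

lemma frameVec_S (ξ : Tan E M E' B p) : s.frameVec (S p ξ) = (0, (0, θ ξ), 0) :=
  s.frameVec_vert _

lemma frameVec_Q (ξ : Tan E M E' B p) : s.frameVec (s.Q p ξ) = (0, (s.ψ ξ, 0), 0) :=
  s.frameVec_horiz _

lemma frameVec_PΓ (ξ : Tan E M E' B p) : s.frameVec (s.PΓ p ξ) = (dt ξ, (0, 0), 0) := by
  rw [PΓ, frameVec_smul, frameVec_Γ]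
  ext <;> simp

lemma frameVec_N (ξ : Tan E M E' B p) : s.frameVec (s.N p ξ) = (0, (0, 0), s.η ξ) :=
  s.frameVec_cons _

lemma frameVec_PH (ξ : Tan E M E' B p) : s.frameVec (s.PH p ξ) = (0, (θ ξ, 0), 0) :=
  s.frameVec_horiz _

lemma frameVec_PV (ξ : Tan E M E' B p) : s.frameVec (s.PV p ξ) = (0, (0, s.ψ ξ), 0) :=
  s.frameVec_vert _

end Pointwise

variable [FiniteDimensional ℝ E] [FiniteDimensional ℝ E'] {p q : Space E M B}

/-- The components of a vector field in the frame `Γ, H_a, V_a, ∂/∂x^α`, in the chart at `p`. -/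
def frameComp (p : Space E M B) (X : VField E M E' B) (z : Model E E') : Model E E' :=
  coframe (s.forceHat p) (s.slopeHat p) z (reading (model E E') p X z)

/-- The change of frame components induced by the change to the chart at `p`. -/
def frameChange (p q : Space E M B) (c : Model E E') : Model E E' :=
  (c.1, (chartDeriv 𝓘(ℝ, E) p.2.1.1 q.2.1.1 c.2.1.1, chartDeriv 𝓘(ℝ, E) p.2.1.1 q.2.1.1 c.2.1.2),
    chartDeriv 𝓘(ℝ, E') p.2.2 q.2.2 c.2.2)

lemma frameChange_self (p : Space E M B) (c : Model E E') : frameChange p p c = c := by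
  refine Prod.ext rfl (Prod.ext (Prod.ext ?_ ?_) ?_)
  · exact congr($(chartDeriv_self (I := 𝓘(ℝ, E)) p.2.1.1) _)
  · exact congr($(chartDeriv_self (I := 𝓘(ℝ, E)) p.2.1.1) _)
  · exact congr($(chartDeriv_self (I := 𝓘(ℝ, E')) p.2.2) _)

lemma frameComp_extChartAt (hq : q ∈ (extChartAt (model E E') p).source)
    (X : VField E M E' B) :
    s.frameComp p X (extChartAt (model E E') p q) = frameChange p q (s.frameVec (X q)) := by
  rw [frameComp, reading_extChartAt _ hq]
  exact s.coframe_chartDeriv hq (X q)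

lemma frameComp_of_mem_target {z : Model E E'} (hz : z ∈ (extChartAt (model E E') p).target)
    (X : VField E M E' B) : s.frameComp p X z =
      frameChange p ((extChartAt (model E E') p).symm z)
        (s.frameVec (X ((extChartAt (model E E') p).symm z))) := by
  have := s.frameComp_extChartAt ((extChartAt (model E E') p).map_target hz) X
  rwa [(extChartAt (model E E') p).right_inv hz] at this

lemma frameComp_self (X : VField E M E' B) :
    s.frameComp p X (extChartAt (model E E') p p) = s.frameVec (X p) := by
  rw [s.frameComp_extChartAt (mem_extChartAt_source p), frameChange_self]

lemma frame_frameComp (X : VField E M E' B) (z : Model E E') :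
    frame (s.forceHat p) (s.slopeHat p) z (s.frameComp p X z) = reading (model E E') p X z :=
  frame_coframe _ _ _ _

lemma contDiffAt_frameComp_iff (hq : q ∈ (extChartAt (model E E') p).source)
    (X : VField E M E' B) :
    ContDiffAt ℝ ∞ (s.frameComp p X) (extChartAt (model E E') p q) ↔
      ContMDiffAt (model E E') (model E E').tangent ∞
        (fun q => (⟨q, X q⟩ : TangentBundle (model E E') (Space E M B))) q := by
  rw [contMDiffAt_section_iff_reading hq]
  refine ⟨fun h => ?_, fun h => ?_⟩
  · have := contDiffAt_frame_apply (s.contDiffAt_forceHat hq) (s.contDiffAt_slopeHat hq) le_rfl h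
    simpa only [frame_frameComp] using this
  · exact contDiffAt_coframe_apply (s.contDiffAt_forceHat hq) (s.contDiffAt_slopeHat hq) le_rfl h

lemma differentiableAt_frameComp_iff (hq : q ∈ (extChartAt (model E E') p).source)
    (X : VField E M E' B) :
    DifferentiableAt ℝ (s.frameComp p X) (extChartAt (model E E') p q) ↔
      MDifferentiableAt (model E E') (model E E').tangent
        (fun q => (⟨q, X q⟩ : TangentBundle (model E E') (Space E M B))) q := by
  rw [mdifferentiableAt_section_iff_reading hq]
  refine ⟨fun h => ?_, fun h => ?_⟩
  · have := differentiableAt_frame_apply (s.contDiffAt_forceHat hq) (s.contDiffAt_slopeHat hq) h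
    simpa only [frame_frameComp] using this
  · exact differentiableAt_coframe_apply (s.contDiffAt_forceHat hq) (s.contDiffAt_slopeHat hq) h

lemma frameComp_sub (X Y : VField E M E' B) (z : Model E E') :
    s.frameComp p (X - Y) z = s.frameComp p X z - s.frameComp p Y z := by
  have : reading (model E E') p (X - Y) z =
      reading (model E E') p X z - reading (model E E') p Y z := map_sub (chartDeriv _ p _) _ _
  rw [frameComp, this, map_sub]; rfl

lemma frameComp_add (X Y : VField E M E' B) (z : Model E E') :
    s.frameComp p (X + Y) z = s.frameComp p X z + s.frameComp p Y z := by
  have : reading (model E E') p (X + Y) z =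
      reading (model E E') p X z + reading (model E E') p Y z := map_add (chartDeriv _ p _) _ _
  rw [frameComp, this, map_add]; rfl

lemma frameComp_smul (r : Space E M B → ℝ) (X : VField E M E' B) (z : Model E E') :
    s.frameComp p (fun q => r q • X q) z =
      r ((extChartAt (model E E') p).symm z) • s.frameComp p X z := by
  have : reading (model E E') p (fun q => r q • X q) z =
      r ((extChartAt (model E E') p).symm z) • reading (model E E') p X z :=
    map_smul (chartDeriv _ p _) _ _
  rw [frameComp, this, map_smul]; rfl

section Tensors

variable {z : Model E E'} (hz : z ∈ (extChartAt (model E E') p).target) (X : VField E M E' B)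
include hz

/-- `frameChange` uses the same Jacobian on the H and V blocks, so exchanging these blocks commutes
with it and S keeps a constant matrix at every point of the chart. The same holds for Q and the
projectors. -/
lemma frameComp_S : s.frameComp p (app S X) z = (0, (0, (s.frameComp p X z).2.1.1), 0) := by
  rw [s.frameComp_of_mem_target hz, s.frameComp_of_mem_target hz, app, frameVec_S]
  simp [frameChange, frameVec]

lemma frameComp_Q : s.frameComp p (app s.Q X) z = (0, ((s.frameComp p X z).2.1.2, 0), 0) := by
  rw [s.frameComp_of_mem_target hz, s.frameComp_of_mem_target hz, app, frameVec_Q]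
  simp [frameChange, frameVec]

lemma frameComp_PH : s.frameComp p (app s.PH X) z = (0, ((s.frameComp p X z).2.1.1, 0), 0) := by
  rw [s.frameComp_of_mem_target hz, s.frameComp_of_mem_target hz, app, frameVec_PH]
  simp [frameChange, frameVec]

lemma frameComp_PV : s.frameComp p (app s.PV X) z = (0, (0, (s.frameComp p X z).2.1.2), 0) := by
  rw [s.frameComp_of_mem_target hz, s.frameComp_of_mem_target hz, app, frameVec_PV]
  simp [frameChange, frameVec]

lemma frameComp_PΓ : s.frameComp p (app s.PΓ X) z = ((s.frameComp p X z).1, (0, 0), 0) := by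
  rw [s.frameComp_of_mem_target hz, s.frameComp_of_mem_target hz, app, frameVec_PΓ]
  simp [frameChange, frameVec]

lemma frameComp_N : s.frameComp p (app s.N X) z = (0, (0, 0), (s.frameComp p X z).2.2) := by
  rw [s.frameComp_of_mem_target hz, s.frameComp_of_mem_target hz, app, frameVec_N]
  simp [frameChange, frameVec]

omit X in
lemma frameComp_Γ : s.frameComp p s.Γ z = (1, (0, 0), 0) := by
  rw [s.frameComp_of_mem_target hz, frameVec_Γ]
  simp [frameChange]

lemma frameComp_fst : (s.frameComp p X z).1 = dtFun X ((extChartAt (model E E') p).symm z) := by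
  rw [s.frameComp_of_mem_target hz]
  rfl

end Tensors

/-- The coframe is applied to the flat bracket: by the product rule the components are
differentiated, and the derivatives of the coframe leave an antisymmetric correction, its exterior
derivative on (X, Y). -/
lemma frameComp_bracket (hq : q ∈ (extChartAt (model E E') p).source) {X Y : VField E M E' B}
    (hX : DifferentiableAt ℝ (s.frameComp p X) (extChartAt (model E E') p q))
    (hY : DifferentiableAt ℝ (s.frameComp p Y) (extChartAt (model E E') p q)) :
    s.frameComp p (bracket X Y) (extChartAt (model E E') p q) =
      fderiv ℝ (s.frameComp p Y) (extChartAt (model E E') p q)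
        (reading (model E E') p X (extChartAt (model E E') p q)) -
      fderiv ℝ (s.frameComp p X) (extChartAt (model E E') p q)
        (reading (model E E') p Y (extChartAt (model E E') p q)) -
      (dcoframe (s.forceHat p) (s.slopeHat p) (extChartAt (model E E') p q)
        (reading (model E E') p X (extChartAt (model E E') p q))
        (reading (model E E') p Y (extChartAt (model E E') p q)) -
       dcoframe (s.forceHat p) (s.slopeHat p) (extChartAt (model E E') p q)
        (reading (model E E') p Y (extChartAt (model E E') p q))
        (reading (model E E') p X (extChartAt (model E E') p q))) := by
  have hX' := (mdifferentiableAt_section_iff_reading hq X).1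
    ((s.differentiableAt_frameComp_iff hq X).1 hX)
  have hY' := (mdifferentiableAt_section_iff_reading hq Y).1
    ((s.differentiableAt_frameComp_iff hq Y).1 hY)
  have hf := s.contDiffAt_forceHat hq
  have hg := s.contDiffAt_slopeHat hq
  have e1 := fderiv_coframe_apply hf hg hX'
    (reading (model E E') p Y (extChartAt (model E E') p q))
  have e2 := fderiv_coframe_apply hf hg hY'
    (reading (model E E') p X (extChartAt (model E E') p q))
  have e3 : s.frameComp p (bracket X Y) (extChartAt (model E E') p q) =
      coframe (s.forceHat p) (s.slopeHat p) (extChartAt (model E E') p q)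
      (reading (model E E') p (bracket X Y) (extChartAt (model E E') p q)) := rfl
  have e4 : (fun z => coframe (s.forceHat p) (s.slopeHat p) z (reading (model E E') p X z)) =
    s.frameComp p X := rfl
  have e5 : (fun z => coframe (s.forceHat p) (s.slopeHat p) z (reading (model E E') p Y z)) =
    s.frameComp p Y := rfl
  rw [e4] at e1
  rw [e5] at e2
  rw [e1, e2, e3, bracket, reading_mlieBracket hq hX' hY', map_sub]
  abel

lemma dirDeriv_dtFun (hq : q ∈ (extChartAt (model E E') p).source) (X : VField E M E' B)
    {Y : VField E M E' B}
    (hY : DifferentiableAt ℝ (s.frameComp p Y) (extChartAt (model E E') p q)) :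
    dirDeriv X (dtFun Y) q = (fderiv ℝ (s.frameComp p Y) (extChartAt (model E E') p q)
      (reading (model E E') p X (extChartAt (model E E') p q))).1 := by
  have h1 : (dtFun Y ∘ (extChartAt (model E E') p).symm) =ᶠ[𝓝 (extChartAt (model E E') p q)]
      fun z => (s.frameComp p Y z).1 := by
    filter_upwards [(isOpen_extChartAt_target p).mem_nhds
      ((extChartAt (model E E') p).map_source hq)] with z hz
    exact (s.frameComp_fst hz Y).symm
  have h2 := mfderiv_apply_eq_fderiv_comp_symm hq
    (h1.differentiableAt_iff.2 hY.fst) (X q)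
  rw [h1.fderiv_eq, fderiv.fst hY] at h2
  rw [reading_extChartAt _ hq]
  exact h2

lemma frameVec_derivN (D : CovariantDerivative 𝓘(ℝ, E') E' (TangentSpace 𝓘(ℝ, E') : B → Type _))
    (hq : q ∈ (extChartAt (model E E') p).source) (X : VField E M E' B) {Y : VField E M E' B}
    (hY : DifferentiableAt ℝ (s.frameComp p Y) (extChartAt (model E E') p q)) :
    s.frameComp p (derivN D (app s.N X) (app s.N Y)) (extChartAt (model E E') p q) =
      (0, (0, 0), (fderiv ℝ (s.frameComp p Y) (extChartAt (model E E') p q)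
        (inclB E E' (s.frameComp p X (extChartAt (model E E') p q)).2.2)).2.2 +
        christoffel D p.2.2 q.2.2 (s.frameComp p Y (extChartAt (model E E') p q)).2.2
          (s.frameComp p X (extChartAt (model E E') p q)).2.2) := by
  have hq1 := (mem_source_iff p q).1 hq
  let Z : ∀ y : B, TangentSpace 𝓘(ℝ, E') y := fun y =>
    (id (s.η (Y (q.1, q.2.1, y))) : E')
  obtain ⟨b, hb⟩ : ∃ b : E', b = D Z q.2.2 (s.η (X q)) := ⟨_, rfl⟩
  have h0 : derivN D (app s.N X) (app s.N Y) q = cons q b := by rw [hb]; rfl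
  rw [s.frameComp_extChartAt hq, h0, frameVec_cons, s.frameComp_extChartAt hq X,
    s.frameComp_extChartAt hq Y]
  -- This parametrises the slice {(t, v)} × B in the chart at p. It is affine with linear part
  -- `inclB`, so derivatives along B become partial derivatives of the frame components.
  let r : E' → Model E E' := fun y => (q.1, (extChartAt (model E E') p q).2.1, y)
  have hr : HasFDerivAt (𝕜 := ℝ) (E := E') r (inclB E E') (extChartAt 𝓘(ℝ, E') p.2.2 q.2.2) := by
    have h1 := (inclB E E').hasFDerivAt (x := extChartAt 𝓘(ℝ, E') p.2.2 q.2.2)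
    have h2 := h1.add_const ((q.1, (extChartAt (model E E') p q).2.1, 0) : Model E E')
    refine h2.congr_of_eventuallyEq (Filter.Eventually.of_forall fun y => ?_)
    simp [r]
  have hr0 : r (extChartAt 𝓘(ℝ, E') p.2.2 q.2.2) = extChartAt (model E E') p q := by
    simp only [r, extChartAt_apply hq]
  have hZ : reading 𝓘(ℝ, E') p.2.2 Z =ᶠ[𝓝 (extChartAt 𝓘(ℝ, E') p.2.2 q.2.2)]
      fun y => (s.frameComp p Y (r y)).2.2 := by
    filter_upwards [(isOpen_extChartAt_target p.2.2).mem_nhds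
      ((extChartAt 𝓘(ℝ, E') p.2.2).map_source hq1.2)] with y hy
    have hy1 := (extChartAt 𝓘(ℝ, E') p.2.2).map_target hy
    have hq' : ((q.1, q.2.1, (extChartAt 𝓘(ℝ, E') p.2.2).symm y) : Space E M B) ∈
      (extChartAt (model E E') p).source := (mem_source_iff _ _).2 ⟨hq1.1, hy1⟩
    have e : r y = extChartAt (model E E') p (q.1, q.2.1, (extChartAt 𝓘(ℝ, E') p.2.2).symm y) := by
      rw [extChartAt_apply hq', (extChartAt 𝓘(ℝ, E') p.2.2).right_inv hy]
      simp only [r, extChartAt_apply hq]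
      rfl
    rw [e, s.frameComp_extChartAt hq']
    rfl
  rw [← hr0] at hY
  have hc := hY.hasFDerivAt.comp (extChartAt 𝓘(ℝ, E') p.2.2 q.2.2) hr
  have hd : HasFDerivAt (fun y => (s.frameComp p Y (r y)).2.2) _
    (extChartAt 𝓘(ℝ, E') p.2.2 q.2.2) := hc.snd.snd
  have hZd := (mdifferentiableAt_section_iff_reading hq1.2 Z).2
    (hZ.differentiableAt_iff.2 hd.differentiableAt)
  have key := chartDeriv_covariantDerivative D hq1.2 hZd (s.η (X q))
  rw [hZ.fderiv_eq, hd.fderiv] at key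
  simp only [frameChange, frameVec, map_zero]
  rw [← hr0]
  refine Prod.ext rfl (Prod.ext rfl ?_)
  rw [hb]
  exact key

end ConstrainedSODE
end

/-! ### The connection form of the glued derivative. -/

noncomputable section

namespace ConstrainedSODE

variable {E : Type*} [NormedAddCommGroup E] [NormedSpace ℝ E]
  {M : Type*} [TopologicalSpace M] [ChartedSpace E M] [IsManifold 𝓘(ℝ, E) ∞ M]
  {E' : Type*} [NormedAddCommGroup E'] [NormedSpace ℝ E']
  {B : Type*} [TopologicalSpace B] [ChartedSpace E' B] [IsManifold 𝓘(ℝ, E') ∞ B]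

variable [FiniteDimensional ℝ E] [FiniteDimensional ℝ E']

/-- The endomorphisms of the space of frame components that act by scalars between the blocks:
`a`, `h`, `v`, `n` on the blocks of `Γ`, `H`, `V`, `∂/∂x^α`, moreover `k` from the block of `V` to
that of `H` and `l` in the opposite direction. -/
def block (a h v n k l : ℝ) : Model E E' →L[ℝ] Model E E' :=
  LinearMap.toContinuousLinearMap
    { toFun := fun c => (a • c.1, (h • c.2.1.1 + k • c.2.1.2, l • c.2.1.1 + v • c.2.1.2), n • c.2.2)
      map_add' := fun ξ ζ => by ext <;> simp only [Prod.fst_add, Prod.snd_add] <;> module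
      map_smul' := fun r ξ => by
        ext <;> simp only [Prod.smul_fst, Prod.smul_snd, RingHom.id_apply] <;> module }

lemma block_apply (a h v n k l : ℝ) (c : Model E E') : block a h v n k l c =
    (a • c.1, (h • c.2.1.1 + k • c.2.1.2, l • c.2.1.1 + v • c.2.1.2), n • c.2.2) := rfl

section Projections

variable (a h v n k l : ℝ) (c : Model E E') (f : Model E E' → E) (g : Model E E' → E')
  (z : Model E E')

lemma block_fst : (block a h v n k l c).1 = a * c.1 := rfl
lemma block_H : (block a h v n k l c).2.1.1 = h • c.2.1.1 + k • c.2.1.2 := rfl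
lemma block_V : (block a h v n k l c).2.1.2 = l • c.2.1.1 + v • c.2.1.2 := rfl
lemma block_B : (block a h v n k l c).2.2 = n • c.2.2 := rfl
lemma frame_fst : (frame f g z c).1 = c.1 := rfl
lemma frame_H : (frame f g z c).2.1.1 = c.2.1.1 + c.1 • z.2.1.2 := rfl
lemma frame_V : (frame f g z c).2.1.2 = c.2.1.2 + c.1 • f z - connHat f z c.2.1.1 := rfl
lemma inclU_fst (w : E) : (inclU E E' w).1 = 0 := rfl
lemma inclU_H (w : E) : (inclU E E' w).2.1.1 = 0 := rfl
lemma inclU_V (w : E) : (inclU E E' w).2.1.2 = w := rfl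
lemma inclB_fst (b : E') : (inclB E E' b).1 = 0 := rfl
lemma inclB_U (b : E') : (inclB E E' b).2.1 = 0 := rfl

end Projections

section Omega

variable (f : Model E E' → E) (g : Model E E' → E') (z : Model E E')

/-- The connection form of the glued connection on the blocks of `H` and `V`, applied to the
component `a`. -/
def omegaU (a : E) : Model E E' →L[ℝ] E :=
  (ContinuousLinearMap.fst ℝ ℝ ((E × E) × E')).smulRight (connHat f z a) +
    (fderiv ℝ (connHat f) z (inclU E E' a)) ∘L (ContinuousLinearMap.fst ℝ E E) ∘L
      (ContinuousLinearMap.fst ℝ (E × E) E') ∘L (ContinuousLinearMap.snd ℝ ℝ ((E × E) × E')) ∘L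
      (coframe f g z)

/-- The connection form of the glued connection on the block of `∂/∂x^α`, applied to the
component `b`; here `Υ` are the Christoffel symbols of the connection on `B`. -/
def omegaB (Υ : E' → E' →L[ℝ] E') (b : E') : Model E E' →L[ℝ] E' :=
  Υ b ∘L (ContinuousLinearMap.snd ℝ (E × E) E') ∘L
      (ContinuousLinearMap.snd ℝ ℝ ((E × E) × E')) ∘L (coframe f g z) -
    (ContinuousLinearMap.fst ℝ ℝ ((E × E) × E')).smulRight (fderiv ℝ g z (inclB E E' b)) +
    (fderiv ℝ (psiHat g) z (inclB E E' b)) ∘L (ContinuousLinearMap.fst ℝ E E) ∘L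
      (ContinuousLinearMap.fst ℝ (E × E) E') ∘L (ContinuousLinearMap.snd ℝ ℝ ((E × E) × E')) ∘L
      (coframe f g z)

/-- The connection form of the glued connection in the frame `Γ, H_a, V_a, ∂/∂x^α`, applied to the
components `c`. -/
def omega (Υ : E' → E' →L[ℝ] E') (c : Model E E') : Model E E' →L[ℝ] Model E E' :=
  (0 : Model E E' →L[ℝ] ℝ).prod
    (((omegaU f g z c.2.1.1).prod (omegaU f g z c.2.1.2)).prod (omegaB f g z Υ c.2.2))

lemma omega_apply (Υ : E' → E' →L[ℝ] E') (c ξ : Model E E') : omega f g z Υ c ξ =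
    (0, (ξ.1 • connHat f z c.2.1.1 +
        fderiv ℝ (connHat f) z (inclU E E' c.2.1.1) (coframe f g z ξ).2.1.1,
      ξ.1 • connHat f z c.2.1.2 +
        fderiv ℝ (connHat f) z (inclU E E' c.2.1.2) (coframe f g z ξ).2.1.1),
      Υ c.2.2 (coframe f g z ξ).2.2 - ξ.1 • fderiv ℝ g z (inclB E E' c.2.2) +
        fderiv ℝ (psiHat g) z (inclB E E' c.2.2) (coframe f g z ξ).2.1.1) := rfl

lemma omega_add {Υ : E' → E' →L[ℝ] E'} (hΥ : ∀ b b', Υ (b + b') = Υ b + Υ b')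
    (c c' ξ : Model E E') :
    omega f g z Υ (c + c') ξ = omega f g z Υ c ξ + omega f g z Υ c' ξ := by
  simp only [omega_apply, Prod.fst_add, Prod.snd_add, map_add, hΥ, add_apply]
  ext <;> simp <;> module

lemma omega_smul {Υ : E' → E' →L[ℝ] E'} (hΥ : ∀ (r : ℝ) b, Υ (r • b) = r • Υ b)
    (r : ℝ) (c ξ : Model E E') :
    omega f g z Υ (r • c) ξ = r • omega f g z Υ c ξ := by
  simp only [omega_apply, Prod.smul_fst, Prod.smul_snd, map_smul, hΥ, smul_apply]
  ext <;> simp <;> module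

/-- The H and V blocks carry the same form `omegaU`, so mixing them by scalars commutes with ω. This
is the reason why S, Q and N are parallel. -/
lemma omega_block {Υ : E' → E' →L[ℝ] E'} (hΥ : ∀ (r : ℝ) b, Υ (r • b) = r • Υ b)
    (a h v n k l : ℝ) (c ξ : Model E E') :
    omega f g z Υ (block a h v n k l c) ξ = block a h v n k l (omega f g z Υ c ξ) := by
  simp only [omega_apply, block_apply, map_add, map_smul, hΥ, smul_apply, add_apply]
  ext <;> simp <;> module

end Omega

variable (s : ConstrainedSODE E M E' B) {p q : Space E M B}

section FrameLinear

variable {X X' Y Y' : VField E M E' B} {L L' : Model E E' →L[ℝ] Model E E'}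

lemma hasFDerivAt_frameComp_of_linear (hq : q ∈ (extChartAt (model E E') p).source)
    (hX : DifferentiableAt ℝ (s.frameComp p X) (extChartAt (model E E') p q))
    (h : ∀ z ∈ (extChartAt (model E E') p).target,
      s.frameComp p X' z = L (s.frameComp p X z)) :
    HasFDerivAt (s.frameComp p X')
      (L ∘L fderiv ℝ (s.frameComp p X) (extChartAt (model E E') p q))
      (extChartAt (model E E') p q) := by
  refine (L.hasFDerivAt.comp _ hX.hasFDerivAt).congr_of_eventuallyEq ?_
  filter_upwards [(isOpen_extChartAt_target p).mem_nhds
    ((extChartAt (model E E') p).map_source hq)] with z hz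
  exact h z hz

/-- All fields in the seven-term formula arise from X and Y by constant block matrices, so their
brackets need only the derivatives of the components of X and Y themselves. -/
lemma frameComp_bracket_of_linear (hq : q ∈ (extChartAt (model E E') p).source)
    (hX : DifferentiableAt ℝ (s.frameComp p X) (extChartAt (model E E') p q))
    (hY : DifferentiableAt ℝ (s.frameComp p Y) (extChartAt (model E E') p q))
    (h : ∀ z ∈ (extChartAt (model E E') p).target,
      s.frameComp p X' z = L (s.frameComp p X z))
    (h' : ∀ z ∈ (extChartAt (model E E') p).target,
      s.frameComp p Y' z = L' (s.frameComp p Y z)) {f g z c d}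
    (hf : f = s.forceHat p) (hg : g = s.slopeHat p) (hz : z = extChartAt (model E E') p q)
    (hc : c = s.frameComp p X z) (hd : d = s.frameComp p Y z) :
    s.frameComp p (bracket X' Y') z =
      L' (fderiv ℝ (s.frameComp p Y) z (frame f g z (L c))) -
      L (fderiv ℝ (s.frameComp p X) z (frame f g z (L' d))) -
      (dcoframe f g z (frame f g z (L c)) (frame f g z (L' d)) -
       dcoframe f g z (frame f g z (L' d)) (frame f g z (L c))) := by
  subst hf hg hc hd hz
  have hz := (extChartAt (model E E') p).map_source hq
  have h1 := s.hasFDerivAt_frameComp_of_linear hq hX h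
  have h2 := s.hasFDerivAt_frameComp_of_linear hq hY h'
  rw [s.frameComp_bracket hq h1.differentiableAt h2.differentiableAt, h1.fderiv, h2.fderiv,
    ← h _ hz, ← h' _ hz, frame_frameComp, frame_frameComp]
  rfl

end FrameLinear

variable (D : CovariantDerivative 𝓘(ℝ, E') E' (TangentSpace 𝓘(ℝ, E') : B → Type _))

/-- The glued derivative in the frame `Γ, H_a, V_a, ∂/∂x^α`. -/
lemma frameComp_explicit (hq : q ∈ (extChartAt (model E E') p).source) {X Y : VField E M E' B}
    (hX : DifferentiableAt ℝ (s.frameComp p X) (extChartAt (model E E') p q))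
    (hY : DifferentiableAt ℝ (s.frameComp p Y) (extChartAt (model E E') p q)) :
    s.frameComp p (s.explicit D X Y) (extChartAt (model E E') p q) =
      fderiv ℝ (s.frameComp p Y) (extChartAt (model E E') p q)
        (chartDeriv (model E E') p q (X q)) +
      omega (s.forceHat p) (s.slopeHat p) (extChartAt (model E E') p q)
        (christoffel D p.2.2 q.2.2) (s.frameComp p Y (extChartAt (model E E') p q))
        (chartDeriv (model E E') p q (X q)) := by
  have hz := (extChartAt (model E E') p).map_source hq
  have bPH : ∀ (X : VField E M E' B), ∀ z ∈ (extChartAt (model E E') p).target,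
      s.frameComp p (app s.PH X) z = block 0 1 0 0 0 0 (s.frameComp p X z) := fun X z hz => by
    simp [s.frameComp_PH hz, block_apply]
  have bPV : ∀ (X : VField E M E' B), ∀ z ∈ (extChartAt (model E E') p).target,
      s.frameComp p (app s.PV X) z = block 0 0 1 0 0 0 (s.frameComp p X z) := fun X z hz => by
    simp [s.frameComp_PV hz, block_apply]
  have bN : ∀ (X : VField E M E' B), ∀ z ∈ (extChartAt (model E E') p).target,
      s.frameComp p (app s.N X) z = block 0 0 0 1 0 0 (s.frameComp p X z) := fun X z hz => by
    simp [s.frameComp_N hz, block_apply]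
  have bS : ∀ (X : VField E M E' B), ∀ z ∈ (extChartAt (model E E') p).target,
      s.frameComp p (app S X) z = block 0 0 0 0 0 1 (s.frameComp p X z) := fun X z hz => by
    simp [s.frameComp_S hz, block_apply]
  have bQ : ∀ (X : VField E M E' B), ∀ z ∈ (extChartAt (model E E') p).target,
      s.frameComp p (app s.Q X) z = block 0 0 0 0 1 0 (s.frameComp p X z) := fun X z hz => by
    simp [s.frameComp_Q hz, block_apply]
  have bPH' : ∀ (X : VField E M E' B), ∀ z ∈ (extChartAt (model E E') p).target,
      s.frameComp p (X - app s.PH X) z = block 1 0 1 1 0 0 (s.frameComp p X z) :=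
    fun X z hz => by rw [frameComp_sub, s.frameComp_PH hz, block_apply]; ext <;> simp
  have bPV' : ∀ (X : VField E M E' B), ∀ z ∈ (extChartAt (model E E') p).target,
      s.frameComp p (X - app s.PV X) z = block 1 1 0 1 0 0 (s.frameComp p X z) :=
    fun X z hz => by rw [frameComp_sub, s.frameComp_PV hz, block_apply]; ext <;> simp
  have bN' : ∀ (X : VField E M E' B), ∀ z ∈ (extChartAt (model E E') p).target,
      s.frameComp p (X - app s.N X) z = block 1 1 1 0 0 0 (s.frameComp p X z) :=
    fun X z hz => by rw [frameComp_sub, s.frameComp_N hz, block_apply]; ext <;> simp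
  have hd := s.dirDeriv_dtFun hq X hY
  have hn := s.frameVec_derivN D hq X hY
  rw [← reading_extChartAt _ hq]
  set z := extChartAt (model E E') p q with hzq
  set f := s.forceHat p with hf
  set g := s.slopeHat p with hg
  set c := s.frameComp p X z with hc
  set d := s.frameComp p Y z with hdd
  have hxc : reading (model E E') p X z = frame f g z c := (s.frame_frameComp X z).symm
  have hΓ : s.frameComp p (fun q => dirDeriv X (dtFun Y) q • s.Γ q) z =
      ((fderiv ℝ (s.frameComp p Y) z (frame f g z c)).1, (0, 0), 0) := by
    rw [frameComp_smul, s.frameComp_Γ hz, hzq, (extChartAt (model E E') p).left_inv hq, ← hzq, hd,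
      ← hxc]
    ext <;> simp
  have hH := s.frameComp_bracket_of_linear hq hX hY (bPH X) (bS Y) hf hg hzq hc hdd
  have hV := s.frameComp_bracket_of_linear hq hX hY (bPV X) (bQ Y) hf hg hzq hc hdd
  have hN := s.frameComp_bracket_of_linear hq hX hY (bN' X) (bN Y) hf hg hzq hc hdd
  have hPH := s.frameComp_bracket_of_linear hq hX hY (bPH' X) (bPH Y) hf hg hzq hc hdd
  have hPV := s.frameComp_bracket_of_linear hq hX hY (bPV' X) (bPV Y) hf hg hzq hc hdd
  rw [explicit]
  simp only [frameComp_add, s.frameComp_Q hz, s.frameComp_S hz, s.frameComp_N hz,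
    s.frameComp_PH hz, s.frameComp_PV hz, hΓ, hn, hH, hV, hN, hPH, hPV, hxc]
  clear_value f g c d
  -- The number -2 inverts the factor -1/2 in the definition of `connHat`.
  have hU : ∀ w : E, fderiv ℝ f z (inclU E E' w) = (-2 : ℝ) • connHat f z w := fun w => by
    simp [connHat, smul_smul]
  -- In each block the formula differentiates Y once along P(X) and once along X - P(X). The three
  -- splittings, for P_H, P_V and N, recombine these into the derivative along X.
  have e1 : frame f g z c = frame f g z (block 0 1 0 0 0 0 c) +
      frame f g z (block 1 0 1 1 0 0 c) := by
    rw [← map_add]; congr 1; ext <;> simp [block_apply]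
  have e2 : frame f g z c = inclU E E' c.2.1.2 + frame f g z (block 1 1 0 1 0 0 c) := by
    have : inclU E E' c.2.1.2 = frame f g z (block 0 0 1 0 0 0 c) := by
      simp [frame_apply, block_apply]
    rw [this, ← map_add]; congr 1; ext <;> simp [block_apply]
  have e3 : frame f g z c = inclB E E' c.2.2 + frame f g z (block 1 1 1 0 0 0 c) := by
    have : inclB E E' c.2.2 = frame f g z (block 0 0 0 1 0 0 c) := by
      simp [frame_apply, block_apply]
    rw [this, ← map_add]; congr 1; ext <;> simp [block_apply]
  have k1 : frame f g z (block 0 0 1 0 0 0 c) = inclU E E' c.2.1.2 := by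
    simp [frame_apply, block_apply]
  have k2 : frame f g z (block 0 0 0 0 0 1 d) = inclU E E' d.2.1.1 := by
    simp [frame_apply, block_apply]
  have k3 : frame f g z (block 0 0 1 0 0 0 d) = inclU E E' d.2.1.2 := by
    simp [frame_apply, block_apply]
  have k4 : frame f g z (block 0 0 0 1 0 0 d) = inclB E E' d.2.2 := by
    simp [frame_apply, block_apply]
  refine Prod.ext ?_ (Prod.ext (Prod.ext ?_ ?_) ?_)
  · simp [omega_apply]
  · have := congrArg (fun x : Model E E' => (fderiv ℝ (s.frameComp p Y) z x).2.1.1) e1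
    simp only [map_add, Prod.fst_add, Prod.snd_add] at this
    simp [-inclU_apply, -inclB_apply, omega_apply, dcoframe, block_fst, block_H, block_V, block_B,
      frame_fst, frame_H, frame_V, inclU_fst, inclU_H, inclU_V, inclB_fst, inclB_U, k2, this]
    module
  · have := congrArg (fun x : Model E E' => (fderiv ℝ (s.frameComp p Y) z x).2.1.2) e2
    simp only [map_add, Prod.fst_add, Prod.snd_add] at this
    simp [-inclU_apply, -inclB_apply, omega_apply, dcoframe, block_fst, block_H, block_V, block_B,
      frame_fst, frame_H, frame_V, inclU_fst, inclU_H, inclU_V, inclB_fst, inclB_U, k1, k3, this, hU]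
    module
  · have := congrArg (fun x : Model E E' => (fderiv ℝ (s.frameComp p Y) z x).2.2) e3
    simp only [map_add, Prod.fst_add, Prod.snd_add] at this
    simp [-inclU_apply, -inclB_apply, omega_apply, dcoframe, block_fst, block_H, block_V, block_B,
      frame_fst, frame_H, frame_V, inclU_fst, inclU_H, inclU_V, inclB_fst, inclB_U, k4, this]
    module

end ConstrainedSODE
end

/-! ### The glued connection: construction, smoothness and agreement with both formulas. -/

noncomputable section

/-- A linear map on a finite-dimensional space is determined, through a linear isomorphism, by its
values on a basis. -/
lemma contDiffAt_of_clm_apply {V F G : Type*} [NormedAddCommGroup V] [NormedSpace ℝ V]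
    [NormedAddCommGroup F] [NormedSpace ℝ F] [FiniteDimensional ℝ F]
    [NormedAddCommGroup G] [NormedSpace ℝ G] {n : ℕ∞ω} {f : V → F →L[ℝ] G} {x : V}
    (h : ∀ c, ContDiffAt ℝ n (fun v => f v c) x) : ContDiffAt ℝ n f x := by
  let d := Module.finrank ℝ F
  have hd : d = Module.finrank ℝ (Fin d → ℝ) := (Module.finrank_fin_fun ℝ).symm
  let e₁ := ContinuousLinearEquiv.ofFinrankEq hd
  let e₂ := (e₁.arrowCongr (1 : G ≃L[ℝ] G)).trans (ContinuousLinearEquiv.piRing (Fin d))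
  rw [← Function.id_comp f, ← e₂.symm_comp_self]
  exact e₂.symm.contDiff.contDiffAt.comp x (contDiffAt_pi.2 fun i => h _)

namespace ConstrainedSODE

variable {E : Type*} [NormedAddCommGroup E] [NormedSpace ℝ E]
  {M : Type*} [TopologicalSpace M] [ChartedSpace E M] [IsManifold 𝓘(ℝ, E) ∞ M]
  {E' : Type*} [NormedAddCommGroup E'] [NormedSpace ℝ E']
  {B : Type*} [TopologicalSpace B] [ChartedSpace E' B] [IsManifold 𝓘(ℝ, E') ∞ B]

variable [FiniteDimensional ℝ E] [FiniteDimensional ℝ E']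

variable (s : ConstrainedSODE E M E' B) {p q : Space E M B}

variable (D : CovariantDerivative 𝓘(ℝ, E') E' (TangentSpace 𝓘(ℝ, E') : B → Type _))

lemma contDiffAt_omega_apply
    {f : Model E E' → E} {g : Model E E' → E'} {z : Model E E'}
    (hf : ContDiffAt ℝ ∞ f z) (hg : ContDiffAt ℝ ∞ g z) {W : Model E E' → Model E E'}
    (hW : ContDiffAt ℝ ∞ W z) {Υ : Model E E' → E' → E' →L[ℝ] E'}
    (hΥ : ContDiffAt ℝ ∞ (fun z => Υ z (W z).2.2) z) (c : Model E E') :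
    ContDiffAt ℝ ∞ (fun z => omega f g z (Υ z) (W z) c) z := by
  have h4 := contDiffAt_coframe_apply hf hg le_rfl (Y := fun _ => c) contDiffAt_const
  have h5 := contDiffAt_connHat hf
  have h6 := contDiffAt_psiHat hg
  have h7 : ContDiffAt ℝ ∞ (fun z => fderiv ℝ (connHat f) z) z := h5.fderiv_right le_rfl
  have h8 : ContDiffAt ℝ ∞ (fun z => fderiv ℝ (psiHat g) z) z := h6.fderiv_right le_rfl
  have h9 : ContDiffAt ℝ ∞ (fun z => fderiv ℝ g z) z := hg.fderiv_right le_rfl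
  simp only [omega_apply]
  have i1 : ContDiffAt ℝ ∞ (fun z => inclU E E' (W z).2.1.1) z :=
    (inclU E E').contDiff.contDiffAt.comp z hW.snd.fst.fst
  have i2 : ContDiffAt ℝ ∞ (fun z => inclU E E' (W z).2.1.2) z :=
    (inclU E E').contDiff.contDiffAt.comp z hW.snd.fst.snd
  have i3 : ContDiffAt ℝ ∞ (fun z => inclB E E' (W z).2.2) z :=
    (inclB E E').contDiff.contDiffAt.comp z hW.snd.snd
  refine contDiffAt_const.prodMk (ContDiffAt.prodMk (ContDiffAt.prodMk ?_ ?_) ?_)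
  · exact ((h5.clm_apply hW.snd.fst.fst).const_smul c.1).add
      ((h7.clm_apply i1).clm_apply h4.snd.fst.fst)
  · exact ((h5.clm_apply hW.snd.fst.snd).const_smul c.1).add
      ((h7.clm_apply i2).clm_apply h4.snd.fst.fst)
  · exact ((hΥ.clm_apply h4.snd.snd).sub ((h9.clm_apply i3).const_smul c.1)).add
      ((h8.clm_apply i3).clm_apply h4.snd.fst.fst)

lemma frameVec_eq_coframe (ξ : Tan E M E' B p) : s.frameVec ξ =
    coframe (s.forceHat p) (s.slopeHat p) (extChartAt (model E E') p p) ξ := by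
  have h := s.coframe_chartDeriv (mem_extChartAt_source p) ξ
  have h2 : chartDeriv (model E E') p p ξ = ξ := congr($(chartDeriv_self (I := model E E') p) ξ)
  rw [h2] at h
  rw [h]
  exact (frameChange_self (E' := E') p (s.frameVec ξ)).symm

lemma coframe_chartDeriv_eq_frameChange (hq : q ∈ (extChartAt (model E E') p).source)
    (ξ : Tan E M E' B q) :
    coframe (s.forceHat p) (s.slopeHat p) (extChartAt (model E E') p q)
      (chartDeriv (model E E') p q ξ) = frameChange p q (s.frameVec ξ) :=
  s.coframe_chartDeriv hq ξ

/-- The glued derivative as a map of all sections, defined by its expression in the frame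
`Γ, H_a, V_a, ∂/∂x^α`. -/
def gluedFun (Y : VField E M E' B) (p : Space E M B) :
    Tan E M E' B p →L[ℝ] Tan E M E' B p :=
  show Model E E' →L[ℝ] Model E E' from
    frame (s.forceHat p) (s.slopeHat p) (extChartAt (model E E') p p) ∘L
      (fderiv ℝ (s.frameComp p Y) (extChartAt (model E E') p p) +
        omega (s.forceHat p) (s.slopeHat p) (extChartAt (model E E') p p)
          (christoffel D p.2.2 p.2.2) (s.frameVec (Y p)))

lemma frameVec_gluedFun (Y : VField E M E' B) (ξ : Tan E M E' B p) :
    s.frameVec (s.gluedFun D Y p ξ) =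
      fderiv ℝ (s.frameComp p Y) (extChartAt (model E E') p p) (comp ξ) +
        omega (s.forceHat p) (s.slopeHat p) (extChartAt (model E E') p p)
          (christoffel D p.2.2 p.2.2) (s.frameVec (Y p)) (comp ξ) := by
  rw [frameVec_eq_coframe]
  exact coframe_frame _ _ _ _

/-- `gluedFun` takes a direction at p instead of a vector field. This identifies it with the bracket
formula, so that formula depends on X only through its value at p. -/
lemma gluedFun_eq_explicit {X Y : VField E M E' B}
    (hX : MDifferentiableAt (model E E') (model E E').tangent
      (fun q => (⟨q, X q⟩ : TangentBundle (model E E') (Space E M B))) p)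
    (hY : MDifferentiableAt (model E E') (model E E').tangent
      (fun q => (⟨q, Y q⟩ : TangentBundle (model E E') (Space E M B))) p) :
    s.gluedFun D Y p (X p) = s.explicit D X Y p := by
  have hp := mem_extChartAt_source (I := model E E') p
  have h := s.frameComp_explicit D hp ((s.differentiableAt_frameComp_iff hp X).2 hX)
    ((s.differentiableAt_frameComp_iff hp Y).2 hY)
  have h2 : chartDeriv (model E E') p p (X p) = X p :=
    congr($(chartDeriv_self (I := model E E') p) (X p))
  rw [frameComp_self, frameComp_self, h2] at h
  apply s.frameVec_injective
  rw [h, frameVec_gluedFun]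
  rfl

/-- The glued derivative in the frame `Γ, H_a, V_a, ∂/∂x^α`, in an arbitrary chart. -/
lemma frameChange_gluedFun (hq : q ∈ (extChartAt (model E E') p).source) {Y : VField E M E' B}
    (hY : DifferentiableAt ℝ (s.frameComp p Y) (extChartAt (model E E') p q))
    (ξ : Tan E M E' B q) :
    frameChange p q (s.frameVec (s.gluedFun D Y q ξ)) =
      fderiv ℝ (s.frameComp p Y) (extChartAt (model E E') p q) (chartDeriv (model E E') p q ξ) +
      omega (s.forceHat p) (s.slopeHat p) (extChartAt (model E E') p q)
        (christoffel D p.2.2 q.2.2) (s.frameComp p Y (extChartAt (model E E') p q))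
        (chartDeriv (model E E') p q ξ) := by
  -- `gluedFun` at q is defined in the chart at q. The bracket formula mentions no chart, so passing
  -- through it with any differentiable field of value ξ at q moves the expression to the chart at
  -- p.
  set X : VField E M E' B := chartConst (model E E') p (chartDeriv (model E E') p q ξ) with hXdef
  have hXq : X q = ξ := chartDeriv_inverse_apply_self hq ξ
  have hX := mdifferentiableAt_chartConst hq (chartDeriv (model E E') p q ξ)
  have h := s.frameComp_explicit D hq ((s.differentiableAt_frameComp_iff hq X).2 hX) hY
  rw [← hXq, s.gluedFun_eq_explicit D hX ((s.differentiableAt_frameComp_iff hq Y).1 hY),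
    ← s.frameComp_extChartAt hq, h]

/-- The flat derivative of the components supplies additivity and the Leibniz term, and ω is linear
in the components of the field. -/
lemma isCovariantDerivativeOn_gluedFun :
    IsCovariantDerivativeOn (I := model E E') (Model E E') (s.gluedFun D) Set.univ where
  add {σ σ' p} hσ hσ' _ := by
    have hp := mem_extChartAt_source (I := model E E') p
    have h1 := (s.differentiableAt_frameComp_iff hp σ).2 hσ
    have h2 := (s.differentiableAt_frameComp_iff hp σ').2 hσ'
    ext ξ
    apply s.frameVec_injective
    have e : s.frameVec ((s.gluedFun D σ p + s.gluedFun D σ' p) ξ) =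
        s.frameVec (s.gluedFun D σ p ξ) + s.frameVec (s.gluedFun D σ' p ξ) :=
      s.frameVec_add _ _
    have e2 : s.frameComp p (σ + σ') = fun z => s.frameComp p σ z + s.frameComp p σ' z :=
      funext fun z => s.frameComp_add σ σ' z
    have e3 : s.frameVec ((σ + σ') p) = s.frameVec (σ p) + s.frameVec (σ' p) :=
      s.frameVec_add _ _
    rw [e, frameVec_gluedFun, frameVec_gluedFun, frameVec_gluedFun, e2, fderiv_fun_add h1 h2, e3,
      omega_add _ _ _ (christoffel_add D (mem_extChartAt_source p.2.2)), add_apply]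
    abel
  leibniz {σ r p} hσ hr _ := by
    have hp := mem_extChartAt_source (I := model E E') p
    have h1 := (s.differentiableAt_frameComp_iff hp σ).2 hσ
    have h2 := (mdifferentiableAt_iff_differentiableAt_comp_symm hp r).1 hr
    ext ξ
    apply s.frameVec_injective
    have h3 : mfderiv (model E E') 𝓘(ℝ, ℝ) r p ξ = fderiv ℝ (r ∘ (extChartAt (model E E') p).symm)
        (extChartAt (model E E') p p) (comp ξ) := by
      have h4 : chartDeriv (model E E') p p ξ = ξ :=
        congr($(chartDeriv_self (I := model E E') p) ξ)
      have := mfderiv_apply_eq_fderiv_comp_symm hp h2 ξ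
      rwa [h4] at this
    have e : s.frameVec ((r p • s.gluedFun D σ p +
        (mvfderiv (model E E') r p).smulRight (σ p)) ξ) =
        r p • s.frameVec (s.gluedFun D σ p ξ) +
        fderiv ℝ (r ∘ (extChartAt (model E E') p).symm) (extChartAt (model E E') p p) (comp ξ) •
          s.frameVec (σ p) := by
      rw [← frameVec_smul, ← frameVec_smul, ← frameVec_add, ← h3]
      rfl
    have e2 : s.frameComp p (r • σ) =
        fun z => (r ∘ (extChartAt (model E E') p).symm) z • s.frameComp p σ z :=
      funext fun z => s.frameComp_smul r σ z
    have e3 : s.frameVec ((r • σ) p) = r p • s.frameVec (σ p) := s.frameVec_smul _ _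
    rw [e, frameVec_gluedFun, frameVec_gluedFun, e2, fderiv_fun_smul h2 h1, e3,
      omega_smul _ _ _ (christoffel_smul D (mem_extChartAt_source p.2.2)), frameComp_self]
    simp only [Function.comp_apply, extChartAt_to_inv, add_apply, smul_apply,
      ContinuousLinearMap.smulRight_apply]
    module

/-- The glued connection. -/
def gluedConn : Conn E M E' B := ⟨s.gluedFun D, s.isCovariantDerivativeOn_gluedFun D⟩

/-- Near p the connection is read in the one chart at p as a composition of the frame, the
derivative of the components and ω, all of which depend smoothly on the point. -/
lemma contMDiff_gluedConn [T2Space B]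
    (hD : CovariantDerivative.ContMDiffCovariantDerivative D ∞) :
    CovariantDerivative.ContMDiffCovariantDerivative (s.gluedConn D) ∞ := by
  refine ⟨⟨fun {Y} hY p _ => ContMDiffAt.contMDiffWithinAt ?_⟩⟩
  have hY' : ∀ q, ContMDiffAt (model E E') (model E E').tangent ∞
      (fun q => (⟨q, Y q⟩ : TangentBundle (model E E') (Space E M B))) q := fun q =>
    (hY q (Set.mem_univ _)).contMDiffAt Filter.univ_mem
  have hp := mem_extChartAt_source (I := model E E') p
  rw [contMDiffAt_hom_bundle]
  refine ⟨contMDiffAt_id, ?_⟩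
  rw [contMDiffAt_iff_contDiffAt_comp_symm hp]
  have hf := s.contDiffAt_forceHat hp
  have hg := s.contDiffAt_slopeHat hp
  set x := extChartAt (model E E') p p with hx
  have key : ContDiffAt ℝ ∞ (fun z => (frame (s.forceHat p) (s.slopeHat p) z) ∘L
      (fderiv ℝ (s.frameComp p Y) z + omega (s.forceHat p) (s.slopeHat p) z
        (christoffel D p.2.2 ((extChartAt 𝓘(ℝ, E') p.2.2).symm z.2.2)) (s.frameComp p Y z))) x := by
    refine contDiffAt_of_clm_apply fun c => ?_
    have h1 := (s.contDiffAt_frameComp_iff hp Y).2 (hY' p)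
    rw [← hx] at h1
    have h2 : ContDiffAt ℝ ∞ (fun z => fderiv ℝ (s.frameComp p Y) z) x := h1.fderiv_right le_rfl
    have h3 : ContDiffAt ℝ ∞ (fun z => christoffel D p.2.2
        ((extChartAt 𝓘(ℝ, E') p.2.2).symm z.2.2) (s.frameComp p Y z).2.2) x :=
      contDiffAt_christoffel D hD (r := fun z : Model E E' => z.2.2) (by fun_prop) rfl
        h1.snd.snd
    refine contDiffAt_frame_apply hf hg le_rfl (Y := fun z => fderiv ℝ (s.frameComp p Y) z c +
      omega (s.forceHat p) (s.slopeHat p) z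
        (christoffel D p.2.2 ((extChartAt 𝓘(ℝ, E') p.2.2).symm z.2.2)) (s.frameComp p Y z) c) ?_
    exact (h2.clm_apply contDiffAt_const).add (contDiffAt_omega_apply hf hg h1 h3 c)
  refine key.congr_of_eventuallyEq ?_
  filter_upwards [(isOpen_extChartAt_target p).mem_nhds
    ((extChartAt (model E E') p).map_source hp)] with z hz
  have hzs := (extChartAt (model E E') p).map_target hz
  have hzr := (extChartAt (model E E') p).right_inv hz
  simp only [Function.comp_apply]
  refine (inCoordinates_tangentSpace hzs _).trans ?_
  refine ContinuousLinearMap.ext fun c => ?_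
  set q := (extChartAt (model E E') p).symm z with hq
  set ξ : Tan E M E' B q := (chartDeriv (model E E') p q).inverse c with hξ
  have hξc : chartDeriv (model E E') p q ξ = c := chartDeriv_inverse_apply hzs c
  have h := s.frameChange_gluedFun D hzs ((s.differentiableAt_frameComp_iff hzs Y).2
    ((hY' q).mdifferentiableAt (by simp))) ξ
  rw [← s.coframe_chartDeriv_eq_frameChange hzs, hξc, hzr] at h
  have h' := congrArg (frame (s.forceHat p) (s.slopeHat p) z) h
  rw [frame_coframe] at h'
  exact h'

lemma dt_smul_Γ (r : ℝ) : dt (r • s.Γ p) = r := by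
  have h := s.frameVec_smul r (s.Γ p)
  rw [frameVec_Γ] at h
  have := congrArg Prod.fst h
  simpa [frameVec] using this

/-- The derivative glued from the submodule derivatives is given by the explicit formula. -/
lemma glued_eq_explicit {X Y : VField E M E' B}
    (hX : MDifferentiableAt (model E E') (model E E').tangent
      (fun q => (⟨q, X q⟩ : TangentBundle (model E E') (Space E M B))) p)
    (hY : MDifferentiableAt (model E E') (model E E').tangent
      (fun q => (⟨q, Y q⟩ : TangentBundle (model E E') (Space E M B))) p) :
    s.glued D X Y p = s.explicit D X Y p := by
  have hp := mem_extChartAt_source (I := model E E') p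
  have hz := (extChartAt (model E E') p).map_source hp
  have hX' := (s.differentiableAt_frameComp_iff hp X).2 hX
  have hY' := (s.differentiableAt_frameComp_iff hp Y).2 hY
  -- The two formulas differ by S P_H = S, Q P_V = Q and dt P_Γ = dt, and by the Γ-term treated
  -- below.
  have h1 : app S (app s.PH Y) = app S Y := by
    funext q
    have := congrArg (fun c : Model E E' => c.2.1.1) (s.frameVec_PH (Y q))
    exact congrArg (vert q) this
  have h2 : app s.Q (app s.PV Y) = app s.Q Y := by
    funext q
    have := congrArg (fun c : Model E E' => c.2.1.2) (s.frameVec_PV (Y q))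
    exact congrArg (s.horiz q) this
  have h4 : dtFun (app s.PΓ Y) = dtFun Y := funext fun q => s.dt_smul_Γ _
  have b1 : ∀ z ∈ (extChartAt (model E E') p).target,
      s.frameComp p (app s.PΓ Y) z = block 1 0 0 0 0 0 (s.frameComp p Y z) := fun z hz => by
    simp [s.frameComp_PΓ hz, block_apply]
  have b2 : ∀ z ∈ (extChartAt (model E E') p).target,
      s.frameComp p (X - app s.PΓ X) z = block 0 1 1 1 0 0 (s.frameComp p X z) :=
    fun z hz => by rw [frameComp_sub, s.frameComp_PΓ hz, block_apply]; ext <;> simp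
  have h5 := s.frameComp_bracket_of_linear hp hX' hY' b2 b1 rfl rfl rfl rfl rfl
  -- The form dt is closed, so dt([X - P_Γ(X), P_Γ(Y)]) is the derivative of dt(Y) along X - P_Γ(X)
  -- and completes the derivative along P_Γ(X).
  have h6 : dirDeriv (app s.PΓ X) (dtFun Y) p • s.Γ p +
      s.PΓ p (bracket (X - app s.PΓ X) (app s.PΓ Y) p) = dirDeriv X (dtFun Y) p • s.Γ p := by
    rw [PΓ, ← add_smul]
    congr 1
    have h7 : dt (bracket (X - app s.PΓ X) (app s.PΓ Y) p) =
        (s.frameComp p (bracket (X - app s.PΓ X) (app s.PΓ Y)) (extChartAt (model E E') p p)).1 := by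
      rw [frameComp_self]; rfl
    rw [h7, h5, s.dirDeriv_dtFun hp _ hY', s.dirDeriv_dtFun hp _ hY', ← frame_frameComp,
      ← frame_frameComp, s.frameComp_PΓ hz]
    have h8 : frame (s.forceHat p) (s.slopeHat p) (extChartAt (model E E') p p)
        (s.frameComp p X (extChartAt (model E E') p p)) =
        frame (s.forceHat p) (s.slopeHat p) (extChartAt (model E E') p p)
        ((s.frameComp p X (extChartAt (model E E') p p)).1, (0, 0), 0) +
        frame (s.forceHat p) (s.slopeHat p) (extChartAt (model E E') p p)
        (block 0 1 1 1 0 0 (s.frameComp p X (extChartAt (model E E') p p))) := by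
      rw [← map_add]; congr 1; ext <;> simp [block_apply]
    rw [h8, map_add, Prod.fst_add]
    simp [dcoframe, block_fst]
  have h9 : s.glued D X Y p = (dirDeriv (app s.PΓ X) (dtFun (app s.PΓ Y)) p • s.Γ p +
      s.PΓ p (bracket (X - app s.PΓ X) (app s.PΓ Y) p)) +
      (derivN D (app s.N X) (app s.N Y) p + app s.N (bracket (X - app s.N X) (app s.N Y)) p) +
      (app s.Q (bracket (app s.PH X) (app S (app s.PH Y))) p +
        app s.PH (bracket (X - app s.PH X) (app s.PH Y)) p) +
      (app S (bracket (app s.PV X) (app s.Q (app s.PV Y))) p +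
        app s.PV (bracket (X - app s.PV X) (app s.PV Y)) p) := rfl
  have h10 : s.explicit D X Y p = dirDeriv X (dtFun Y) p • s.Γ p +
      derivN D (app s.N X) (app s.N Y) p
    + app s.Q (bracket (app s.PH X) (app S Y)) p + app S (bracket (app s.PV X) (app s.Q Y)) p
    + app s.N (bracket (X - app s.N X) (app s.N Y)) p
    + app s.PH (bracket (X - app s.PH X) (app s.PH Y)) p
    + app s.PV (bracket (X - app s.PV X) (app s.PV Y)) p := rfl
  rw [h9, h10, h1, h2, h4, h6]
  abel

end ConstrainedSODE
end

/-! ### Parallel tensors, lifts from the factors, and the torsion in the frame. -/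

noncomputable section

namespace ConstrainedSODE

variable {E : Type*} [NormedAddCommGroup E] [NormedSpace ℝ E]
  {M : Type*} [TopologicalSpace M] [ChartedSpace E M] [IsManifold 𝓘(ℝ, E) ∞ M]
  {E' : Type*} [NormedAddCommGroup E'] [NormedSpace ℝ E']
  {B : Type*} [TopologicalSpace B] [ChartedSpace E' B] [IsManifold 𝓘(ℝ, E') ∞ B]

variable [FiniteDimensional ℝ E] [FiniteDimensional ℝ E']

variable (s : ConstrainedSODE E M E' B) {p q : Space E M B}

variable (D : CovariantDerivative 𝓘(ℝ, E') E' (TangentSpace 𝓘(ℝ, E') : B → Type _))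

lemma comp_eq_frame (ξ : Tan E M E' B p) : comp ξ =
    frame (s.forceHat p) (s.slopeHat p) (extChartAt (model E E') p p) (s.frameVec ξ) := by
  rw [frameVec_eq_coframe]
  exact (frame_coframe _ _ _ _).symm

lemma Smooth.mdifferentiableAt {X : VField E M E' B} (hX : Smooth X) (p : Space E M B) :
    MDifferentiableAt (model E E') (model E E').tangent
      (fun q => (⟨q, X q⟩ : TangentBundle (model E E') (Space E M B))) p :=
  (hX p).mdifferentiableAt (by simp)

lemma christoffel_zero : christoffel D q.2.2 q.2.2 0 = 0 := by
  have := christoffel_smul D (mem_extChartAt_source q.2.2) 0 0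
  rwa [zero_smul, zero_smul] at this

lemma frameComp_Γ_eventuallyEq (hq : q ∈ (extChartAt (model E E') p).source) :
    s.frameComp p s.Γ =ᶠ[𝓝 (extChartAt (model E E') p q)] fun _ => (1, (0, 0), 0) := by
  filter_upwards [(isOpen_extChartAt_target p).mem_nhds
    ((extChartAt (model E E') p).map_source hq)] with z hz
  exact s.frameComp_Γ hz

lemma smooth_Γ : Smooth s.Γ := fun p =>
  (s.contDiffAt_frameComp_iff (mem_extChartAt_source p) s.Γ).1
    (contDiffAt_const.congr_of_eventuallyEq
      (s.frameComp_Γ_eventuallyEq (mem_extChartAt_source p)))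

/-- Γ has constant frame components, and ω vanishes on its block. -/
lemma gluedFun_Γ (ξ : Tan E M E' B p) : s.gluedFun D s.Γ p ξ = 0 := by
  apply s.frameVec_injective
  rw [frameVec_gluedFun, (s.frameComp_Γ_eventuallyEq (mem_extChartAt_source p)).fderiv_eq,
    frameVec_Γ, frameVec_zero, omega_apply, christoffel_zero]
  ext <;> simp [-inclU_apply, -inclB_apply]

/-- A constant matrix passes through the flat derivative, and through ω by `omega_block`. Applied to
S, Q and N this gives that they are parallel. -/
lemma gluedFun_block {a h v n k l : ℝ} {Y Y' : VField E M E' B}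
    (hY : MDifferentiableAt (model E E') (model E E').tangent
      (fun q => (⟨q, Y q⟩ : TangentBundle (model E E') (Space E M B))) p)
    (hb : ∀ z ∈ (extChartAt (model E E') p).target,
      s.frameComp p Y' z = block a h v n k l (s.frameComp p Y z)) (ξ : Tan E M E' B p) :
    s.frameVec (s.gluedFun D Y' p ξ) = block a h v n k l (s.frameVec (s.gluedFun D Y p ξ)) := by
  have hp := mem_extChartAt_source (I := model E E') p
  have h1 := s.hasFDerivAt_frameComp_of_linear hp
    ((s.differentiableAt_frameComp_iff hp Y).2 hY) hb
  have h2 := hb _ ((extChartAt (model E E') p).map_source hp)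
  rw [frameComp_self, frameComp_self] at h2
  rw [frameVec_gluedFun, frameVec_gluedFun, h1.fderiv, h2,
    omega_block _ _ _ (christoffel_smul D (mem_extChartAt_source p.2.2)), map_add]
  rfl

lemma nablaEndo_S {Y : VField E M E' B} (X : VField E M E' B) (hY : Smooth Y) :
    nablaEndo (s.gluedConn D) S X Y = 0 := by
  funext p
  apply s.frameVec_injective
  have h := s.gluedFun_block D (hY.mdifferentiableAt p) (Y' := app S Y) (a := 0) (h := 0) (v := 0)
    (n := 0) (k := 0) (l := 1)
    (fun z hz => by simp [s.frameComp_S hz, block_apply]) (X p)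
  have h2 : s.frameVec (nablaEndo (s.gluedConn D) S X Y p) =
      s.frameVec (s.gluedFun D (app S Y) p (X p) - S p (s.gluedFun D Y p (X p))) := rfl
  have h3 := s.frameVec_zero (p := p)
  rw [h2, frameVec_sub, h, frameVec_S]
  refine Eq.trans ?_ h3.symm
  simp [block_apply, frameVec]

lemma nablaEndo_Q {Y : VField E M E' B} (X : VField E M E' B) (hY : Smooth Y) :
    nablaEndo (s.gluedConn D) s.Q X Y = 0 := by
  funext p
  apply s.frameVec_injective
  have h := s.gluedFun_block D (hY.mdifferentiableAt p) (Y' := app s.Q Y) (a := 0) (h := 0)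
    (v := 0) (n := 0) (k := 1) (l := 0)
    (fun z hz => by simp [s.frameComp_Q hz, block_apply]) (X p)
  have h2 : s.frameVec (nablaEndo (s.gluedConn D) s.Q X Y p) =
      s.frameVec (s.gluedFun D (app s.Q Y) p (X p) - s.Q p (s.gluedFun D Y p (X p))) := rfl
  have h3 := s.frameVec_zero (p := p)
  rw [h2, frameVec_sub, h, frameVec_Q]
  refine Eq.trans ?_ h3.symm
  simp [block_apply, frameVec]

lemma nablaEndo_N {Y : VField E M E' B} (X : VField E M E' B) (hY : Smooth Y) :
    nablaEndo (s.gluedConn D) s.N X Y = 0 := by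
  funext p
  apply s.frameVec_injective
  have h := s.gluedFun_block D (hY.mdifferentiableAt p) (Y' := app s.N Y) (a := 0) (h := 0)
    (v := 0) (n := 1) (k := 0) (l := 0)
    (fun z hz => by simp [s.frameComp_N hz, block_apply]) (X p)
  have h2 : s.frameVec (nablaEndo (s.gluedConn D) s.N X Y p) =
      s.frameVec (s.gluedFun D (app s.N Y) p (X p) - s.N p (s.gluedFun D Y p (X p))) := rfl
  have h3 := s.frameVec_zero (p := p)
  rw [h2, frameVec_sub, h, frameVec_N]
  refine Eq.trans ?_ h3.symm
  simp [block_apply, frameVec]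

lemma nabla_dt_gluedConn {Y : VField E M E' B} (X : VField E M E' B) (hY : Smooth Y) :
    dirDeriv X (dtFun Y) - dtFun (nabla (s.gluedConn D) X Y) = 0 := by
  funext p
  have hp := mem_extChartAt_source (I := model E E') p
  have h1 := s.dirDeriv_dtFun hp X
    ((s.differentiableAt_frameComp_iff hp Y).2 (hY.mdifferentiableAt p))
  have h2 : chartDeriv (model E E') p p (X p) = X p :=
    congr($(chartDeriv_self (I := model E E') p) (X p))
  have h3 : dtFun (nabla (s.gluedConn D) X Y) p = (s.frameVec (s.gluedFun D Y p (X p))).1 := rfl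
  rw [Pi.sub_apply, h1, h3, frameVec_gluedFun, reading_extChartAt _ hp, h2]
  exact sub_eq_zero.2 (add_zero _).symm

lemma hasFDerivAt_frameComp_vertLift {W : ∀ x : M, TangentSpace 𝓘(ℝ, E) x}
    (hW : MDifferentiableAt 𝓘(ℝ, E) 𝓘(ℝ, E).tangent
      (fun x => (⟨x, W x⟩ : TangentBundle 𝓘(ℝ, E) M)) p.2.1.1) :
    HasFDerivAt (s.frameComp p (vertLift W))
      (inclU E E' ∘L fderiv ℝ (reading 𝓘(ℝ, E) p.2.1.1 W)
          (extChartAt 𝓘(ℝ, E) p.2.1.1 p.2.1.1) ∘L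
        ContinuousLinearMap.fst ℝ E E ∘L ContinuousLinearMap.fst ℝ (E × E) E' ∘L
        ContinuousLinearMap.snd ℝ ℝ ((E × E) × E'))
      (extChartAt (model E E') p p) := by
  have hps := mem_extChartAt_source (I := model E E') p
  have hps1 := mem_extChartAt_source (I := 𝓘(ℝ, E)) p.2.1.1
  have hWd := (mdifferentiableAt_section_iff_reading hps1 W).1 hW
  have h1 : s.frameComp p (vertLift W) =ᶠ[𝓝 (extChartAt (model E E') p p)]
      fun z => inclU E E' (reading 𝓘(ℝ, E) p.2.1.1 W z.2.1.1) := by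
    filter_upwards [(isOpen_extChartAt_target p).mem_nhds
      ((extChartAt (model E E') p).map_source hps)] with z hz
    have hzs := (extChartAt (model E E') p).map_target hz
    have e := congrArg (fun z : Model E E' => z.2.1.1) (extChartAt_apply hzs)
    rw [(extChartAt (model E E') p).right_inv hz] at e
    have e2 : (extChartAt 𝓘(ℝ, E) p.2.1.1).symm z.2.1.1 =
        ((extChartAt (model E E') p).symm z).2.1.1 := by
      rw [e, (extChartAt 𝓘(ℝ, E) p.2.1.1).left_inv ((mem_source_iff _ _).1 hzs).1]
    obtain ⟨w', hw'⟩ : ∃ w' : E, w' = W ((extChartAt (model E E') p).symm z).2.1.1 := ⟨_, rfl⟩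
    have hv : (vertLift W ((extChartAt (model E E') p).symm z) : Tan E M E' B _) =
      vert _ w' := by rw [hw']; rfl
    rw [s.frameComp_of_mem_target hz, hv, frameVec_vert, reading, e2, ← hw']
    simp [frameChange]
  have hx : (extChartAt (model E E') p p).2.1.1 = extChartAt 𝓘(ℝ, E) p.2.1.1 p.2.1.1 :=
    congrArg (fun z : Model E E' => z.2.1.1) (extChartAt_apply hps)
  rw [← hx] at hWd ⊢
  refine HasFDerivAt.congr_of_eventuallyEq ?_ h1
  exact (inclU E E').hasFDerivAt.comp _
      (hWd.hasFDerivAt.comp (f := fun z : Model E E' => z.2.1.1) _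
        (hasFDerivAt_id (𝕜 := ℝ) (extChartAt (model E E') p p)).snd.fst.fst)

/-- The components of a vertical lift depend on x^a only, so their u-derivative is zero, and ω
vanishes on vertical directions because dt, θ and η do. -/
lemma gluedFun_vertLift {W : ∀ x : M, TangentSpace 𝓘(ℝ, E) x}
    (hW : MDifferentiableAt 𝓘(ℝ, E) 𝓘(ℝ, E).tangent
      (fun x => (⟨x, W x⟩ : TangentBundle 𝓘(ℝ, E) M)) p.2.1.1) (w : E) :
    s.gluedFun D (vertLift W) p (vert p w) = 0 := by
  apply s.frameVec_injective
  have hw : comp (vert p w : Tan E M E' B p) = inclU E E' w := rfl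
  have hc : ∀ f g z, coframe f g z (inclU E E' w) = inclU E E' w := fun f g z => by
    simp [coframe_apply]
  rw [frameVec_gluedFun, (s.hasFDerivAt_frameComp_vertLift hW).fderiv, frameVec_zero, omega_apply,
    hw, hc]
  ext <;> simp

lemma hasFDerivAt_frameComp_consLift {Z : ∀ y : B, TangentSpace 𝓘(ℝ, E') y}
    (hZ : MDifferentiableAt 𝓘(ℝ, E') 𝓘(ℝ, E').tangent
      (fun y => (⟨y, Z y⟩ : TangentBundle 𝓘(ℝ, E') B)) p.2.2) :
    HasFDerivAt (s.frameComp p (consLift Z))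
      (inclB E E' ∘L fderiv ℝ (reading 𝓘(ℝ, E') p.2.2 Z) (extChartAt 𝓘(ℝ, E') p.2.2 p.2.2) ∘L
        ContinuousLinearMap.snd ℝ (E × E) E' ∘L ContinuousLinearMap.snd ℝ ℝ ((E × E) × E'))
      (extChartAt (model E E') p p) := by
  have hps := mem_extChartAt_source (I := model E E') p
  have hps1 := mem_extChartAt_source (I := 𝓘(ℝ, E')) p.2.2
  have hZd := (mdifferentiableAt_section_iff_reading hps1 Z).1 hZ
  have h1 : s.frameComp p (consLift Z) =ᶠ[𝓝 (extChartAt (model E E') p p)]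
      fun z => inclB E E' (reading 𝓘(ℝ, E') p.2.2 Z z.2.2) := by
    filter_upwards [(isOpen_extChartAt_target p).mem_nhds
      ((extChartAt (model E E') p).map_source hps)] with z hz
    have hzs := (extChartAt (model E E') p).map_target hz
    have e := congrArg (fun z : Model E E' => z.2.2) (extChartAt_apply hzs)
    rw [(extChartAt (model E E') p).right_inv hz] at e
    have e2 : (extChartAt 𝓘(ℝ, E') p.2.2).symm z.2.2 =
        ((extChartAt (model E E') p).symm z).2.2 := by
      rw [e, (extChartAt 𝓘(ℝ, E') p.2.2).left_inv ((mem_source_iff _ _).1 hzs).2]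
    obtain ⟨w', hw'⟩ : ∃ w' : E', w' = Z ((extChartAt (model E E') p).symm z).2.2 := ⟨_, rfl⟩
    have hv : (consLift Z ((extChartAt (model E E') p).symm z) : Tan E M E' B _) =
      cons _ w' := by rw [hw']; rfl
    rw [s.frameComp_of_mem_target hz, hv, frameVec_cons, reading, e2, ← hw']
    simp [frameChange]
  have hx : (extChartAt (model E E') p p).2.2 = extChartAt 𝓘(ℝ, E') p.2.2 p.2.2 :=
    congrArg (fun z : Model E E' => z.2.2) (extChartAt_apply hps)
  rw [← hx] at hZd ⊢
  refine HasFDerivAt.congr_of_eventuallyEq ?_ h1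
  exact (inclB E E').hasFDerivAt.comp _
      (hZd.hasFDerivAt.comp (f := fun z : Model E E' => z.2.2) _
        (hasFDerivAt_id (𝕜 := ℝ) (extChartAt (model E E') p p)).snd.snd)

/-- Along ∂/∂x^α only the flat derivative and the Christoffel term of ω survive, and together they
are D in the chart. -/
lemma gluedFun_consLift {Z : ∀ y : B, TangentSpace 𝓘(ℝ, E') y}
    (hZ : MDifferentiableAt 𝓘(ℝ, E') 𝓘(ℝ, E').tangent
      (fun y => (⟨y, Z y⟩ : TangentBundle 𝓘(ℝ, E') B)) p.2.2) (b : E') :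
    s.gluedFun D (consLift Z) p (cons p b) = cons (E' := E') p (D Z p.2.2 b) := by
  have key := chartDeriv_covariantDerivative D (mem_extChartAt_source (I := 𝓘(ℝ, E')) p.2.2) hZ b
  have hself : ∀ v : E', chartDeriv 𝓘(ℝ, E') p.2.2 p.2.2 v = v := fun v =>
    congr($(chartDeriv_self (I := 𝓘(ℝ, E')) p.2.2) v)
  obtain ⟨d, hd⟩ : ∃ d : E', d = D Z p.2.2 b := ⟨_, rfl⟩
  obtain ⟨z0, hz0⟩ : ∃ z0 : E', z0 = Z p.2.2 := ⟨_, rfl⟩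
  have key' : d = fderiv ℝ (reading 𝓘(ℝ, E') p.2.2 Z) (extChartAt 𝓘(ℝ, E') p.2.2 p.2.2) b +
      christoffel D p.2.2 p.2.2 z0 b := by
    rw [hd, hz0]
    have e1 := hself (Z p.2.2)
    have e2 := hself b
    rw [e1, e2] at key
    exact (hself _).symm.trans key
  have hcd : (cons (E' := E') p (D Z p.2.2 b) : Tan E M E' B p) = cons p d := by rw [hd]
  have hcl : (consLift Z p : Tan E M E' B p) = cons p z0 := by rw [hz0]; rfl
  rw [hcd]
  apply s.frameVec_injective
  have hw : comp (cons p b : Tan E M E' B p) = inclB E E' b := rfl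
  have hc : ∀ f g z, coframe f g z (inclB E E' b) = inclB E E' b := fun f g z => by
    simp [coframe_apply]
  rw [frameVec_gluedFun, (s.hasFDerivAt_frameComp_consLift hZ).fderiv, omega_apply, hw, hc, hcl,
    frameVec_cons, frameVec_cons, key']
  ext <;> simp [-inclU_apply, -inclB_apply, inclB_fst, inclB_U]
  all_goals simp

/-- The torsion of the glued connection in the frame `Γ, H_a, V_a, ∂/∂x^α`. -/
lemma frameVec_tors (ξ ζ : Tan E M E' B p) {f g z}
    (hf : f = s.forceHat p) (hg : g = s.slopeHat p) (hz : z = extChartAt (model E E') p p) :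
    s.frameVec (tors (s.gluedConn D) ξ ζ) =
      omega f g z (christoffel D p.2.2 p.2.2) (s.frameVec ζ) (frame f g z (s.frameVec ξ)) -
      omega f g z (christoffel D p.2.2 p.2.2) (s.frameVec ξ) (frame f g z (s.frameVec ζ)) +
      (dcoframe f g z (frame f g z (s.frameVec ξ)) (frame f g z (s.frameVec ζ)) -
        dcoframe f g z (frame f g z (s.frameVec ζ)) (frame f g z (s.frameVec ξ))) := by
  have hp := mem_extChartAt_source (I := model E E') p
  have hself : ∀ v : Tan E M E' B p, chartDeriv (model E E') p p v = v := fun v =>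
    congr($(chartDeriv_self (I := model E E') p) v)
  -- Torsion is tensorial, so any differentiable fields with these values serve; the derivatives of
  -- their components cancel against those in the bracket.
  set X : VField E M E' B := chartConst (model E E') p (chartDeriv (model E E') p p ξ) with hXd
  set Y : VField E M E' B := chartConst (model E E') p (chartDeriv (model E E') p p ζ) with hYd
  have hXp : X p = ξ := chartDeriv_inverse_apply_self hp ξ
  have hYp : Y p = ζ := chartDeriv_inverse_apply_self hp ζ
  have hX := mdifferentiableAt_chartConst hp (chartDeriv (model E E') p p ξ)
  have hY := mdifferentiableAt_chartConst hp (chartDeriv (model E E') p p ζ)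
  have h1 := (s.gluedConn D).torsion_apply hX hY
  have h2 : tors (s.gluedConn D) ξ ζ =
      s.gluedFun D Y p (X p) - s.gluedFun D X p (Y p) - bracket X Y p := by
    rw [← hXp, ← hYp]
    exact h1
  have h3 := s.frameComp_bracket hp ((s.differentiableAt_frameComp_iff hp X).2 hX)
    ((s.differentiableAt_frameComp_iff hp Y).2 hY)
  have hrX : reading (model E E') p X (extChartAt (model E E') p p) = comp ξ := by
    rw [reading_extChartAt _ hp, hXp, hself]; rfl
  have hrY : reading (model E E') p Y (extChartAt (model E E') p p) = comp ζ := by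
    rw [reading_extChartAt _ hp, hYp, hself]; rfl
  rw [frameComp_self, hrX, hrY] at h3
  rw [h2, frameVec_sub, frameVec_sub, frameVec_gluedFun, frameVec_gluedFun, h3, hXp, hYp, hf, hg,
    hz, ← comp_eq_frame, ← comp_eq_frame]
  abel

end ConstrainedSODE
end

/-! ### The torsion conditions and the vanishing of R(Γ, V). -/

noncomputable section

namespace ConstrainedSODE

variable {E : Type*} [NormedAddCommGroup E] [NormedSpace ℝ E]
  {M : Type*} [TopologicalSpace M] [ChartedSpace E M] [IsManifold 𝓘(ℝ, E) ∞ M]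
  {E' : Type*} [NormedAddCommGroup E'] [NormedSpace ℝ E']
  {B : Type*} [TopologicalSpace B] [ChartedSpace E' B] [IsManifold 𝓘(ℝ, E') ∞ B]

variable [FiniteDimensional ℝ E] [FiniteDimensional ℝ E']

variable (s : ConstrainedSODE E M E' B) {p q : Space E M B}

variable (D : CovariantDerivative 𝓘(ℝ, E') E' (TangentSpace 𝓘(ℝ, E') : B → Type _))

lemma frame_U (f : Model E E' → E) (g : Model E E' → E') (z : Model E E') (w : E) :
    frame f g z (0, (0, w), 0) = inclU E E' w := by simp [frame_apply]

lemma frame_B (f : Model E E' → E) (g : Model E E' → E') (z : Model E E') (b : E') :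
    frame f g z (0, (0, 0), b) = inclB E E' b := by simp [frame_apply]

lemma coframe_inclU (f : Model E E' → E) (g : Model E E' → E') (z : Model E E') (w : E) :
    coframe f g z (inclU E E' w) = inclU E E' w := by simp [coframe_apply]

lemma coframe_inclB (f : Model E E' → E) (g : Model E E' → E') (z : Model E E') (b : E') :
    coframe f g z (inclB E E' b) = inclB E E' b := by simp [coframe_apply]

lemma fderiv_force_inclU (f : Model E E' → E) (z : Model E E') (w : E) :
    fderiv ℝ f z (inclU E E' w) = (-2 : ℝ) • connHat f z w := by simp [connHat, smul_smul]

lemma fderiv_slope_inclU (g : Model E E' → E') (z : Model E E') (w : E) :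
    fderiv ℝ g z (inclU E E' w) = -psiHat g z w := by simp [psiHat]

/-- The bracket [Γ, V_a] has horizontal part -H_a and vertical part Γ^b_a V_b; the latter equals ∇_Γ
V_a, so the torsion is H_a. -/
lemma PH_eq_tors (ξ : Tan E M E' B p) :
    s.PH p ξ = tors (s.gluedConn D) (s.Γ p) (S p ξ) := by
  apply s.frameVec_injective
  rw [s.frameVec_PH, s.frameVec_tors D _ _ rfl rfl rfl, frameVec_Γ, frameVec_S]
  generalize extChartAt (model E E') p p = z
  simp only [omega_apply, dcoframe, coframe_frame, frame_U, frame_B, inclU_fst, inclU_H, inclU_V,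
    coframe_inclU, fderiv_force_inclU, fderiv_slope_inclU, frame_fst, frame_H, frame_V,
    christoffel_zero, map_zero, zero_apply]
  refine Prod.ext ?_ (Prod.ext (Prod.ext ?_ ?_) ?_)
  · simp
  · simp
  · simp; module
  · simp

/-- S sees only the H-block of the torsion, and there the contributions of Γ^b_a and F cancel, which
leaves ψ. -/
lemma PV_eq_tors (ξ : Tan E M E' B p) :
    s.PV p ξ = S p (tors (s.gluedConn D) (s.Γ p) ξ) := by
  apply s.frameVec_injective
  have h : s.ψ ξ = θ (tors (s.gluedConn D) (s.Γ p) ξ) := by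
    have h1 := congrArg (fun c : Model E E' => c.2.1.1) (s.frameVec_tors D (s.Γ p) ξ rfl rfl rfl)
    refine Eq.trans ?_ h1.symm
    generalize extChartAt (model E E') p p = z
    simp only [frameVec_Γ, omega_apply, dcoframe, coframe_frame, frame_fst, frame_H, frame_V,
      Prod.fst_sub, Prod.snd_sub, Prod.fst_add, Prod.snd_add, map_zero, zero_apply]
    simp [frameVec]
    abel
  rw [frameVec_PV, frameVec_S, h]

/-- The terms of ω on the ∂/∂x^α block are those that cancel the η-part of the brackets with ∂/∂x^α.
The H-part is zero, while the V-part, which involves ∂F/∂x^α and ∂Γ^b_a/∂x^α, is removed by I - P_V.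
-/
lemma tors_cons_eq (ξ ζ : Tan E M E' B p) :
    tors (s.gluedConn D) (ξ - s.N p ξ) (s.N p ζ) -
      s.PV p (tors (s.gluedConn D) (ξ - s.N p ξ) (s.N p ζ)) = 0 := by
  apply s.frameVec_injective
  obtain ⟨c, hc⟩ : ∃ c, c = s.frameVec ξ := ⟨_, rfl⟩
  have h1 : s.frameVec (ξ - s.N p ξ) = block 1 1 1 0 0 0 c := by
    rw [frameVec_sub, frameVec_N, hc, block_apply]; ext <;> simp [frameVec]
  have h2 := s.frameVec_tors D (ξ - s.N p ξ) (s.N p ζ) rfl rfl rfl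
  rw [h1, frameVec_N] at h2
  rw [frameVec_sub, frameVec_PV, frameVec_zero]
  have h3 : ∀ χ : Tan E M E' B p, s.frameVec χ - (0, (0, s.ψ χ), 0) =
      block 1 1 0 1 0 0 (s.frameVec χ) := fun χ => by
    rw [block_apply]; ext <;> simp [frameVec]
  rw [h3, h2]
  generalize extChartAt (model E E') p p = z
  simp only [omega_apply, dcoframe, coframe_frame, coframe_inclB, frame_B, inclB_fst, inclB_U, frame_fst,
    frame_H, frame_V, block_fst, block_H, block_V, block_B, zero_smul, christoffel_zero,
    Prod.fst_zero, Prod.snd_zero, map_zero, zero_apply, one_smul, zero_smul, add_zero]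
  refine Prod.ext ?_ (Prod.ext (Prod.ext ?_ ?_) ?_)
  · simp [block_fst]
  · simp [-inclB_apply, block_H]
  · simp [-inclB_apply, block_V]
  · simp [-inclB_apply, block_B]

lemma fderiv_connHat {f : Model E E' → E} {z : Model E E'} (hf : ContDiffAt ℝ ∞ f z)
    (ξ : Model E E') (a : E) : fderiv ℝ (connHat f) z ξ a =
      (-(1 / 2 : ℝ)) • fderiv ℝ (fderiv ℝ f) z ξ (inclU E E' a) := by
  have h1 : DifferentiableAt ℝ (fderiv ℝ f) z :=
    (hf.fderiv_right (m := ∞) le_rfl).differentiableAt (by simp)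
  have h2 : HasFDerivAt (connHat f) _ z :=
    (h1.hasFDerivAt.clm_comp (hasFDerivAt_const (inclU E E') z)).const_smul (-(1 / 2 : ℝ))
  rw [h2.fderiv]
  simp

lemma fderiv_psiHat {g : Model E E' → E'} {z : Model E E'} (hg : ContDiffAt ℝ ∞ g z)
    (ξ : Model E E') (a : E) : fderiv ℝ (psiHat g) z ξ a =
      -fderiv ℝ (fderiv ℝ g) z ξ (inclU E E' a) := by
  have h1 : DifferentiableAt ℝ (fderiv ℝ g) z :=
    (hg.fderiv_right (m := ∞) le_rfl).differentiableAt (by simp)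
  have h2 : HasFDerivAt (psiHat g) _ z :=
    (h1.hasFDerivAt.clm_comp (hasFDerivAt_const (inclU E E') z)).neg
  rw [h2.fderiv]
  simp

/-- The glued connection in the frame `Γ, H_a, V_a, ∂/∂x^α`, in an arbitrary chart. -/
lemma frameComp_nabla {z : Model E E'} (hz : z ∈ (extChartAt (model E E') p).target)
    (X : VField E M E' B) {Y : VField E M E' B}
    (hY : DifferentiableAt ℝ (s.frameComp p Y) z) :
    s.frameComp p (nabla (s.gluedConn D) X Y) z =
      fderiv ℝ (s.frameComp p Y) z (reading (model E E') p X z) +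
      omega (s.forceHat p) (s.slopeHat p) z
        (christoffel D p.2.2 ((extChartAt (model E E') p).symm z).2.2) (s.frameComp p Y z)
        (reading (model E E') p X z) := by
  have hs := (extChartAt (model E E') p).map_target hz
  have hr := (extChartAt (model E E') p).right_inv hz
  rw [← hr] at hY
  have h := s.frameChange_gluedFun D hs hY (X ((extChartAt (model E E') p).symm z))
  rw [hr] at h
  rw [s.frameComp_of_mem_target hz]
  exact h

section Symmetry

variable {f : Model E E' → E} {g : Model E E' → E'} {z : Model E E'}

/-- Up to the factor -1/2 this is the second derivative of f in two velocity directions, which is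
symmetric. -/
lemma fderiv_connHat_symm (hf : ContDiffAt ℝ ∞ f z) (a b : E) :
    fderiv ℝ (connHat f) z (inclU E E' a) b = fderiv ℝ (connHat f) z (inclU E E' b) a := by
  rw [fderiv_connHat hf, fderiv_connHat hf,
    (hf.isSymmSndFDerivAt (by simpa using ENat.LEInfty.out)) (inclU E E' a)]

lemma fderiv_psiHat_symm (hg : ContDiffAt ℝ ∞ g z) (b : E') (a : E) :
    fderiv ℝ (psiHat g) z (inclB E E' b) a =
      -fderiv ℝ (fderiv ℝ g) z (inclU E E' a) (inclB E E' b) := by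
  rw [fderiv_psiHat hg, (hg.isSymmSndFDerivAt (by simpa using ENat.LEInfty.out)) (inclU E E' a)]

/-- The expression of the curvature `R(Γ, V)Z` in the frame `Γ, H_a, V_a, ∂/∂x^α`, where the
components of `Z` are `Y` and `V` has the components `w`, with the derivative `w'` along `Γ`. -/
lemma curvature_expression (hf : ContDiffAt ℝ ∞ f z) (hg : ContDiffAt ℝ ∞ g z)
    {Y : Model E E' → Model E E'} (hY : ContDiffAt ℝ ∞ Y z) (Υ : E' → E' →L[ℝ] E')
    (w w' : E) :
    (fderiv ℝ Y z (inclU E E' w') + fderiv ℝ (fderiv ℝ Y) z (1, (z.2.1.2, f z), g z) (inclU E E' w)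
      + omega f g z Υ (fderiv ℝ Y z (inclU E E' w)) (1, (z.2.1.2, f z), g z)) -
    (fderiv ℝ Y z (0, (w, fderiv ℝ f z (inclU E E' w)), fderiv ℝ g z (inclU E E' w)) +
      fderiv ℝ (fderiv ℝ Y) z (inclU E E' w) (1, (z.2.1.2, f z), g z) +
      (0, (connHat f z (fderiv ℝ Y z (inclU E E' w)).2.1.1 +
          fderiv ℝ (connHat f) z (inclU E E' w) (Y z).2.1.1,
        connHat f z (fderiv ℝ Y z (inclU E E' w)).2.1.2 +
          fderiv ℝ (connHat f) z (inclU E E' w) (Y z).2.1.2),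
        -(fderiv ℝ g z (inclB E E' (fderiv ℝ Y z (inclU E E' w)).2.2) +
          fderiv ℝ (fderiv ℝ g) z (inclU E E' w) (inclB E E' (Y z).2.2))) +
      omega f g z Υ (fderiv ℝ Y z (1, (z.2.1.2, f z), g z) +
        (0, (connHat f z (Y z).2.1.1, connHat f z (Y z).2.1.2),
          -fderiv ℝ g z (inclB E E' (Y z).2.2))) (inclU E E' w)) -
    (fderiv ℝ Y z (inclU E E' w' -
      (0, (w, fderiv ℝ f z (inclU E E' w)), fderiv ℝ g z (inclU E E' w))) +
      omega f g z Υ (Y z) (inclU E E' w' -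
        (0, (w, fderiv ℝ f z (inclU E E' w)), fderiv ℝ g z (inclU E E' w)))) = 0 := by
  have o1 : ∀ d, omega f g z Υ d (1, (z.2.1.2, f z), g z) =
      (0, (connHat f z d.2.1.1, connHat f z d.2.1.2), -fderiv ℝ g z (inclB E E' d.2.2)) :=
    fun d => by simp [-inclU_apply, -inclB_apply, omega_apply, coframe_apply]
  have o2 : ∀ d, omega f g z Υ d (inclU E E' w) = 0 := fun d => by
    have hB : (inclU E E' w).2.2 = 0 := rfl
    rw [omega_apply, coframe_inclU, inclU_H, inclU_fst, hB]
    ext <;> simp [-inclU_apply, -inclB_apply]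
  -- The third direction is [Γ, V]. Its θ-component is -w, and its η-component vanishes because
  -- ∂g/∂u cancels the correction by `psiHat`.
  have o3 : ∀ d, omega f g z Υ d (inclU E E' w' -
        (0, (w, fderiv ℝ f z (inclU E E' w)), fderiv ℝ g z (inclU E E' w))) =
      (0, (-fderiv ℝ (connHat f) z (inclU E E' d.2.1.1) w,
        -fderiv ℝ (connHat f) z (inclU E E' d.2.1.2) w),
        -fderiv ℝ (psiHat g) z (inclB E E' d.2.2) w) := fun d => by
    have h1 : (coframe f g z (inclU E E' w' - (0, (w, fderiv ℝ f z (inclU E E' w)),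
        fderiv ℝ g z (inclU E E' w)))).2.1.1 = -w := by
      simp [coframe_apply]
    have h2 : (coframe f g z (inclU E E' w' - (0, (w, fderiv ℝ f z (inclU E E' w)),
        fderiv ℝ g z (inclU E E' w)))).2.2 = 0 := by
      rw [coframe_apply, fderiv_slope_inclU]
      simp
    rw [omega_apply, h1, h2]
    simp
  -- The second derivatives of Y cancel by symmetry; the remaining terms cancel by the symmetry of
  -- those of f and g.
  have hsymm := (hY.isSymmSndFDerivAt (by simpa using ENat.LEInfty.out)) (1, (z.2.1.2, f z), g z)
    (inclU E E' w)
  rw [o1, o2, o3, hsymm, map_sub, fderiv_connHat_symm hf (Y z).2.1.1,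
    fderiv_connHat_symm hf (Y z).2.1.2, fderiv_psiHat_symm hg]
  generalize fderiv ℝ Y z (inclU E E' w') = a1
  generalize fderiv ℝ (fderiv ℝ Y) z (inclU E E' w) (1, (z.2.1.2, f z), g z) = a2
  generalize fderiv ℝ Y z (0, (w, fderiv ℝ f z (inclU E E' w)), fderiv ℝ g z (inclU E E' w)) = a3
  ext <;> simp [-inclU_apply, -inclB_apply]
  all_goals abel

end Symmetry

lemma curv_Γ_vert {V Z : VField E M E' B} (hV : Smooth V) (hZ : Smooth Z)
    (hv : ∀ p, ∃ w, V p = vert p w) : curv (s.gluedConn D) s.Γ V Z = 0 := by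
  funext p
  have hp := mem_extChartAt_source (I := model E E') p
  have hx := (extChartAt (model E E') p).map_source hp
  have htarget := (isOpen_extChartAt_target p).mem_nhds hx
  have hf := s.contDiffAt_forceHat hp
  have hg := s.contDiffAt_slopeHat hp
  have hVc := (s.contDiffAt_frameComp_iff hp V).2 (hV p)
  have hZc := (s.contDiffAt_frameComp_iff hp Z).2 (hZ p)
  have hZd : ∀ z ∈ (extChartAt (model E E') p).target,
      DifferentiableAt ℝ (s.frameComp p Z) z := fun z hz => by
    have := (s.differentiableAt_frameComp_iff ((extChartAt (model E E') p).map_target hz) Z).2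
      (hZ.mdifferentiableAt _)
    rwa [(extChartAt (model E E') p).right_inv hz] at this
  -- the fields in the chart
  have hΓr : ∀ z ∈ (extChartAt (model E E') p).target, reading (model E E') p s.Γ z =
      (1, (z.2.1.2, s.forceHat p z), s.slopeHat p z) := fun z hz => by
    rw [← frame_frameComp, s.frameComp_Γ hz, frame_apply]
    simp
  have hVr : ∀ z ∈ (extChartAt (model E E') p).target, reading (model E E') p V z =
      inclU E E' (s.frameComp p V z).2.1.2 := fun z hz => by
    obtain ⟨w, hw⟩ := hv ((extChartAt (model E E') p).symm z)
    rw [← frame_frameComp, s.frameComp_of_mem_target hz, hw, frameVec_vert]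
    simp [frameChange, frame_apply]
  have hnV : ∀ z ∈ (extChartAt (model E E') p).target,
      s.frameComp p (nabla (s.gluedConn D) V Z) z = fderiv ℝ (s.frameComp p Z) z
        (inclU E E' (s.frameComp p V z).2.1.2) := fun z hz => by
    rw [s.frameComp_nabla D hz V (hZd z hz), hVr z hz, omega_apply, coframe_inclU]
    ext <;> simp [-inclU_apply, -inclB_apply, inclU_fst, inclU_H]
    simp
  have hnΓ : ∀ z ∈ (extChartAt (model E E') p).target,
      s.frameComp p (nabla (s.gluedConn D) s.Γ Z) z = fderiv ℝ (s.frameComp p Z) z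
        (1, (z.2.1.2, s.forceHat p z), s.slopeHat p z) +
        (0, (connHat (s.forceHat p) z (s.frameComp p Z z).2.1.1,
          connHat (s.forceHat p) z (s.frameComp p Z z).2.1.2),
          -fderiv ℝ (s.slopeHat p) z (inclB E E' (s.frameComp p Z z).2.2)) := fun z hz => by
    rw [s.frameComp_nabla D hz s.Γ (hZd z hz), hΓr z hz, omega_apply]
    simp [-inclU_apply, -inclB_apply, coframe_apply]
  obtain ⟨x, hxe⟩ : ∃ x, x = extChartAt (model E E') p p := ⟨_, rfl⟩
  rw [← hxe] at hx htarget hf hg hVc hZc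
  set f := s.forceHat p
  set g := s.slopeHat p
  set Zh := s.frameComp p Z
  set W : Model E E' → E := fun z => (s.frameComp p V z).2.1.2 with hWdef
  let G : Model E E' → Model E E' := fun z => (1, (z.2.1.2, f z), g z)
  have hf1 := (hf.differentiableAt (by simp)).hasFDerivAt
  have hg1 := (hg.differentiableAt (by simp)).hasFDerivAt
  have hg2 := ((hg.fderiv_right (m := ∞) le_rfl).differentiableAt (by simp)).hasFDerivAt
  have hc1 := ((contDiffAt_connHat hf).differentiableAt (by simp)).hasFDerivAt
  have hZ1 := (hZc.differentiableAt (by simp)).hasFDerivAt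
  have hZ2 := ((hZc.fderiv_right (m := ∞) le_rfl).differentiableAt (by simp)).hasFDerivAt
  have hW1 : HasFDerivAt W _ x := (hVc.differentiableAt (by simp)).hasFDerivAt.snd.fst.snd
  -- The computed derivative is renamed to `fderiv ℝ W x`, so that its value along Γ can be inserted
  -- as `w'` in `curvature_expression`.
  rw [hW1.fderiv.symm] at hW1
  have hUW := (inclU E E').hasFDerivAt.comp x hW1
  have hG : HasFDerivAt G _ x := (hasFDerivAt_const (1 : ℝ) x).prodMk
    (((hasFDerivAt_id (𝕜 := ℝ) x).snd.fst.snd.prodMk hf1).prodMk hg1)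
  have hA : HasFDerivAt (s.frameComp p (nabla (s.gluedConn D) V Z)) _ x :=
    (hZ2.clm_apply hUW).congr_of_eventuallyEq (by
      filter_upwards [htarget] with z hz using hnV z hz)
  have hBZ := (inclB E E').hasFDerivAt.comp x hZ1.snd.snd
  have hB : HasFDerivAt (s.frameComp p (nabla (s.gluedConn D) s.Γ Z)) _ x :=
    ((hZ2.clm_apply hG).add ((hasFDerivAt_const (0 : ℝ) x).prodMk
      (((hc1.clm_apply hZ1.snd.fst.fst).prodMk (hc1.clm_apply hZ1.snd.fst.snd)).prodMk
        (hg2.clm_apply hBZ).neg))).congr_of_eventuallyEq (by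
      filter_upwards [htarget] with z hz using hnΓ z hz)
  have hrV : HasFDerivAt (reading (model E E') p V) _ x := hUW.congr_of_eventuallyEq (by
      filter_upwards [htarget] with z hz using hVr z hz)
  have hrΓ : HasFDerivAt (reading (model E E') p s.Γ) _ x := hG.congr_of_eventuallyEq (by
      filter_upwards [htarget] with z hz using hΓr z hz)
  have hbr := reading_mlieBracket (I := model E E') hp
    (by rw [← hxe]; exact hrΓ.differentiableAt) (by rw [← hxe]; exact hrV.differentiableAt)
  rw [← hxe, hrV.fderiv, hrΓ.fderiv, hVr x hx, hΓr x hx] at hbr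
  have e1 := s.frameComp_nabla D hx s.Γ hA.differentiableAt
  have e2 := s.frameComp_nabla D hx V hB.differentiableAt
  have e3 := s.frameComp_nabla D hx (bracket s.Γ V) hZ1.differentiableAt
  rw [hA.fderiv, hΓr x hx, hnV x hx] at e1
  rw [hB.fderiv, hVr x hx, hnΓ x hx] at e2
  rw [bracket, hbr] at e3
  apply s.frameVec_injective
  have h0 := s.frameVec_zero (p := p)
  refine Eq.trans ?_ h0.symm
  have hcu : s.frameVec (curv (s.gluedConn D) s.Γ V Z p) =
      s.frameComp p (nabla (s.gluedConn D) s.Γ (nabla (s.gluedConn D) V Z)) x -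
      s.frameComp p (nabla (s.gluedConn D) V (nabla (s.gluedConn D) s.Γ Z)) x -
      s.frameComp p (nabla (s.gluedConn D) (mlieBracket (model E E') s.Γ V) Z) x := by
    rw [hxe, frameComp_self, frameComp_self, frameComp_self, ← frameVec_sub, ← frameVec_sub]
    rfl
  rw [hcu, e1, e2, e3]
  have hq2 : ((extChartAt (model E E') p).symm x).2.2 = p.2.2 := by rw [hxe, extChartAt_to_inv]
  rw [hq2]
  refine Eq.trans ?_ (curvature_expression hf hg hZc
    (christoffel D p.2.2 p.2.2) (W x)
    (fderiv ℝ W x (1, (x.2.1.2, f x), g x)))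
  simp only [Function.comp_apply, add_apply, ContinuousLinearMap.comp_apply,
    ContinuousLinearMap.prod_apply, ContinuousLinearMap.flip_apply, neg_apply, zero_apply,
    ContinuousLinearMap.coe_fst', ContinuousLinearMap.coe_snd', ContinuousLinearMap.id_apply, G]
  rfl

lemma characterizes_gluedConn : s.Characterizes D (s.gluedConn D) where
  nabla_Γ X _ := funext fun p => s.gluedFun_Γ D (X p)
  nabla_dt X _ _ hY := s.nabla_dt_gluedConn D X hY
  nabla_S X _ _ hY := s.nablaEndo_S D X hY
  nabla_Q X _ _ hY := s.nablaEndo_Q D X hY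
  nabla_vert _ _ hU hW _ hp w := s.gluedFun_vertLift D
    (((hW _ hp).contMDiffAt (hU.mem_nhds hp)).mdifferentiableAt (by simp)) w
  PH_eq _ ξ := s.PH_eq_tors D ξ
  PV_eq _ ξ := s.PV_eq_tors D ξ
  curv_eq _ _ hV hZ hv := s.curv_Γ_vert D hV hZ hv
  nabla_N X _ _ hY := s.nablaEndo_N D X hY
  nabla_cons _ _ hU hZ _ hp b := s.gluedFun_consLift D
    (((hZ _ hp).contMDiffAt (hU.mem_nhds hp)).mdifferentiableAt (by simp)) b
  tors_eq _ ξ ζ := s.tors_cons_eq D ξ ζ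

end ConstrainedSODE
end

/-! ### Uniqueness: the difference tensor of two connections. -/

noncomputable section

/-- Points of different fibres are separated over the base, points of the same fibre in a
trivialization. This provides the Hausdorff property of TM needed for cut-offs on the constraint
submanifold. -/
lemma t2Space_totalSpace {N F : Type*} [TopologicalSpace N] [TopologicalSpace F] [T2Space N]
    [T2Space F] {V : N → Type*} [TopologicalSpace (TotalSpace F V)] [∀ b, TopologicalSpace (V b)]
    [FiberBundle F V] : T2Space (TotalSpace F V) := by
  refine ⟨fun x y hxy => ?_⟩
  by_cases h : x.proj = y.proj
  · let e := trivializationAt F V x.proj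
    have hx : x ∈ e.source := by rw [e.mem_source]; exact mem_baseSet_trivializationAt F V x.proj
    have hy : y ∈ e.source := by
      rw [e.mem_source, ← h]; exact mem_baseSet_trivializationAt F V x.proj
    have hne : e x ≠ e y := fun k => hxy (e.injOn hx hy k)
    obtain ⟨u, v, hu, hv, hxu, hyv, huv⟩ := t2_separation hne
    refine ⟨e.source ∩ e ⁻¹' u, e.source ∩ e ⁻¹' v,
      e.continuousOn.isOpen_inter_preimage e.open_source hu,
      e.continuousOn.isOpen_inter_preimage e.open_source hv, ⟨hx, hxu⟩, ⟨hy, hyv⟩, ?_⟩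
    exact (huv.preimage e).mono Set.inter_subset_right Set.inter_subset_right
  · exact separated_by_continuous (FiberBundle.continuous_proj F V) h

namespace ConstrainedSODE

variable {E : Type*} [NormedAddCommGroup E] [NormedSpace ℝ E]
  {M : Type*} [TopologicalSpace M] [ChartedSpace E M] [IsManifold 𝓘(ℝ, E) ∞ M]
  {E' : Type*} [NormedAddCommGroup E'] [NormedSpace ℝ E']
  {B : Type*} [TopologicalSpace B] [ChartedSpace E' B] [IsManifold 𝓘(ℝ, E') ∞ B]

section Linear

variable (s : ConstrainedSODE E M E' B) {p : Space E M B}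

lemma θ_sub (ξ ζ : Tan E M E' B p) : θ (ξ - ζ) = θ ξ - θ ζ :=
  sub_eq_iff_eq_add.2 (by
    have h : comp ξ = comp (ξ - ζ) + comp ζ := (sub_add_cancel (comp ξ) (comp ζ)).symm
    simp only [θ, dt, h, Prod.fst_add, Prod.snd_add]
    module)

lemma ψ_sub (ξ ζ : Tan E M E' B p) : s.ψ (ξ - ζ) = s.ψ ξ - s.ψ ζ :=
  congrArg (fun c : Model E E' => c.2.1.2) (s.frameVec_sub ξ ζ)

lemma η_sub (ξ ζ : Tan E M E' B p) : s.η (ξ - ζ) = s.η ξ - s.η ζ :=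
  congrArg (fun c : Model E E' => c.2.2) (s.frameVec_sub ξ ζ)

lemma S_sub (ξ ζ : Tan E M E' B p) : S p (ξ - ζ) = S p ξ - S p ζ := by
  have h : ∀ a b : E, (vert p (a - b) : Tan E M E' B p) = vert p a - vert p b := fun a b => by
    refine Prod.ext ?_ (Prod.ext (Prod.ext ?_ ?_) ?_)
    · exact (sub_zero (0 : ℝ)).symm
    · exact (sub_zero (0 : E)).symm
    · rfl
    · exact (sub_zero (0 : E')).symm
  rw [S, θ_sub, h]; rfl

lemma Q_sub (ξ ζ : Tan E M E' B p) : s.Q p (ξ - ζ) = s.Q p ξ - s.Q p ζ := by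
  apply s.frameVec_injective
  rw [frameVec_sub, frameVec_Q, frameVec_Q, frameVec_Q, ψ_sub]
  ext <;> simp

lemma N_sub (ξ ζ : Tan E M E' B p) : s.N p (ξ - ζ) = s.N p ξ - s.N p ζ := by
  apply s.frameVec_injective
  rw [frameVec_sub, frameVec_N, frameVec_N, frameVec_N, η_sub]
  ext <;> simp

lemma S_horiz (a : E) : S p (s.horiz p a) = vert p a := by
  simp [S, θ, horiz, vec, comp, dt]

lemma Q_vert (w : E) : s.Q p (vert p w : Tan E M E' B p) = s.horiz p w := by
  have := congrArg (fun c : Model E E' => c.2.1.2) (s.frameVec_vert (p := p) w)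
  exact congrArg (s.horiz p) this

lemma N_cons (b : E') : s.N p (cons p b : Tan E M E' B p) = cons p b := by
  have := congrArg (fun c : Model E E' => c.2.2) (s.frameVec_cons (p := p) b)
  exact congrArg (cons p) this

lemma S_zero : S p (0 : Tan E M E' B p) = 0 := by
  have := S_sub (0 : Tan E M E' B p) 0
  rwa [sub_zero, sub_self] at this

lemma Q_zero : s.Q p (0 : Tan E M E' B p) = 0 := by
  have := s.Q_sub (0 : Tan E M E' B p) 0
  rwa [sub_zero, sub_self] at this

lemma frame_decomposition (ξ : Tan E M E' B p) :
    ξ = dt ξ • s.Γ p + s.horiz p (θ ξ) + vert p (s.ψ ξ) + cons p (s.η ξ) := by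
  apply s.frameVec_injective
  rw [frameVec_add, frameVec_add, frameVec_add, frameVec_smul, frameVec_Γ, frameVec_horiz,
    frameVec_vert, frameVec_cons]
  ext <;> simp [frameVec]

end Linear

variable [FiniteDimensional ℝ E] [FiniteDimensional ℝ E']

variable (s : ConstrainedSODE E M E' B) {p q : Space E M B}

lemma smooth_of_block {a h v n k l : ℝ} {Y Y' : VField E M E' B} (hY : Smooth Y)
    (hb : ∀ p, ∀ z ∈ (extChartAt (model E E') p).target,
      s.frameComp p Y' z = block a h v n k l (s.frameComp p Y z)) : Smooth Y' := fun p => by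
  have hp := mem_extChartAt_source (I := model E E') p
  rw [← s.contDiffAt_frameComp_iff hp]
  refine ((block a h v n k l).contDiff.contDiffAt.comp _
    ((s.contDiffAt_frameComp_iff hp Y).2 (hY p))).congr_of_eventuallyEq ?_
  filter_upwards [(isOpen_extChartAt_target p).mem_nhds
    ((extChartAt (model E E') p).map_source hp)] with z hz
  exact hb p z hz

include s in
lemma Smooth.app_S {Y : VField E M E' B} (hY : Smooth Y) : Smooth (app S Y) :=
  s.smooth_of_block (a := 0) (h := 0) (v := 0) (n := 0) (k := 0) (l := 1) hY
    fun p z hz => by simp [s.frameComp_S hz, block_apply]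

lemma Smooth.app_Q {Y : VField E M E' B} (hY : Smooth Y) : Smooth (app s.Q Y) :=
  s.smooth_of_block (a := 0) (h := 0) (v := 0) (n := 0) (k := 1) (l := 0) hY
    fun p z hz => by simp [s.frameComp_Q hz, block_apply]

lemma Smooth.app_N {Y : VField E M E' B} (hY : Smooth Y) : Smooth (app s.N Y) :=
  s.smooth_of_block (a := 0) (h := 0) (v := 0) (n := 1) (k := 0) (l := 0) hY
    fun p z hz => by simp [s.frameComp_N hz, block_apply]

lemma Smooth.nabla {C : Conn E M E' B} (hC : CovariantDerivative.ContMDiffCovariantDerivative C ∞)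
    {X Y : VField E M E' B} (hX : Smooth X) (hY : Smooth Y) : Smooth (nabla C X Y) := fun p => by
  have h1 := hC.contMDiff.contMDiff (σ := Y) (ContMDiff.contMDiffOn hY)
  have h2 := (h1 p (Set.mem_univ _)).contMDiffAt Filter.univ_mem
  exact h2.clm_bundle_apply (hX p)

lemma exists_smooth_eq [T2Space M] [T2Space B] (ξ : Tan E M E' B p) :
    ∃ X : VField E M E' B, Smooth X ∧ X p = ξ := by
  have : T2Space (TangentBundle 𝓘(ℝ, E) M) := t2Space_totalSpace
  have hp := mem_extChartAt_source (I := model E E') p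
  obtain ⟨X, hX, hXe⟩ := exists_contMDiff_eventuallyEq (I := model E E') (q := p)
    (X := chartConst (model E E') p (chartDeriv (model E E') p p ξ)) (by
      filter_upwards [(isOpen_extChartAt_source (I := model E E') p).mem_nhds hp] with q hq
      exact contMDiffAt_chartConst hq _)
  exact ⟨X, hX, hXe.eq_of_nhds.trans (chartDeriv_inverse_apply_self hp ξ)⟩

/-- The difference of two connections. -/
def diff (C' C : Conn E M E' B) (p : Space E M B) :
    Tan E M E' B p →L[ℝ] Tan E M E' B p →L[ℝ] Tan E M E' B p :=
  C'.isCovariantDerivativeOnUniv.difference C.isCovariantDerivativeOnUniv p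

section Difference

variable {C' C : Conn E M E' B}

lemma diff_apply {Y : VField E M E' B}
    (hY : MDifferentiableAt (model E E') (model E E').tangent
      (fun q => (⟨q, Y q⟩ : TangentBundle (model E E') (Space E M B))) p) (ξ : Tan E M E' B p) :
    diff C' C p (Y p) ξ = C' Y p ξ - C Y p ξ :=
  congr($(IsCovariantDerivativeOn.difference_apply C'.isCovariantDerivativeOnUniv
    C.isCovariantDerivativeOnUniv (x := p) (Set.mem_univ _) hY) ξ)

/-- The brackets cancel. In `diff C' C p ζ ξ` the first vector is the value of the differentiated
field and the second is the direction. -/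
lemma tors_sub_tors (ξ ζ : Tan E M E' B p) :
    tors C' ξ ζ - tors C ξ ζ = diff C' C p ζ ξ - diff C' C p ξ ζ := by
  have hp := mem_extChartAt_source (I := model E E') p
  have hX := mdifferentiableAt_chartConst hp (chartDeriv (model E E') p p ξ)
  have hY := mdifferentiableAt_chartConst hp (chartDeriv (model E E') p p ζ)
  set X : VField E M E' B := chartConst (model E E') p (chartDeriv (model E E') p p ξ) with hXd
  set Y : VField E M E' B := chartConst (model E E') p (chartDeriv (model E E') p p ζ) with hYd
  have hXp : X p = ξ := chartDeriv_inverse_apply_self hp ξ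
  have hYp : Y p = ζ := chartDeriv_inverse_apply_self hp ζ
  have h1 : tors C' (X p) (Y p) = C' Y p (X p) - C' X p (Y p) - bracket X Y p :=
    C'.torsion_apply hX hY
  have h2 : tors C (X p) (Y p) = C Y p (X p) - C X p (Y p) - bracket X Y p :=
    C.torsion_apply hX hY
  rw [← hXp, ← hYp, h1, h2, diff_apply hX, diff_apply hY]
  abel

variable [T2Space M] [T2Space B]

/-- A tensor parallel for both connections commutes with their difference; smooth fields through the
given vectors reduce the identity to ∇A = 0. -/
lemma diff_endo {A : ∀ p : Space E M B, Tan E M E' B p → Tan E M E' B p}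
    (hA : ∀ p (ξ ζ : Tan E M E' B p), A p (ξ - ζ) = A p ξ - A p ζ)
    (hs : ∀ Y : VField E M E' B, Smooth Y → Smooth (app A Y))
    (h' : ∀ X Y, Smooth X → Smooth Y → nablaEndo C' A X Y = 0)
    (h : ∀ X Y, Smooth X → Smooth Y → nablaEndo C A X Y = 0) (ζ ξ : Tan E M E' B p) :
    diff C' C p (A p ζ) ξ = A p (diff C' C p ζ ξ) := by
  obtain ⟨X, hX, rfl⟩ := exists_smooth_eq ξ
  obtain ⟨Y, hY, rfl⟩ := exists_smooth_eq ζ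
  have h1 : C' (app A Y) p (X p) - A p (C' Y p (X p)) = 0 := congrFun (h' X Y hX hY) p
  have h2 : C (app A Y) p (X p) - A p (C Y p (X p)) = 0 := congrFun (h X Y hX hY) p
  have h3 := diff_apply (C' := C') (C := C) ((hs Y hY).mdifferentiableAt p) (X p)
  refine h3.trans ?_
  rw [diff_apply (hY.mdifferentiableAt p), hA, sub_eq_zero.1 h1, sub_eq_zero.1 h2]

variable {s} {D : CovariantDerivative 𝓘(ℝ, E') E' (TangentSpace 𝓘(ℝ, E') : B → Type _)}
  (h' : s.Characterizes D C') (h : s.Characterizes D C)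

include h' h

lemma Characterizes.diff_S (ζ ξ : Tan E M E' B p) :
    diff C' C p (S p ζ) ξ = S p (diff C' C p ζ ξ) :=
  diff_endo (fun _ => S_sub) (fun _ => Smooth.app_S s) h'.nabla_S h.nabla_S ζ ξ

lemma Characterizes.diff_Q (ζ ξ : Tan E M E' B p) :
    diff C' C p (s.Q p ζ) ξ = s.Q p (diff C' C p ζ ξ) :=
  diff_endo (fun _ => s.Q_sub) (fun _ => Smooth.app_Q s) h'.nabla_Q h.nabla_Q ζ ξ

lemma Characterizes.diff_N (ζ ξ : Tan E M E' B p) :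
    diff C' C p (s.N p ζ) ξ = s.N p (diff C' C p ζ ξ) :=
  diff_endo (fun _ => s.N_sub) (fun _ => Smooth.app_N s) h'.nabla_N h.nabla_N ζ ξ

lemma Characterizes.diff_Γ (ξ : Tan E M E' B p) : diff C' C p (s.Γ p) ξ = 0 := by
  obtain ⟨X, hX, rfl⟩ := exists_smooth_eq ξ
  have h1 : C' s.Γ p (X p) = 0 := congrFun (h'.nabla_Γ X hX) p
  have h2 : C s.Γ p (X p) = 0 := congrFun (h.nabla_Γ X hX) p
  rw [diff_apply (s.smooth_Γ.mdifferentiableAt p), h1, h2, sub_zero]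

lemma Characterizes.diff_vert_vert (w v : E) : diff C' C p (vert p w) (vert p v) = 0 := by
  have hps := mem_extChartAt_source (I := 𝓘(ℝ, E)) p.2.1.1
  let W : ∀ x : M, TangentSpace 𝓘(ℝ, E) x :=
    chartConst 𝓘(ℝ, E) p.2.1.1 (chartDeriv 𝓘(ℝ, E) p.2.1.1 p.2.1.1 w)
  have hW : ContMDiffOn 𝓘(ℝ, E) 𝓘(ℝ, E).tangent ∞
      (fun x => (⟨x, W x⟩ : TangentBundle 𝓘(ℝ, E) M)) (extChartAt 𝓘(ℝ, E) p.2.1.1).source :=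
    fun x hx => (contMDiffAt_chartConst hx _).contMDiffWithinAt
  have hWp : (vertLift W p : Tan E M E' B p) = vert p w :=
    congrArg (fun w : E => (vert p w : Tan E M E' B p))
      (chartDeriv_inverse_apply_self (I := 𝓘(ℝ, E)) hps w)
  have h1 := h'.nabla_vert _ W (isOpen_extChartAt_source _) hW p hps v
  have h2 := h.nabla_vert _ W (isOpen_extChartAt_source _) hW p hps v
  have h3 : MDifferentiableAt (model E E') (model E E').tangent
      (fun q => (⟨q, vertLift W q⟩ : TangentBundle (model E E') (Space E M B))) p :=
    (s.differentiableAt_frameComp_iff (mem_extChartAt_source p) _).1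
      (s.hasFDerivAt_frameComp_vertLift (mdifferentiableAt_chartConst hps _)).differentiableAt
  rw [← hWp, diff_apply h3, h1, h2, sub_zero]

lemma Characterizes.diff_cons_cons (b c : E') : diff C' C p (cons p b) (cons p c) = 0 := by
  have hps := mem_extChartAt_source (I := 𝓘(ℝ, E')) p.2.2
  let Z : ∀ y : B, TangentSpace 𝓘(ℝ, E') y :=
    chartConst 𝓘(ℝ, E') p.2.2 (chartDeriv 𝓘(ℝ, E') p.2.2 p.2.2 b)
  have hZ : ContMDiffOn 𝓘(ℝ, E') 𝓘(ℝ, E').tangent ∞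
      (fun y => (⟨y, Z y⟩ : TangentBundle 𝓘(ℝ, E') B)) (extChartAt 𝓘(ℝ, E') p.2.2).source :=
    fun x hx => (contMDiffAt_chartConst hx _).contMDiffWithinAt
  have hZp : (consLift Z p : Tan E M E' B p) = cons p b :=
    congrArg (fun b : E' => (cons p b : Tan E M E' B p))
      (chartDeriv_inverse_apply_self (I := 𝓘(ℝ, E')) hps b)
  have h1 := h'.nabla_cons _ Z (isOpen_extChartAt_source _) hZ p hps c
  have h2 := h.nabla_cons _ Z (isOpen_extChartAt_source _) hZ p hps c
  have h3 : MDifferentiableAt (model E E') (model E E').tangent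
      (fun q => (⟨q, consLift Z q⟩ : TangentBundle (model E E') (Space E M B))) p :=
    (s.differentiableAt_frameComp_iff (mem_extChartAt_source p) _).1
      (s.hasFDerivAt_frameComp_consLift (mdifferentiableAt_chartConst hps _)).differentiableAt
  rw [← hZp, diff_apply h3, h1, h2, sub_self]

/-- The condition on P_H fixes T(Γ, V), and the difference kills Γ as argument, so the torsion
difference is this single term. -/
lemma Characterizes.diff_vert_Γ (w : E) : diff C' C p (vert p w) (s.Γ p) = 0 := by
  have h1 := h'.PH_eq p (s.horiz p w)
  have h2 := h.PH_eq p (s.horiz p w)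
  rw [S_horiz] at h1 h2
  have h3 := tors_sub_tors (C' := C') (C := C) (s.Γ p) (vert p w)
  rwa [← h1, ← h2, sub_self, h'.diff_Γ h, sub_zero, eq_comm] at h3

/-- Q carries V_a to H_a and commutes with the difference. -/
lemma Characterizes.diff_horiz (w : E) (ξ : Tan E M E' B p)
    (hξ : diff C' C p (vert p w) ξ = 0) : diff C' C p (s.horiz p w) ξ = 0 := by
  rw [← Q_vert, h'.diff_Q h, hξ, Q_zero]

lemma Characterizes.diff_cons_and_diff (ξ ζ : Tan E M E' B p) :
    diff C' C p (s.N p ζ) (ξ - s.N p ξ) = 0 ∧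
      diff C' C p (ξ - s.N p ξ) (s.N p ζ) = s.PV p (diff C' C p (ξ - s.N p ξ) (s.N p ζ)) := by
  have hN : s.N p (ξ - s.N p ξ) = 0 := by rw [N_sub, N, N_cons, sub_self]
  have e1 := sub_eq_zero.1 (h'.tors_eq p ξ ζ)
  have e2 := sub_eq_zero.1 (h.tors_eq p ξ ζ)
  have e3 := tors_sub_tors (C' := C') (C := C) (ξ - s.N p ξ) (s.N p ζ)
  -- The difference preserves the kernel and the image of N, so the two terms of the torsion
  -- difference lie in complementary subspaces. The torsion difference is vertical, which N
  -- annihilates.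
  have a1 : s.N p (diff C' C p (ξ - s.N p ξ) (s.N p ζ)) = 0 := by
    rw [← h'.diff_N h, hN, map_zero]; rfl
  have a2 : s.N p (diff C' C p (s.N p ζ) (ξ - s.N p ξ)) =
      diff C' C p (s.N p ζ) (ξ - s.N p ξ) := by
    rw [h'.diff_N h]
    exact s.N_cons _
  have hV : ∀ χ : Tan E M E' B p, s.N p (s.PV p χ) = 0 := fun χ => by
    apply s.frameVec_injective
    rw [frameVec_N, frameVec_zero]
    have := congrArg (fun c : Model E E' => c.2.2) (s.frameVec_PV χ)
    simp only [frameVec] at this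
    rw [this]; rfl
  have a3 : s.N p (tors C' (ξ - s.N p ξ) (s.N p ζ) - tors C (ξ - s.N p ξ) (s.N p ζ)) = 0 := by
    rw [e1, e2, N_sub, hV, hV, sub_zero]
  rw [e3, N_sub, a1, a2, sub_zero] at a3
  refine ⟨a3, ?_⟩
  have hPs : ∀ χ χ' : Tan E M E' B p, s.PV p (χ - χ') = s.PV p χ - s.PV p χ' := fun χ χ' => by
    apply s.frameVec_injective
    rw [frameVec_sub, frameVec_PV, frameVec_PV, frameVec_PV, ψ_sub]
    ext <;> simp
  have a4 : tors C' (ξ - s.N p ξ) (s.N p ζ) - tors C (ξ - s.N p ξ) (s.N p ζ) =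
      s.PV p (tors C' (ξ - s.N p ξ) (s.N p ζ) - tors C (ξ - s.N p ξ) (s.N p ζ)) := by
    rw [hPs, ← e1, ← e2]
  rw [e3, a3, hPs] at a4
  have hP0 : s.PV p 0 = 0 := by simpa using hPs 0 0
  rw [hP0, zero_sub, zero_sub] at a4
  exact neg_injective a4

lemma Characterizes.diff_cons (b : E') (ξ : Tan E M E' B p) :
    diff C' C p (cons p b) ξ = 0 := by
  have h1 := (h'.diff_cons_and_diff h ξ (cons p b)).1
  rw [N_cons, map_sub] at h1
  rw [sub_eq_zero.1 h1]
  exact h'.diff_cons_cons h b _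

/-- The value is vertical by the torsion condition, and horizontal because H_a = Q(V_a) and the
difference commutes with Q. -/
lemma Characterizes.diff_horiz_cons (w : E) (b : E') :
    diff C' C p (s.horiz p w) (cons p b) = 0 := by
  have hN : s.N p (s.horiz p w) = 0 := by
    have := congrArg (fun c : Model E E' => c.2.2) (s.frameVec_horiz (p := p) w)
    apply s.frameVec_injective
    rw [frameVec_N, frameVec_zero]
    simp only [frameVec] at this
    rw [this]; rfl
  have h1 := (h'.diff_cons_and_diff h (s.horiz p w) (cons p b)).2
  rw [N_cons, hN, sub_zero] at h1
  have h2 := h'.diff_Q h (vert p w) (cons p b)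
  rw [Q_vert] at h2
  apply s.frameVec_injective
  have h3 := s.frameVec_PV (diff C' C p (s.horiz p w) (cons p b))
  rw [← h1] at h3
  have h4 := s.frameVec_Q (diff C' C p (vert p w) (cons p b))
  rw [← h2] at h4
  have h5 := congrArg (fun c : Model E E' => c.2.1.2) h4
  have h6 : s.ψ (diff C' C p (s.horiz p w) (cons p b)) = 0 := h5
  rw [h3, h6, frameVec_zero]
  rfl

/-- S carries H_a to V_a, so the vanishing on H_a is transported by S. -/
lemma Characterizes.diff_vert_cons (w : E) (b : E') :
    diff C' C p (vert p w) (cons p b) = 0 := by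
  rw [← S_horiz s, h'.diff_S h, h'.diff_horiz_cons h, S_zero]

/-- The difference applied to `Γ`, to a vertical vector and to a vector of the block of
`∂/∂x^α` vanishes. -/
lemma Characterizes.diff_eq (ζ ξ : Tan E M E' B p) :
    diff C' C p ζ ξ = diff C' C p ζ (s.horiz p (θ ξ)) := by
  -- For a fixed direction it suffices to test vertical arguments: Γ and ∂/∂x^α always give zero,
  -- and H_a follows from V_a.
  have key : ∀ χ : Tan E M E' B p, (∀ w, diff C' C p (vert p w) χ = 0) → diff C' C p ζ χ = 0 :=
    fun χ hχ => by
      rw [s.frame_decomposition ζ]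
      simp only [map_add, map_smul, add_apply, smul_apply]
      rw [h'.diff_Γ h, h'.diff_cons h, hχ, h'.diff_horiz h _ _ (hχ _)]
      simp
  conv_lhs => rw [s.frame_decomposition ξ]
  rw [map_add, map_add, map_add, map_smul, key _ (fun w => h'.diff_vert_Γ h w),
    key _ (fun w => h'.diff_vert_vert h w _), key _ (fun w => h'.diff_vert_cons h w _)]
  simp

lemma Characterizes.diff_horiz_right
    (hC : CovariantDerivative.ContMDiffCovariantDerivative C ∞) (ζ : Tan E M E' B p) (w : E) :
    diff C' C p ζ (s.horiz p w) = 0 := by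
  obtain ⟨Z, hZ, hZp⟩ := exists_smooth_eq ζ
  obtain ⟨X, hX, hXp⟩ := exists_smooth_eq (s.horiz p w)
  -- S(X) is smooth, vertical everywhere and equal to w^a V_a at p, since S carries H_a to V_a.
  set V : VField E M E' B := app S X with hVd
  have hV : Smooth V := hX.app_S s
  have hVp : V p = vert p w := by rw [hVd, app, hXp, S_horiz]
  have hθ0 : ∀ q, θ (V q) = 0 := fun q => by
    have := congrArg (fun c : Model E E' => c.2.1.1) (s.frameVec_S (X q))
    exact this
  have hh0 : ∀ q : Space E M B, s.horiz q 0 = 0 := fun q => by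
    apply s.frameVec_injective; rw [frameVec_horiz, frameVec_zero]; rfl
  have hv0 : ∀ q : Space E M B, (vert q 0 : Tan E M E' B q) = 0 := fun q => by
    apply s.frameVec_injective; rw [frameVec_vert, frameVec_zero]; rfl
  have hΓθ : ∀ q, θ (s.Γ q) = 0 := fun q =>
    congrArg (fun c : Model E E' => c.2.1.1) (s.frameVec_Γ (p := q))
  have eq0 : ∀ (q : Space E M B) (χ ξ : Tan E M E' B q), θ ξ = 0 → diff C' C q χ ξ = 0 :=
    fun q χ ξ hξ => by rw [h'.diff_eq h, hξ, hh0, map_zero]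
  have n1 : nabla C' V Z = nabla C V Z := funext fun q => by
    have := diff_apply (C' := C') (C := C) (hZ.mdifferentiableAt q) (V q)
    rw [eq0 q _ _ (hθ0 q)] at this
    exact sub_eq_zero.1 this.symm
  have n2 : nabla C' s.Γ Z = nabla C s.Γ Z := funext fun q => by
    have := diff_apply (C' := C') (C := C) (hZ.mdifferentiableAt q) (s.Γ q)
    rw [eq0 q _ _ (hΓθ q)] at this
    exact sub_eq_zero.1 this.symm
  have n3 : C' (nabla C V Z) p (s.Γ p) = C (nabla C V Z) p (s.Γ p) := by
    have := diff_apply (C' := C') (C := C) ((hV.nabla hC hZ).mdifferentiableAt p) (s.Γ p)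
    rw [eq0 p _ _ (hΓθ p)] at this
    exact sub_eq_zero.1 this.symm
  have n4 : C' (nabla C s.Γ Z) p (V p) = C (nabla C s.Γ Z) p (V p) := by
    have := diff_apply (C' := C') (C := C) ((s.smooth_Γ.nabla hC hZ).mdifferentiableAt p) (V p)
    rw [eq0 p _ _ (hθ0 p)] at this
    exact sub_eq_zero.1 this.symm
  have c1 : C' (nabla C' V Z) p (s.Γ p) - C' (nabla C' s.Γ Z) p (V p) -
      C' Z p (bracket s.Γ V p) = 0 :=
    congrFun (h'.curv_eq V Z hV hZ fun q => ⟨_, rfl⟩) p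
  have c2 : C (nabla C V Z) p (s.Γ p) - C (nabla C s.Γ Z) p (V p) -
      C Z p (bracket s.Γ V p) = 0 :=
    congrFun (h.curv_eq V Z hV hZ fun q => ⟨_, rfl⟩) p
  rw [n1, n2, n3, n4] at c1
  -- Both connections agree along Γ and V, so the iterated derivatives in the two curvature
  -- identities coincide, and only the derivatives along [Γ, V] remain to be compared.
  have d1 : diff C' C p ζ (bracket s.Γ V p) = 0 := by
    have := diff_apply (C' := C') (C := C) (hZ.mdifferentiableAt p) (bracket s.Γ V p)
    rw [hZp] at this
    rw [this, ← sub_eq_zero.1 c1, ← sub_eq_zero.1 c2, sub_self]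
  -- the horizontal component of the bracket
  have t1 : tors C (s.Γ p) (V p) = C V p (s.Γ p) - C s.Γ p (V p) - bracket s.Γ V p :=
    C.torsion_apply (s.smooth_Γ.mdifferentiableAt p) (hV.mdifferentiableAt p)
  have t2 : C s.Γ p (V p) = 0 := congrFun (h.nabla_Γ V hV) p
  -- S is parallel and S(V) = 0, so S(∇_Γ V) = ∇_Γ(S(V)) = 0.
  have t3 : S p (C V p (s.Γ p)) = 0 := by
    have u1 : C (app S V) p (s.Γ p) - S p (C V p (s.Γ p)) = 0 :=
      congrFun (h.nabla_S s.Γ V s.smooth_Γ hV) p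
    have u2 : app S V = 0 := funext fun q => by
      have : app S V q = vert q (θ (V q)) := rfl
      rw [this, hθ0, hv0]; rfl
    rw [u2, CovariantDerivative.zero] at u1
    have := sub_eq_zero.1 u1
    rw [← this]; rfl
  have t4 := h.PV_eq p (V p)
  rw [t1, t2, sub_zero, S_sub, t3, zero_sub] at t4
  -- The condition on P_V now reads V = -S([Γ, V]) at p, which gives the horizontal part of the
  -- bracket.
  have t5 : θ (bracket s.Γ V p) = -w := by
    have u1 := congrArg s.frameVec t4
    have u2 : s.frameVec (-S p (bracket s.Γ V p)) = -s.frameVec (S p (bracket s.Γ V p)) := by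
      have := s.frameVec_sub 0 (S p (bracket s.Γ V p))
      rwa [zero_sub, frameVec_zero, zero_sub] at this
    rw [u2, frameVec_S, frameVec_PV, hVp] at u1
    have u3 := congrArg (fun c : Model E E' => c.2.1.2) u1
    have u4 := congrArg (fun c : Model E E' => c.2.1.2) (s.frameVec_vert (p := p) w)
    have u5 : w = -θ (bracket s.Γ V p) := u4.symm.trans u3
    rw [u5, neg_neg]
  rw [h'.diff_eq h, t5] at d1
  have hneg : s.horiz p (-w) = -s.horiz p w := by
    apply s.frameVec_injective
    have := s.frameVec_sub 0 (s.horiz p w)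
    rw [zero_sub, frameVec_zero, zero_sub] at this
    rw [this, frameVec_horiz, frameVec_horiz]
    ext <;> simp
  rw [hneg, map_neg] at d1
  exact neg_eq_zero.1 d1

lemma Characterizes.eq_of_mdifferentiableAt
    (hC : CovariantDerivative.ContMDiffCovariantDerivative C ∞) {Y : VField E M E' B}
    (hY : MDifferentiableAt (model E E') (model E E').tangent
      (fun q => (⟨q, Y q⟩ : TangentBundle (model E E') (Space E M B))) p) :
    C' Y p = C Y p := by
  refine ContinuousLinearMap.ext fun ξ => ?_
  have := diff_apply (C' := C') (C := C) hY ξ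
  rw [h'.diff_eq h, h'.diff_horiz_right h hC] at this
  exact sub_eq_zero.1 this.symm

end Difference

end ConstrainedSODE
end

theorem theorem4p1
    {E : Type*} [NormedAddCommGroup E] [NormedSpace ℝ E] [FiniteDimensional ℝ E]
    {M : Type*} [TopologicalSpace M] [T2Space M] [ChartedSpace E M] [IsManifold 𝓘(ℝ, E) ∞ M]
    {E' : Type*} [NormedAddCommGroup E'] [NormedSpace ℝ E'] [FiniteDimensional ℝ E']
    {B : Type*} [TopologicalSpace B] [T2Space B] [ChartedSpace E' B] [IsManifold 𝓘(ℝ, E') ∞ B]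
    (s : ConstrainedSODE E M E' B)
    (D : CovariantDerivative 𝓘(ℝ, E') E' (TangentSpace 𝓘(ℝ, E') : B → Type _))
    (hD : CovariantDerivative.ContMDiffCovariantDerivative D ∞) :
    ∃ C : ConstrainedSODE.Conn E M E' B,
      CovariantDerivative.ContMDiffCovariantDerivative C ∞ ∧
      (∀ X Y, ConstrainedSODE.Smooth X → ConstrainedSODE.Smooth Y →
        ConstrainedSODE.nabla C X Y = s.glued D X Y) ∧
      (∀ X Y, ConstrainedSODE.Smooth X → ConstrainedSODE.Smooth Y →
        ConstrainedSODE.nabla C X Y = s.explicit D X Y) ∧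
      s.Characterizes D C ∧
      ∀ C' : ConstrainedSODE.Conn E M E' B,
        CovariantDerivative.ContMDiffCovariantDerivative C' ∞ → s.Characterizes D C' →
        ∀ (Y : ConstrainedSODE.VField E M E' B) (p : ConstrainedSODE.Space E M B),
          MDifferentiableAt (ConstrainedSODE.model E E') (ConstrainedSODE.model E E').tangent
            (fun q => (⟨q, Y q⟩ : TangentBundle (ConstrainedSODE.model E E')
              (ConstrainedSODE.Space E M B))) p →
          C' Y p = C Y p := by
  refine ⟨s.gluedConn D, s.contMDiff_gluedConn D hD, fun X Y hX hY => funext fun p => ?_,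
    fun X Y hX hY => funext fun p => ?_, s.characterizes_gluedConn D, fun C' _ h' Y p hY =>
      h'.eq_of_mdifferentiableAt (s.characterizes_gluedConn D) (s.contMDiff_gluedConn D hD) hY⟩
  · rw [s.glued_eq_explicit D (hX.mdifferentiableAt p) (hY.mdifferentiableAt p)]
    exact s.gluedFun_eq_explicit D (hX.mdifferentiableAt p) (hY.mdifferentiableAt p)
  · exact s.gluedFun_eq_explicit D (hX.mdifferentiableAt p) (hY.mdifferentiableAt p)
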